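/- Let $0<\alpha\le 1$, $c,\varepsilon\in\mathbb{R}$ with $|\varepsilon|<1$, $0<\delta<1$, and let $\Omega=(0,1)\times(-\pi,\pi)$. Let $D_x^\alpha u(x,y)=\frac{1}{\Gamma(1-\alpha)}\int_0^x (x-s)^{-\alpha}\,\frac{\partial u}{\partial s}(s,y)\,ds$ for $\alpha<1$ and $D_x^1u=u_x$ (Caputo derivative). A regular solution of $$D_x^\alpha D_x^\alpha u(x,y)+u_{yy}(x,y)-\varepsilon\,u_{yy}(x,-y)-c^2u(x,y)=0,\qquad (x,y)\in\Omega, \qquad (1)$$ is a function $u\in C(\overline\Omega)$ for which $D_x^\alpha u$, $D_x^\alpha D_x^\alpha u$, $u_{yy}$ exist and belong to $C(\Omega)$, and which satisfies (1). Problem N: find a regular solution $u$ of (1) with $u_y\in C(\overline\Omega)$, with $u(0,y)=\varphi(y)$ and $u(1,y)=\psi(y)$ for $-\pi\le y\le\pi$, and with $u_y(x,-\pi)=u_y(x,\pi)=0$ for $0\le x\le 1$. Theorem. Let $\varphi\in C^{3+\delta}[-\pi,\pi]$ and $\psi\in C^{2+\delta}[-\pi,\pi]$ with $\varphi'(\pm\pi)=\psi'(\pm\pi)=0$.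 Then Problem N has a solution, the solution is unique (on $\overline\Omega$), and for all $(x,y)\in\overline\Omega$ $$u(x,y)=u_0(x)+\sum_{k=0}^\infty\big[\varphi^{s}_k\,C_{\mu_k}(x)+\psi^{s}_k\,S_{\mu_k}(x)\big]\sin\big((k+\tfrac12)y\big)+\sum_{k=1}^\infty\big[\varphi^{c}_k\,C_{\nu_k}(x)+\psi^{c}_k\,S_{\nu_k}(x)\big]\cos(ky),$$ where both series converge absolutely. Here, for $f\in\{\varphi,\psi\}$, $f^{s}_k=\frac1\pi\int_{-\pi}^{\pi}f(y)\sin((k+\frac12)y)\,dy$, $f^{c}_k=\frac1\pi\int_{-\pi}^{\pi}f(y)\cos(ky)\,dy$ and $f_0=\frac1{2\pi}\int_{-\pi}^{\pi}f(y)\,dy$; moreover $\mu_k=\sqrt{(1+\varepsilon)(k+\frac12)^2+c^2}$ and $\nu_k=\sqrt{(1-\varepsilon)k^2+c^2}$; for $\mu>0$, $$C_\mu(x)=\frac{E_{\alpha,1}(\mu)E_{\alpha,1}(-\mu x^\alpha)-E_{\alpha,1}(-\mu)E_{\alpha,1}(\mu x^\alpha)}{2\mu E_{2\alpha,\alpha+1}(\mu^2)},\qquad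 S_\mu(x)=\frac{x^\alpha E_{2\alpha,\alpha+1}(\mu^2x^{2\alpha})}{E_{2\alpha,\alpha+1}(\mu^2)},$$ with the Mittag-Leffler function $E_{\alpha,\beta}(z)=\sum_{k=0}^\infty z^k/\Gamma(\alpha k+\beta)$; and $$u_0(x)=\begin{cases}(1-x^\alpha)\varphi_0+x^\alpha\psi_0, & c=0,\\ \varphi_0\,C_{|c|}(x)+\psi_0\,S_{|c|}(x), & c\neq 0.\end{cases}$$ -/

import Mathlib

open Set MeasureTheory
open scoped NNReal Real

noncomputable section

namespace FracHelmholtz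

/-- The Caputo derivative of order `α ∈ (0, 1]` with base point `0`; for `α = 1` it is the
ordinary derivative. -/
def caputoDeriv (α : ℝ) (f : ℝ → ℝ) (x : ℝ) : ℝ :=
  if α = 1 then deriv f x
  else (Real.Gamma (1 - α))⁻¹ * ∫ s in (0 : ℝ)..x, (x - s) ^ (-α) * deriv f s

/-- The Caputo derivative of order `α` of `f` exists at every point of `(0, 1)`: `f` is
differentiable on `(0, 1)` and, if `α < 1`, the defining integrals converge absolutely. -/
def CaputoDifferentiable (α : ℝ) (f : ℝ → ℝ) : Prop :=
  ∀ x ∈ Ioo (0 : ℝ) 1, DifferentiableAt ℝ f x ∧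
    (α < 1 → IntervalIntegrable (fun s => (x - s) ^ (-α) * deriv f s) volume 0 x)

/-- The open rectangle `Ω = (0, 1) × (-π, π)`. -/
def Omega : Set (ℝ × ℝ) := Ioo (0 : ℝ) 1 ×ˢ Ioo (-π) π

/-- The closed rectangle `[0, 1] × [-π, π]`. -/
def OmegaBar : Set (ℝ × ℝ) := Icc (0 : ℝ) 1 ×ˢ Icc (-π) π

/-- `D_x^α u (x, y)`. -/
def dx (α : ℝ) (u : ℝ → ℝ → ℝ) (x y : ℝ) : ℝ := caputoDeriv α (fun s => u s y) x

/-- `u_yy (x, y)`. -/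
def uyy (u : ℝ → ℝ → ℝ) (x y : ℝ) : ℝ := deriv (deriv (u x)) y

/-- Regular solutions in `Ω` of
`D_x^α D_x^α u(x, y) + u_yy(x, y) - ε u_yy(x, -y) - c² u(x, y) = 0`:
`u` is continuous on the closed rectangle, and `D_x^α u`, `D_x^α D_x^α u`, `u_yy` exist and
are continuous in the open one. -/
structure IsRegularSolution (α ε c : ℝ) (u : ℝ → ℝ → ℝ) : Prop where
  continuousOn : ContinuousOn (fun p : ℝ × ℝ => u p.1 p.2) OmegaBar
  dx_exists : ∀ y ∈ Ioo (-π) π, CaputoDifferentiable α (fun x => u x y)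
  dx_continuousOn : ContinuousOn (fun p : ℝ × ℝ => dx α u p.1 p.2) Omega
  dxdx_exists : ∀ y ∈ Ioo (-π) π, CaputoDifferentiable α (fun x => dx α u x y)
  dxdx_continuousOn : ContinuousOn (fun p : ℝ × ℝ => dx α (dx α u) p.1 p.2) Omega
  uy_exists : ∀ p ∈ Omega, DifferentiableAt ℝ (u p.1) p.2
  uyy_exists : ∀ p ∈ Omega, DifferentiableAt ℝ (deriv (u p.1)) p.2
  uyy_continuousOn : ContinuousOn (fun p : ℝ × ℝ => uyy u p.1 p.2) Omega
  equation : ∀ x ∈ Ioo (0 : ℝ) 1, ∀ y ∈ Ioo (-π) π,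
    dx α (dx α u) x y + uyy u x y - ε * uyy u x (-y) - c ^ 2 * u x y = 0

/-- `u_y` on the closed rectangle (one-sided at `y = ±π`). -/
def uyBar (u : ℝ → ℝ → ℝ) (x y : ℝ) : ℝ := derivWithin (u x) (Icc (-π) π) y

/-- The solutions of Problem N: regular solutions with `u_y` continuous on the closed rectangle,
`u(0, ·) = φ`, `u(1, ·) = ψ`, and `u_y(x, -π) = u_y(x, π) = 0`. -/
structure IsSolutionN (α ε c : ℝ) (φ ψ : ℝ → ℝ) (u : ℝ → ℝ → ℝ) : Prop where
  regular : IsRegularSolution α ε c u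
  uy_exists : ∀ p ∈ OmegaBar, DifferentiableWithinAt ℝ (u p.1) (Icc (-π) π) p.2
  uy_continuousOn : ContinuousOn (fun p : ℝ × ℝ => uyBar u p.1 p.2) OmegaBar
  left : ∀ y ∈ Icc (-π) π, u 0 y = φ y
  right : ∀ y ∈ Icc (-π) π, u 1 y = ψ y
  bottom : ∀ x ∈ Icc (0 : ℝ) 1, uyBar u x (-π) = 0
  top : ∀ x ∈ Icc (0 : ℝ) 1, uyBar u x π = 0

/-- The Hölder class `C^{m+δ}[-π, π]`. -/
def HolderClass (m : ℕ) (δ : ℝ≥0) (f : ℝ → ℝ) : Prop :=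
  ContDiffOn ℝ m f (Icc (-π) π) ∧
    ∃ K : ℝ≥0, HolderOnWith K δ (iteratedDerivWithin m f (Icc (-π) π)) (Icc (-π) π)

/-- The two-parameter Mittag-Leffler function (real argument). -/
def mittagLeffler (α β z : ℝ) : ℝ := ∑' k : ℕ, z ^ k / Real.Gamma (α * k + β)

/-- The function `C(μ t)`, for `μ > 0`. -/
def fracC (α μ t : ℝ) : ℝ :=
  (mittagLeffler α 1 μ * mittagLeffler α 1 (-μ * t ^ α)
      - mittagLeffler α 1 (-μ) * mittagLeffler α 1 (μ * t ^ α))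
    / (2 * μ * mittagLeffler (2 * α) (α + 1) (μ ^ 2))

/-- The function `S(μ t)`, for `μ > 0`. -/
def fracS (α μ t : ℝ) : ℝ :=
  t ^ α * mittagLeffler (2 * α) (α + 1) (μ ^ 2 * t ^ (2 * α))
    / mittagLeffler (2 * α) (α + 1) (μ ^ 2)

/-- Fourier coefficient of `f` along the constant `1`. -/
def coeffZero (f : ℝ → ℝ) : ℝ := (2 * π)⁻¹ * ∫ y in (-π)..π, f y

/-- Fourier coefficient of `f` along `cos (k y)`, `k ≥ 1`. -/
def coeffCos (f : ℝ → ℝ) (k : ℕ) : ℝ := π⁻¹ * ∫ y in (-π)..π, f y * Real.cos (k * y)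

/-- Fourier coefficient of `f` along `sin ((k + 1/2) y)`, `k ≥ 0`. -/
def coeffSin (f : ℝ → ℝ) (k : ℕ) : ℝ :=
  π⁻¹ * ∫ y in (-π)..π, f y * Real.sin ((k + 1 / 2) * y)

/-- `μ = √(λ + c²)` for the eigenvalue `λ = (1 - ε) k²` of `cos (k y)`. -/
def muCos (ε c : ℝ) (k : ℕ) : ℝ := √((1 - ε) * (k : ℝ) ^ 2 + c ^ 2)

/-- `μ = √(λ + c²)` for the eigenvalue `λ = (1 + ε) (k + 1/2)²` of `sin ((k + 1/2) y)`. -/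
def muSin (ε c : ℝ) (k : ℕ) : ℝ := √((1 + ε) * ((k : ℝ) + 1 / 2) ^ 2 + c ^ 2)

/-- The contribution of the constant eigenfunction (eigenvalue `0`, so that `μ = |c|`). -/
def zeroMode (α c : ℝ) (φ ψ : ℝ → ℝ) (x : ℝ) : ℝ :=
  if c = 0 then (1 - x ^ α) * coeffZero φ + x ^ α * coeffZero ψ
  else coeffZero φ * fracC α |c| x + coeffZero ψ * fracS α |c| x

/-- The `k`-th term of the series over `sin ((k + 1/2) y)`, `k ≥ 0`. -/
def sinTerm (α ε c : ℝ) (φ ψ : ℝ → ℝ) (x y : ℝ) (k : ℕ) : ℝ :=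
  (coeffSin φ k * fracC α (muSin ε c k) x + coeffSin ψ k * fracS α (muSin ε c k) x)
    * Real.sin ((k + 1 / 2) * y)

/-- The `k`-th term of the series over `cos (k y)`, `k ≥ 1`. -/
def cosTerm (α ε c : ℝ) (φ ψ : ℝ → ℝ) (x y : ℝ) (k : ℕ) : ℝ :=
  (coeffCos φ k * fracC α (muCos ε c k) x + coeffCos ψ k * fracS α (muCos ε c k) x)
    * Real.cos (k * y)

end FracHelmholtz

end

open FracHelmholtz

open FracHelmholtz

/-! With Neumann conditions at `y = ±π`, the operator `g ↦ -g''(y) + ε g''(-y)` has eigenfunctions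
`sin((k+1/2)y)` and `cos(ky)`, with eigenvalues `(1+ε)(k+1/2)²` and `(1-ε)k²`. Separation of
variables leaves `D^α D^α f = μ² f` with prescribed `f(0) = a` and `f(1) = b`. Its solution is
written as `a E_{α,1}(-μx^α)` plus a multiple of `x^α E_{2α,α+1}(μ²x^{2α})` (`modeSol`). The odd
part of `E_{α,1}` (`mittagLeffler_sub_neg`) identifies this with `a C_μ + b S_μ`.

Existence rests on bounds uniform in `μ`. A Volterra argument gives `E_{α,α}(-z) > 0` for `z ≥ 0`,
hence `0 ≤ E_{α,1}(-z) ≤ 1`, so a mode is at most `|a| + |b|` on `[0,1]`. For `x ≤ ρ < 1`, comparing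
`E_{2α,b}(μ²x^{2α})` with `E_{2α,α+1}(μ²)` gains a factor `1 + μ²` (`exists_mittagLeffler_le`), so
only `φ` has to pay for the second derivatives. Integration by parts and Bessel's inequality make
`ω²|φ_i|` and `ω|ψ_i|` summable over the frequencies `ω`. These sums justify all termwise operations
(`caputoDeriv_tsum`, `isRegularSolution_fourierSol`).

Uniqueness is the delicate half: a regular solution gives no control of `D^α D^α u` or `u_yy` near
the boundary that is uniform in the other variable, so the equation cannot simply be projected on
the modes. The even and odd parts `w` of the difference of two solutions satisfy the local equation
`D^α D^α w + κ w_yy - c² w = 0` with `κ = 1 ∓ ε`. Integrating it twice in `x` between interior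
points and once in `y` leaves only continuous quantities. With `J` the fractional integral,
`J^{1-α}J^{1-α}w` appears in place of `D^α D^α w`, up to `B(y) x^{2-α}`, where `B` comes from the
value of `D^α w` at `x = 0+`. The integrated equation then holds up to an error `x · slope(y)`.

For `α < 1` the slope vanishes. Pointwise in `y` the integrand is `o(x)`, but not uniformly. Baire's
theorem gives local uniformity on a dense open set, hence small difference quotients of the slope at
a dense set of points. The choice `x = ρ^{1/α}` bounds the second differences of the slope at step
`ρ` by `C ρ^{1/α}`, with `1/α > 1`. Together these force it to be constant
(`eq_of_second_difference`). For `α = 1` the term has the form `x^{2-α}P(y)` anyway.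

Projection on a mode now gives `J^{1-α}J^{1-α} f = β x^{2-α} + m J² f` with `f(1) = 0`. Its only
continuous solution vanishes on `(0,1)` (`eq_zero_of_fracInt_eq_add`), and completeness of the modes
gives `w = 0`. -/

namespace FracHelmholtz

/-! ### Riemann–Liouville integrals: Beta integrals and the semigroup law -/

section FractionalIntegral

/-- The Riemann–Liouville fractional integral of order `a ≥ 0` with base point `0`. -/
noncomputable def fracInt (a : ℝ) (f : ℝ → ℝ) (x : ℝ) : ℝ :=
  -- Order zero is the identity by convention, so the Caputo derivative is `fracInt (1 - α)` of the
  -- derivative for `α = 1` as well.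
  if a = 0 then f x else (Real.Gamma a)⁻¹ * ∫ s in (0 : ℝ)..x, (x - s) ^ (a - 1) * f s

lemma caputoDeriv_eq_fracInt (α : ℝ) (f : ℝ → ℝ) (x : ℝ) :
    caputoDeriv α f x = fracInt (1 - α) (deriv f) x := by
  unfold caputoDeriv fracInt
  by_cases h : α = 1
  · simp [h]
  · rw [if_neg h, if_neg (by intro h'; apply h; linarith)]
    congr 2
    ext s
    congr 2
    ring

lemma fracInt_zero (f : ℝ → ℝ) (x : ℝ) : fracInt 0 f x = f x := by simp [fracInt]

lemma fracInt_of_pos {a : ℝ} (ha : 0 < a) (f : ℝ → ℝ) (x : ℝ) :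
    fracInt a f x = (Real.Gamma a)⁻¹ * ∫ s in (0 : ℝ)..x, (x - s) ^ (a - 1) * f s := by
  simp [fracInt, ha.ne']

lemma fracInt_one (f : ℝ → ℝ) (x : ℝ) : fracInt 1 f x = ∫ s in (0 : ℝ)..x, f s := by
  simp [fracInt]

/-- The endpoint `x` is included because order zero reads the value there. -/
lemma fracInt_congr {a x : ℝ} (ha : 0 ≤ a) (hx : 0 < x) {f g : ℝ → ℝ}
    (h : ∀ s ∈ Ioc 0 x, f s = g s) : fracInt a f x = fracInt a g x := by
  rcases ha.eq_or_lt with rfl | ha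
  · rw [fracInt_zero, fracInt_zero, h x ⟨hx, le_rfl⟩]
  · rw [fracInt_of_pos ha, fracInt_of_pos ha]
    congr 1
    apply intervalIntegral.integral_congr_ae
    refine Filter.Eventually.of_forall fun s hs => ?_
    rw [uIoc_of_le hx.le] at hs
    rw [h s hs]

lemma intervalIntegrable_sub_rpow {a : ℝ} (ha : 0 < a) (x c d : ℝ) :
    IntervalIntegrable (fun s => (x - s) ^ (a - 1)) volume c d := by
  have := (intervalIntegral.intervalIntegrable_rpow' (a := x - c) (b := x - d)
    (r := a - 1) (by linarith)).comp_sub_left x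
  simpa using this

/-- Cutting at `x / 2` leaves a single endpoint singularity on each half, with the other factor
continuous. -/
lemma intervalIntegrable_beta {a b x : ℝ} (ha : 0 < a) (hb : 0 < b) (hx : 0 < x) :
    IntervalIntegrable (fun s => (x - s) ^ (a - 1) * s ^ (b - 1)) volume 0 x := by
  have h1 : IntervalIntegrable (fun s => (x - s) ^ (a - 1) * s ^ (b - 1)) volume 0 (x / 2) := by
    apply IntervalIntegrable.continuousOn_mul
    · exact intervalIntegral.intervalIntegrable_rpow' (by linarith)
    · intro s hs
      rw [uIcc_of_le (by linarith)] at hs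
      refine ContinuousAt.continuousWithinAt ?_
      exact ContinuousAt.rpow_const (by fun_prop) (Or.inl (by linarith [hs.2]))
  have h2 : IntervalIntegrable (fun s => (x - s) ^ (a - 1) * s ^ (b - 1)) volume (x / 2) x := by
    apply IntervalIntegrable.mul_continuousOn
    · exact intervalIntegrable_sub_rpow ha x _ _
    · intro s hs
      rw [uIcc_of_le (by linarith)] at hs
      refine ContinuousAt.continuousWithinAt ?_
      exact ContinuousAt.rpow_const (by fun_prop) (Or.inl (by linarith [hs.1]))
  exact h1.trans h2

lemma integral_beta {a b x : ℝ} (ha : 0 < a) (hb : 0 < b) (hx : 0 < x) :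
    ∫ s in (0 : ℝ)..x, (x - s) ^ (a - 1) * s ^ (b - 1)
      = Real.Gamma a * Real.Gamma b / Real.Gamma (a + b) * x ^ (a + b - 1) := by
  have h1 := Complex.betaIntegral_scaled (b : ℂ) (a : ℂ) hx
  have h2 : ∫ s in (0 : ℝ)..x, ((s : ℂ) ^ ((b : ℂ) - 1) * ((x : ℂ) - s) ^ ((a : ℂ) - 1))
      = ((∫ s in (0 : ℝ)..x, (x - s) ^ (a - 1) * s ^ (b - 1) : ℝ) : ℂ) := by
    rw [← intervalIntegral.integral_ofReal]
    apply intervalIntegral.integral_congr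
    intro s hs
    rw [uIcc_of_le hx.le] at hs
    simp only
    rw [Complex.ofReal_mul, Complex.ofReal_cpow (by linarith [hs.2]), Complex.ofReal_cpow hs.1]
    push_cast
    ring
  rw [h2, Complex.betaIntegral_eq_Gamma_mul_div _ _ (by simpa) (by simpa)] at h1
  have h3 : (x : ℂ) ^ ((b : ℂ) + a - 1) = ((x ^ (a + b - 1) : ℝ) : ℂ) := by
    rw [Complex.ofReal_cpow hx.le]
    push_cast
    ring_nf
  rw [h3, Complex.Gamma_ofReal, Complex.Gamma_ofReal, ← Complex.ofReal_add,
    Complex.Gamma_ofReal] at h1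
  have h4 := congrArg Complex.re h1
  norm_cast at h4
  rw [h4, add_comm b a]
  ring

lemma fracInt_rpow {a b x : ℝ} (ha : 0 ≤ a) (hb : 0 < b) (hx : 0 < x) :
    fracInt a (fun s => s ^ (b - 1)) x
      = Real.Gamma b / Real.Gamma (b + a) * x ^ (b + a - 1) := by
  have hG := Real.Gamma_pos_of_pos hb
  rcases ha.eq_or_lt with rfl | ha
  · rw [fracInt_zero]; simp [hG.ne']
  · rw [fracInt_of_pos ha, integral_beta ha hb hx, add_comm b a]
    have := Real.Gamma_pos_of_pos ha
    field_simp

lemma setIntegral_beta_shift {a b x s : ℝ} (ha : 0 < a) (hb : 0 < b) (hx : s < x) :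
    IntegrableOn (fun t => (x - t) ^ (a - 1) * (t - s) ^ (b - 1)) (Ioc s x) ∧
    ∫ t in Ioc s x, (x - t) ^ (a - 1) * (t - s) ^ (b - 1)
      = Real.Gamma a * Real.Gamma b / Real.Gamma (a + b) * (x - s) ^ (a + b - 1) := by
  have hxs : 0 < x - s := by linarith
  have h1 := (intervalIntegrable_beta ha hb hxs).comp_sub_right s
  have h2 := intervalIntegral.integral_comp_sub_right (a := s) (b := x)
    (fun t => (x - s - t) ^ (a - 1) * t ^ (b - 1)) s
  simp only [sub_self, zero_add, sub_add_cancel, sub_sub_sub_cancel_right] at h1 h2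
  rw [integral_beta ha hb hxs] at h2
  constructor
  · exact (intervalIntegrable_iff_integrableOn_Ioc_of_le hx.le).1 h1
  · rw [← intervalIntegral.integral_of_le hx.le, h2]

/-- The integrand of the iterated fractional integral is integrable on the triangle. -/
lemma integrable_triangle {a b x : ℝ} (ha : 0 < a) (hb : 0 < b) (hx : 0 < x)
    (hab : 1 ≤ a + b) {f : ℝ → ℝ} (hf : IntervalIntegrable f volume 0 x) :
    Integrable (fun p : ℝ × ℝ =>
      (Iio p.1).indicator (fun s => (x - p.1) ^ (a - 1) * ((p.1 - s) ^ (b - 1) * f s)) p.2)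
      ((volume.restrict (Ioc 0 x)).prod (volume.restrict (Ioc 0 x))) := by
  have hf' : Integrable f (volume.restrict (Ioc 0 x)) :=
    (intervalIntegrable_iff_integrableOn_Ioc_of_le hx.le).1 hf
  have hm : AEStronglyMeasurable (fun p : ℝ × ℝ =>
      (Iio p.1).indicator (fun s => (x - p.1) ^ (a - 1) * ((p.1 - s) ^ (b - 1) * f s)) p.2)
      ((volume.restrict (Ioc 0 x)).prod (volume.restrict (Ioc 0 x))) := by
    have h1 : AEStronglyMeasurable (fun p : ℝ × ℝ =>
        (x - p.1) ^ (a - 1) * ((p.1 - p.2) ^ (b - 1) * f p.2))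
        ((volume.restrict (Ioc 0 x)).prod (volume.restrict (Ioc 0 x))) := by
      have h2 : AEStronglyMeasurable (fun p : ℝ × ℝ => f p.2)
        ((volume.restrict (Ioc 0 x)).prod (volume.restrict (Ioc 0 x))) :=
        hf'.aestronglyMeasurable.comp_snd
      have h3 : Measurable (fun p : ℝ × ℝ => (x - p.1) ^ (a - 1)) := by fun_prop
      have h4 : Measurable (fun p : ℝ × ℝ => (p.1 - p.2) ^ (b - 1)) := by fun_prop
      exact h3.aestronglyMeasurable.mul (h4.aestronglyMeasurable.mul h2)
    have h5 : MeasurableSet {p : ℝ × ℝ | p.2 < p.1} := measurableSet_lt measurable_snd measurable_fst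
    have := h1.indicator h5
    refine this.congr (Filter.Eventually.of_forall fun p => ?_)
    simp only [indicator, mem_ofPred_eq, mem_Iio]
  rw [integrable_prod_iff' hm]
  have key : ∀ s ∈ Ioc 0 x, ∀ᵐ t ∂(volume.restrict (Ioc 0 x)), 
      (Iio t).indicator (fun s => (x - t) ^ (a - 1) * ((t - s) ^ (b - 1) * f s)) s =
      (Ioc s x).indicator (fun t => ((x - t) ^ (a - 1) * (t - s) ^ (b - 1)) * f s) t := by
    intro s hs
    filter_upwards [ae_restrict_mem measurableSet_Ioc] with t ht
    by_cases h : s < t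
    · rw [indicator_of_mem (show s ∈ Iio t from h), indicator_of_mem (show t ∈ Ioc s x from ⟨h, ht.2⟩)]
      ring
    · rw [indicator_of_notMem (show s ∉ Iio t from h),
        indicator_of_notMem (fun hh => h hh.1)]
  have hsub : ∀ s ∈ Ioc 0 x, Ioc s x ∩ Ioc 0 x = Ioc s x := by
    intro s hs
    exact inter_eq_left.2 (Ioc_subset_Ioc_left hs.1.le)
  constructor
  · filter_upwards [ae_restrict_mem measurableSet_Ioc] with s hs
    refine Integrable.congr ?_ ((key s hs).mono fun t ht => ht.symm)
    rw [integrable_indicator_iff measurableSet_Ioc, IntegrableOn, Measure.restrict_restrict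
      measurableSet_Ioc, hsub s hs]
    rcases hs.2.eq_or_lt with h | h
    · simp [h]
    · exact (setIntegral_beta_shift ha hb h).1.mul_const _
  · have hint : Integrable (fun s => Real.Gamma a * Real.Gamma b / Real.Gamma (a + b)
        * (x - s) ^ (a + b - 1) * ‖f s‖) (volume.restrict (Ioc 0 x)) := by
      have : IntervalIntegrable (fun s => Real.Gamma a * Real.Gamma b / Real.Gamma (a + b)
        * (x - s) ^ (a + b - 1) * ‖f s‖) volume 0 x := by
        -- Here `1 ≤ a + b` enters: the composed kernel `(x - s)^(a+b-1)` is continuous up to `s =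
        -- x`, so mere integrability of `f` suffices, at every `x` and not just almost every one.
        apply IntervalIntegrable.continuousOn_mul hf.norm
        apply ContinuousOn.mul continuousOn_const
        exact ContinuousOn.rpow_const (by fun_prop) (fun _ _ => Or.inr (by linarith))
      exact (intervalIntegrable_iff_integrableOn_Ioc_of_le hx.le).1 this
    refine hint.congr ?_
    have hne : ∀ᵐ s ∂(volume.restrict (Ioc 0 x)), s ≠ x := by
      apply ae_restrict_of_ae
      exact (Set.countable_singleton x).ae_notMem volume
    filter_upwards [ae_restrict_mem measurableSet_Ioc, hne] with s hs hsx
    have hlt : s < x := lt_of_le_of_ne hs.2 hsx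
    have : ∫ t, ‖(Iio t).indicator (fun s => (x - t) ^ (a - 1) * ((t - s) ^ (b - 1) * f s)) s‖
        ∂(volume.restrict (Ioc 0 x)) = ∫ t in Ioc s x, 
          (x - t) ^ (a - 1) * (t - s) ^ (b - 1) * ‖f s‖ := by
      rw [integral_congr_ae ((key s hs).mono fun t ht => congrArg norm ht)]
      simp_rw [norm_indicator_eq_indicator_norm]
      rw [integral_indicator measurableSet_Ioc, Measure.restrict_restrict
        measurableSet_Ioc, hsub s hs]
      apply setIntegral_congr_fun measurableSet_Ioc
      intro t ht
      simp only [norm_mul]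
      rw [Real.norm_of_nonneg (Real.rpow_nonneg (by linarith [ht.2]) _),
        Real.norm_of_nonneg (Real.rpow_nonneg (by linarith [ht.1]) _)]
    rw [this, integral_mul_const, (setIntegral_beta_shift ha hb hlt).2]

lemma fracInt_eq_setIntegral {b x t : ℝ} (hb : 0 < b) (ht : t ∈ Ioc 0 x) (f : ℝ → ℝ) (c : ℝ) :
    ∫ s in Ioc 0 x, (Iio t).indicator (fun s => c * ((t - s) ^ (b - 1) * f s)) s
      = c * (Real.Gamma b * fracInt b f t) := by
  have hG := Real.Gamma_pos_of_pos hb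
  rw [integral_indicator measurableSet_Iio, Measure.restrict_restrict measurableSet_Iio,
    fracInt_of_pos hb, intervalIntegral.integral_of_le ht.1.le, integral_const_mul,
    mul_inv_cancel_left₀ hG.ne', integral_Ioc_eq_integral_Ioo]
  congr 3
  ext s
  simp only [mem_inter_iff, mem_Iio, mem_Ioc, mem_Ioo]
  constructor
  · rintro ⟨h1, h2, h3⟩; exact ⟨h2, h1⟩
  · rintro ⟨h1, h2⟩; exact ⟨h2, h1, h2.le.trans ht.2⟩

/-- The fractional integral of order `b` is integrable against the kernel of order `a`. -/
lemma intervalIntegrable_mul_fracInt {a b x : ℝ} (ha : 0 < a) (hb : 0 ≤ b) (hx : 0 < x)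
    (hab : 1 ≤ a + b) {f : ℝ → ℝ} (hf : IntervalIntegrable f volume 0 x) :
    IntervalIntegrable (fun t => (x - t) ^ (a - 1) * fracInt b f t) volume 0 x := by
  rcases hb.eq_or_lt with rfl | hb
  · simp_rw [fracInt_zero]
    apply hf.continuousOn_mul
    exact ContinuousOn.rpow_const (by fun_prop) (fun _ _ => Or.inr (by linarith))
  · have h := (integrable_triangle ha hb hx hab hf).integral_prod_left
    rw [intervalIntegrable_iff_integrableOn_Ioc_of_le hx.le]
    have h2 := h.const_mul (Real.Gamma b)⁻¹
    refine h2.congr ?_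
    filter_upwards [ae_restrict_mem measurableSet_Ioc] with t ht
    rw [fracInt_eq_setIntegral hb ht]
    have hG := Real.Gamma_pos_of_pos hb
    field_simp

/-- The semigroup property of fractional integrals. -/
theorem fracInt_fracInt {a b x : ℝ} (ha : 0 ≤ a) (hb : 0 ≤ b) (hx : 0 < x)
    (hab : 1 ≤ a + b) {f : ℝ → ℝ} (hf : IntervalIntegrable f volume 0 x) :
    fracInt a (fracInt b f) x = fracInt (a + b) f x := by
  rcases ha.eq_or_lt with rfl | ha
  · rw [fracInt_zero, zero_add]
  rcases hb.eq_or_lt with rfl | hb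
  · rw [add_zero]
    exact fracInt_congr ha.le hx fun s _ => fracInt_zero f s
  have hsw := integral_integral_swap (f := fun t s =>
    (Iio t).indicator (fun s => (x - t) ^ (a - 1) * ((t - s) ^ (b - 1) * f s)) s)
    (integrable_triangle ha hb hx hab hf)
  have hGa := Real.Gamma_pos_of_pos ha
  have hGb := Real.Gamma_pos_of_pos hb
  have hGab := Real.Gamma_pos_of_pos (add_pos ha hb)
  have hL : ∫ t in Ioc 0 x, ∫ s in Ioc 0 x, 
      (Iio t).indicator (fun s => (x - t) ^ (a - 1) * ((t - s) ^ (b - 1) * f s)) s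
      = Real.Gamma b * Real.Gamma a * fracInt a (fracInt b f) x := by
    rw [fracInt_of_pos ha, intervalIntegral.integral_of_le hx.le,
      mul_assoc, mul_inv_cancel_left₀ hGa.ne', ← integral_const_mul]
    apply setIntegral_congr_fun measurableSet_Ioc
    intro t ht
    simp only
    rw [fracInt_eq_setIntegral hb ht]
    ring
  have hR : ∫ s in Ioc 0 x, ∫ t in Ioc 0 x, 
      (Iio t).indicator (fun s => (x - t) ^ (a - 1) * ((t - s) ^ (b - 1) * f s)) s
      = Real.Gamma b * Real.Gamma a * fracInt (a + b) f x := by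
    rw [fracInt_of_pos (add_pos ha hb), intervalIntegral.integral_of_le hx.le,
      ← mul_assoc, ← integral_const_mul]
    have hne : ∀ᵐ s ∂(volume.restrict (Ioc 0 x)), s ≠ x := by
      apply ae_restrict_of_ae
      exact (Set.countable_singleton x).ae_notMem volume
    apply integral_congr_ae
    filter_upwards [ae_restrict_mem measurableSet_Ioc, hne] with s hs hsx
    have hlt : s < x := lt_of_le_of_ne hs.2 hsx
    have e1 : ∀ t ∈ Ioc 0 x,
        (Iio t).indicator (fun s => (x - t) ^ (a - 1) * ((t - s) ^ (b - 1) * f s)) s =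
        (Ioc s x).indicator (fun t => ((x - t) ^ (a - 1) * (t - s) ^ (b - 1)) * f s) t := by
      intro t ht
      by_cases h : s < t
      · rw [indicator_of_mem (show s ∈ Iio t from h),
          indicator_of_mem (show t ∈ Ioc s x from ⟨h, ht.2⟩)]
        ring
      · rw [indicator_of_notMem (show s ∉ Iio t from h),
          indicator_of_notMem (fun hh => h hh.1)]
    rw [setIntegral_congr_fun measurableSet_Ioc e1, integral_indicator measurableSet_Ioc,
      Measure.restrict_restrict measurableSet_Ioc,
      inter_eq_left.2 (Ioc_subset_Ioc_left hs.1.le), integral_mul_const,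
      (setIntegral_beta_shift ha hb hlt).2]
    field_simp
  have h3 : Real.Gamma b * Real.Gamma a * fracInt a (fracInt b f) x
      = Real.Gamma b * Real.Gamma a * fracInt (a + b) f x := by
    rw [← hL, ← hR]
    exact hsw
  exact mul_left_cancel₀ (mul_pos hGb hGa).ne' h3

end FractionalIntegral

/-! ### Mittag-Leffler functions: fractional calculus, positivity and comparison -/

section MittagLeffler

open Filter Topology

/-- Cut the Gamma integral down to `t > R` and use `t^(x-1) ≥ R^(x-1)` there. Since `R` is free, `Γ`
outgrows every exponential. -/
lemma rpow_mul_exp_neg_le_Gamma {R x : ℝ} (hR : 0 < R) (hx : 1 ≤ x) :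
    R ^ (x - 1) * Real.exp (-R) ≤ Real.Gamma x := by
  rw [Real.Gamma_eq_integral (by linarith)]
  have hint := Real.GammaIntegral_convergent (s := x) (by linarith)
  calc R ^ (x - 1) * Real.exp (-R) = ∫ t in Ioi R, Real.exp (-t) * R ^ (x - 1) := by
        rw [integral_mul_const, integral_exp_neg_Ioi, mul_comm]
    _ ≤ ∫ t in Ioi R, Real.exp (-t) * t ^ (x - 1) := by
        apply setIntegral_mono_on
        · exact (integrableOn_exp_neg_Ioi R).mul_const _
        · exact hint.mono_set (Ioi_subset_Ioi hR.le)
        · exact measurableSet_Ioi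
        · intro t ht
          gcongr
          exact le_of_lt ht
    _ ≤ ∫ t in Ioi (0 : ℝ), Real.exp (-t) * t ^ (x - 1) := by
        apply setIntegral_mono_set hint
        · filter_upwards [ae_restrict_mem measurableSet_Ioi] with t ht
          exact mul_nonneg (Real.exp_pos _).le (Real.rpow_nonneg (le_of_lt ht) _)
        · exact (Ioi_subset_Ioi hR.le).eventuallyLE

lemma arg_pos {a b : ℝ} (ha : 0 < a) (hb : 0 < b) (k : ℕ) : 0 < a * k + b := by positivity

lemma summable_mittagLeffler {a b : ℝ} (ha : 0 < a) (hb : 0 < b) (z : ℝ) :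
    Summable fun k : ℕ => z ^ k / Real.Gamma (a * k + b) := by
  set M : ℝ := |z| + 1 with hM
  have hM0 : 0 < M := by positivity
  -- Chosen so that `R^a = 2M`: the lower bound for `Γ(ak+b)` then carries `(2M)^k`, and the terms
  -- are dominated by a multiple of `2^(-k)`.
  set R : ℝ := (2 * M) ^ (1 / a) with hR
  have hR0 : 0 < R := by positivity
  have hRa : R ^ a = 2 * M := by
    rw [hR, ← Real.rpow_mul (by positivity), one_div_mul_cancel ha.ne', Real.rpow_one]
  have hg : Summable fun k : ℕ => Real.exp R * R ^ (1 - b) * (1 / 2 : ℝ) ^ k :=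
    (summable_geometric_of_lt_one (by norm_num) (by norm_num)).mul_left _
  refine Summable.of_norm_bounded_eventually_nat hg ?_
  filter_upwards [eventually_ge_atTop ⌈1 / a⌉₊] with k hk
  have hk1 : 1 ≤ a * k + b := by
    have : 1 / a ≤ k := (Nat.le_ceil _).trans (by exact_mod_cast hk)
    rw [div_le_iff₀ ha] at this
    linarith
  have h1 := rpow_mul_exp_neg_le_Gamma hR0 hk1
  have hG : 0 < Real.Gamma (a * k + b) := Real.Gamma_pos_of_pos (by linarith)
  rw [norm_div, Real.norm_of_nonneg hG.le, norm_pow, Real.norm_eq_abs, div_le_iff₀ hG]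
  have h2 : R ^ (a * k + b - 1) = (2 * M) ^ k * R ^ (b - 1) := by
    rw [show a * k + b - 1 = a * k + (b - 1) by ring, Real.rpow_add hR0, Real.rpow_mul hR0.le, hRa,
      Real.rpow_natCast]
  rw [h2] at h1
  calc |z| ^ k ≤ M ^ k := by gcongr; linarith
    _ = Real.exp R * R ^ (1 - b) * (1 / 2 : ℝ) ^ k * ((2 * M) ^ k * R ^ (b - 1) * Real.exp (-R)) := by
        have e1 : R ^ (1 - b) * R ^ (b - 1) = 1 := by
          rw [← Real.rpow_add hR0]; simp
        have e2 : Real.exp R * Real.exp (-R) = 1 := by rw [← Real.exp_add]; simp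
        have e3 : (1 / 2 : ℝ) ^ k * (2 * M) ^ k = M ^ k := by rw [← mul_pow]; ring_nf
        calc M ^ k = (Real.exp R * Real.exp (-R)) * (R ^ (1 - b) * R ^ (b - 1)) *
              ((1 / 2 : ℝ) ^ k * (2 * M) ^ k) := by rw [e1, e2, e3]; ring
          _ = _ := by ring
    _ ≤ _ := by gcongr

lemma mittagLeffler_zero (a b : ℝ) : mittagLeffler a b 0 = (Real.Gamma b)⁻¹ := by
  unfold mittagLeffler
  rw [tsum_eq_single 0]
  · simp
  · intro k hk
    simp [hk]

lemma continuous_mittagLeffler {a b : ℝ} (ha : 0 < a) (hb : 0 < b) :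
    Continuous (mittagLeffler a b) := by
  rw [continuous_iff_continuousAt]
  intro z
  have : ContinuousOn (mittagLeffler a b) (Metric.ball 0 (|z| + 1)) := by
    unfold mittagLeffler
    refine continuousOn_tsum (u := fun k : ℕ => (|z| + 1) ^ k / Real.Gamma (a * k + b)) ?_
      (summable_mittagLeffler ha hb _) ?_
    · intro k
      fun_prop
    · intro k w hw
      have hG : 0 < Real.Gamma (a * k + b) := Real.Gamma_pos_of_pos (arg_pos ha hb k)
      rw [norm_div, Real.norm_of_nonneg hG.le, norm_pow]
      gcongr
      simpa using (Metric.mem_ball.1 hw).le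
  exact this.continuousAt (Metric.isOpen_ball.mem_nhds (by simp))

lemma mittagLeffler_pos {a b z : ℝ} (ha : 0 < a) (hb : 0 < b) (hz : 0 ≤ z) :
    0 < mittagLeffler a b z := by
  unfold mittagLeffler
  refine (summable_mittagLeffler ha hb z).tsum_pos (fun k => ?_) 0 ?_
  · have hG : 0 < Real.Gamma (a * k + b) := Real.Gamma_pos_of_pos (arg_pos ha hb k)
    positivity
  · have hG : 0 < Real.Gamma b := Real.Gamma_pos_of_pos hb
    simpa using hG

lemma mittagLeffler_mono {a b z w : ℝ} (ha : 0 < a) (hb : 0 < b) (hz : 0 ≤ z) (hzw : z ≤ w) :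
    mittagLeffler a b z ≤ mittagLeffler a b w := by
  refine (summable_mittagLeffler ha hb z).tsum_le_tsum (fun k => ?_) (summable_mittagLeffler ha hb w)
  have hG : 0 < Real.Gamma (a * k + b) := Real.Gamma_pos_of_pos (arg_pos ha hb k)
  gcongr

/-- Splitting off the term `k = 0`. Read through fractional integrals, this is the Volterra equation
satisfied by `mlFun`. -/
lemma mittagLeffler_shift {a b : ℝ} (ha : 0 < a) (hb : 0 < b) (z : ℝ) :
    mittagLeffler a b z = (Real.Gamma b)⁻¹ + z * mittagLeffler a (b + a) z := by
  unfold mittagLeffler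
  rw [(summable_mittagLeffler ha hb z).tsum_eq_zero_add, ← tsum_mul_left]
  congr 1
  · simp
  · apply tsum_congr
    intro k
    rw [pow_succ', mul_div_assoc]
    congr 3
    push_cast
    ring

/-- The even part of a Mittag-Leffler function is one of twice the order. -/
lemma mittagLeffler_sub_neg {α : ℝ} (hα : 0 < α) (z : ℝ) :
    mittagLeffler α 1 z - mittagLeffler α 1 (-z)
      = 2 * z * mittagLeffler (2 * α) (α + 1) (z ^ 2) := by
  have h1 := (summable_mittagLeffler hα one_pos z).hasSum
  have h2 := (summable_mittagLeffler hα one_pos (-z)).hasSum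
  have h3 := (summable_mittagLeffler (a := 2 * α) (b := α + 1) (by positivity) (by positivity)
    (z ^ 2)).hasSum
  have h4 := h1.sub h2
  have h5 : HasSum (fun k : ℕ => z ^ k / Real.Gamma (α * k + 1) - (-z) ^ k / Real.Gamma (α * k + 1))
      (0 + 2 * z * mittagLeffler (2 * α) (α + 1) (z ^ 2)) := by
    apply HasSum.even_add_odd
    · convert! hasSum_zero with k
      rw [pow_mul, pow_mul, neg_sq, sub_self]
    · convert! h3.mul_left (2 * z) using 2 with k
      have e : α * ((2 * k + 1 : ℕ) : ℝ) + 1 = 2 * α * k + (α + 1) := by push_cast; ring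
      rw [e, pow_succ, pow_succ, pow_mul, pow_mul, neg_sq]
      ring
  rw [zero_add] at h5
  exact h4.unique h5

/-- The function `x ↦ x ^ (b - 1) E_{a, b}(l x ^ a)`. -/
noncomputable def mlFun (a b l x : ℝ) : ℝ := x ^ (b - 1) * mittagLeffler a b (l * x ^ a)

lemma continuous_mittagLeffler_rpow {a b : ℝ} (ha : 0 < a) (hb : 0 < b) (l : ℝ) :
    Continuous fun x : ℝ => mittagLeffler a b (l * x ^ a) := by
  refine (continuous_mittagLeffler ha hb).comp ?_
  exact continuous_const.mul (Real.continuous_rpow_const ha.le)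

lemma mlFun_continuousAt {a b x : ℝ} (ha : 0 < a) (hb : 0 < b) (hx : 0 < x) (l : ℝ) :
    ContinuousAt (mlFun a b l) x := by
  unfold mlFun
  exact (Real.continuousAt_rpow_const _ _ (Or.inl hx.ne')).mul
    (continuous_mittagLeffler_rpow ha hb l).continuousAt

lemma mlFun_continuousOn {a b : ℝ} (ha : 0 < a) (hb : 0 < b) (l : ℝ) :
    ContinuousOn (mlFun a b l) (Ioi 0) :=
  fun _ hx => (mlFun_continuousAt ha hb hx l).continuousWithinAt

lemma intervalIntegrable_mlFun {a b : ℝ} (ha : 0 < a) (hb : 0 < b) (l x : ℝ) :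
    IntervalIntegrable (mlFun a b l) volume 0 x := by
  unfold mlFun
  apply IntervalIntegrable.mul_continuousOn
  · exact intervalIntegral.intervalIntegrable_rpow' (by linarith)
  · exact (continuous_mittagLeffler_rpow ha hb l).continuousOn

lemma intervalIntegrable_mul_mlFun {a b c x : ℝ} (ha : 0 < a) (hb : 0 < b) (hc : 0 < c)
    (hx : 0 < x) (l : ℝ) :
    IntervalIntegrable (fun s => (x - s) ^ (c - 1) * mlFun a b l s) volume 0 x := by
  unfold mlFun
  simp_rw [← mul_assoc]
  apply IntervalIntegrable.mul_continuousOn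
  · exact intervalIntegrable_beta hc hb hx
  · exact (continuous_mittagLeffler_rpow ha hb l).continuousOn

lemma mlFun_hasSum {a b x : ℝ} (ha : 0 < a) (hb : 0 < b) (hx : 0 < x) (l : ℝ) :
    HasSum (fun k : ℕ => l ^ k / Real.Gamma (a * (k : ℝ) + b) * x ^ (a * k + b - 1)) (mlFun a b l x) := by
  unfold mlFun
  convert! (summable_mittagLeffler ha hb (l * x ^ a)).hasSum.mul_left (x ^ (b - 1)) using 1
  ext k
  rw [show a * k + b - 1 = (b - 1) + a * k by ring, Real.rpow_add hx, Real.rpow_mul hx.le,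
    Real.rpow_natCast, mul_pow]
  ring

/-- Termwise Beta integrals turn `x^(ak+b-1)/Γ(ak+b)` into `x^(ak+b+c-1)/Γ(ak+b+c)`. Sum and
integral commute because the integrals of the norms form `Γ(c)` times the same series with `|l|` in
place of `l`. Derivatives, Caputo derivatives and Volterra equations of the modes all follow from
this rule. -/
theorem fracInt_mlFun {a b c x : ℝ} (ha : 0 < a) (hb : 0 < b) (hc : 0 ≤ c) (hx : 0 < x) (l : ℝ) :
    fracInt c (mlFun a b l) x = mlFun a (b + c) l x := by
  rcases hc.eq_or_lt with rfl | hc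
  · rw [fracInt_zero, add_zero]
  have hGc := Real.Gamma_pos_of_pos hc
  set F : ℕ → ℝ → ℝ := fun k s =>
    l ^ k / Real.Gamma (a * (k : ℝ) + b) * ((x - s) ^ (c - 1) * s ^ (a * (k : ℝ) + b - 1)) with hF
  have hG : ∀ k : ℕ, 0 < Real.Gamma (a * k + b) := fun k => Real.Gamma_pos_of_pos (arg_pos ha hb k)
  have hint : ∀ k, Integrable (F k) (volume.restrict (Ioc 0 x)) := fun k =>
    ((intervalIntegrable_iff_integrableOn_Ioc_of_le hx.le).1
      (intervalIntegrable_beta hc (arg_pos ha hb k) hx)).const_mul _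
  have hval : ∀ k : ℕ, ∫ s in Ioc 0 x, ((x - s) ^ (c - 1) * s ^ (a * k + b - 1))
      = Real.Gamma c * Real.Gamma (a * k + b) / Real.Gamma (a * k + (b + c))
        * x ^ (a * k + (b + c) - 1) := by
    intro k
    rw [← intervalIntegral.integral_of_le hx.le, integral_beta hc (arg_pos ha hb k) hx]
    rw [show c + (a * k + b) = a * k + (b + c) by ring]
  have hnorm : ∀ k, ∫ s in Ioc 0 x, ‖F k s‖ = Real.Gamma c *
      (|l| ^ k / Real.Gamma (a * k + (b + c)) * x ^ (a * k + (b + c) - 1)) := by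
    intro k
    have : ∀ s ∈ Ioc 0 x, ‖F k s‖ = |l| ^ k / Real.Gamma (a * k + b) *
        ((x - s) ^ (c - 1) * s ^ (a * k + b - 1)) := by
      intro s hs
      rw [hF]
      simp only [norm_mul, norm_div, norm_pow, Real.norm_eq_abs]
      rw [abs_of_pos (hG k), abs_of_nonneg (Real.rpow_nonneg (by linarith [hs.2]) _),
        abs_of_nonneg (Real.rpow_nonneg hs.1.le _)]
    rw [setIntegral_congr_fun measurableSet_Ioc this, integral_const_mul, hval]
    have := (hG k).ne'
    field_simp
  have hsum := hasSum_integral_of_summable_integral_norm (F := F) hint (by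
    simp_rw [hnorm]
    exact ((mlFun_hasSum ha (add_pos hb hc) hx |l|).summable).mul_left _)
  have hR : ∀ k, ∫ s in Ioc 0 x, F k s = Real.Gamma c *
      (l ^ k / Real.Gamma (a * k + (b + c)) * x ^ (a * k + (b + c) - 1)) := by
    intro k
    rw [hF]
    simp only
    rw [integral_const_mul, hval]
    have := (hG k).ne'
    field_simp
  simp_rw [hR] at hsum
  have h1 := hsum.unique ((mlFun_hasSum ha (add_pos hb hc) hx l).mul_left (Real.Gamma c))
  rw [fracInt_of_pos hc, intervalIntegral.integral_of_le hx.le]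
  have h2 : ∫ s in Ioc 0 x, (x - s) ^ (c - 1) * mlFun a b l s = ∫ s in Ioc 0 x, ∑' k, F k s := by
    apply setIntegral_congr_fun measurableSet_Ioc
    intro s hs
    have := (mlFun_hasSum ha hb hs.1 l).mul_left ((x - s) ^ (c - 1))
    simp only
    rw [← this.tsum_eq]
    apply tsum_congr
    intro k
    rw [hF]
    ring
  rw [h2, h1]
  field_simp

lemma mlFun_shift {a b x : ℝ} (ha : 0 < a) (hb : 0 < b) (hx : 0 < x) (l : ℝ) :
    mlFun a b l x = x ^ (b - 1) / Real.Gamma b + l * mlFun a (b + a) l x := by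
  unfold mlFun
  rw [mittagLeffler_shift ha hb, show b + a - 1 = (b - 1) + a by ring, Real.rpow_add hx]
  ring

lemma hasDerivAt_mlFun {a b x : ℝ} (ha : 0 < a) (hb : 0 < b) (hx : 0 < x) (l : ℝ) :
    HasDerivAt (mlFun a (b + 1) l) (mlFun a b l x) x := by
  have h1 : HasDerivAt (fun u => ∫ s in (0 : ℝ)..u, mlFun a b l s) (mlFun a b l x) x := by
    apply intervalIntegral.integral_hasDerivAt_right (intervalIntegrable_mlFun ha hb l x)
    · exact ContinuousOn.stronglyMeasurableAtFilter isOpen_Ioi (mlFun_continuousOn ha hb l) x hx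
    · exact mlFun_continuousAt ha hb hx l
  refine h1.congr_of_eventuallyEq ?_
  filter_upwards [Ioi_mem_nhds hx] with u hu
  rw [← fracInt_one, fracInt_mlFun ha hb zero_le_one hu]

/-- At `b = 1` lowering `b` by one is not allowed, so the constant term is split off first. -/
lemma hasDerivAt_mlFun_one {a x : ℝ} (ha : 0 < a) (hx : 0 < x) (l : ℝ) :
    HasDerivAt (mlFun a 1 l) (l * mlFun a a l x) x := by
  have h1 := ((hasDerivAt_mlFun ha ha hx l).const_mul l).const_add (Real.Gamma 1)⁻¹
  refine h1.congr_of_eventuallyEq ?_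
  filter_upwards [Ioi_mem_nhds hx] with u hu
  rw [mlFun_shift ha one_pos hu]
  simp [add_comm]

/-- Positivity of the resolvent of a log-convex kernel. -/
lemma mittagLeffler_self_neg_rpow_pos {α : ℝ} (hα0 : 0 < α) (hα1 : α ≤ 1) {t : ℝ} (ht : 0 ≤ t) :
    0 < mittagLeffler α α (-1 * t ^ α) := by
  -- Argue by contradiction at the first point `T` where `q ≤ 0`. The function `r = t^(α-1) q` is
  -- positive before `T` and satisfies `J^α r = t^(α-1)/Γ(α) - r`.
  set q : ℝ → ℝ := fun t => mittagLeffler α α (-1 * t ^ α) with hq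
  have hqc : Continuous q := continuous_mittagLeffler_rpow hα0 hα0 (-1)
  have hG := Real.Gamma_pos_of_pos hα0
  have hq0 : 0 < q 0 := by
    simp only [hq, Real.zero_rpow hα0.ne', mul_zero, mittagLeffler_zero]
    positivity
  by_contra hcon
  set Z : Set ℝ := Ici 0 ∩ q ⁻¹' Iic 0 with hZ
  have hZc : IsClosed Z := isClosed_Ici.inter (isClosed_Iic.preimage hqc)
  have hZn : Z.Nonempty := ⟨t, ht, not_lt.1 hcon⟩
  have hZb : BddBelow Z := ⟨0, fun s hs => hs.1⟩
  set T := sInf Z with hT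
  have hTZ : T ∈ Z := hZc.csInf_mem hZn hZb
  have hT0 : 0 < T := by
    refine lt_of_le_of_ne hTZ.1 fun h => ?_
    have := hTZ.2
    rw [← h] at this
    exact absurd hq0 (not_lt.2 this)
  have hqpos : ∀ s, 0 ≤ s → s < T → 0 < q s := by
    intro s hs hsT
    by_contra h
    exact absurd (csInf_le hZb ⟨hs, not_lt.1 h⟩) (not_le.2 hsT)
  set r : ℝ → ℝ := mlFun α α (-1) with hr
  have hrq : ∀ s, r s = s ^ (α - 1) * q s := fun s => rfl
  have hrpos : ∀ s, 0 < s → s < T → 0 < r s := fun s hs hsT => by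
    rw [hrq]; exact mul_pos (Real.rpow_pos_of_pos hs _) (hqpos s hs.le hsT)
  have hrT : r T ≤ 0 := by
    rw [hrq]; exact mul_nonpos_of_nonneg_of_nonpos (Real.rpow_nonneg hT0.le _) hTZ.2
  have hvol : ∀ s, 0 < s → fracInt α r s = s ^ (α - 1) / Real.Gamma α - r s := by
    intro s hs
    rw [hr, fracInt_mlFun hα0 hα0 hα0.le hs, mlFun_shift hα0 hα0 hs]
    ring
  -- a short interval before the first zero
  have hGa : 0 < Real.Gamma (α + 1) := Real.Gamma_pos_of_pos (by linarith)
  obtain ⟨η, hη0, hηT, hη⟩ : ∃ η > 0, η ≤ T / 2 ∧ η ^ α < Real.Gamma (α + 1) / 2 := by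
    have h1 : Tendsto (fun η : ℝ => η ^ α) (𝓝[>] 0) (𝓝 0) := by
      have := (Real.continuous_rpow_const hα0.le).tendsto 0
      rw [Real.zero_rpow hα0.ne'] at this
      exact this.mono_left nhdsWithin_le_nhds
    have h2 := h1.eventually (gt_mem_nhds (show (0 : ℝ) < Real.Gamma (α + 1) / 2 by positivity))
    have h3 : ∀ᶠ η : ℝ in 𝓝[>] 0, η ≤ T / 2 :=
      nhdsWithin_le_nhds (eventually_le_nhds (by positivity))
    obtain ⟨η, h⟩ := ((h2.and h3).and self_mem_nhdsWithin).exists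
    exact ⟨η, h.2, h.1.2, h.1.1⟩
  have hrc : ContinuousOn r (Icc (T - η) T) :=
    (mlFun_continuousOn hα0 hα0 (-1)).mono fun s hs => by
      have := hs.1; simp only [mem_Ioi]; linarith
  -- The Volterra equation will be compared at `T`, where `r ≤ 0`, and at a maximum point `t` of `r`
  -- just before `T`, where `r > 0`.
  obtain ⟨t, htm, htmax⟩ := isCompact_Icc.exists_isMaxOn
    (nonempty_Icc.2 (show T - η ≤ T by linarith)) hrc
  have hmax : ∀ s ∈ Icc (T - η) T, r s ≤ r t := htmax
  have hrt : 0 < r t := lt_of_lt_of_le (hrpos (T - η) (by linarith) (by linarith))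
    (hmax _ ⟨le_rfl, by linarith⟩)
  have htT : t < T := lt_of_le_of_ne htm.2 fun h => by rw [h] at hrt; linarith
  have ht0 : 0 < t := by linarith [htm.1]
  have hIt := hvol t ht0
  have hIT := hvol T hT0
  rw [fracInt_of_pos hα0] at hIt hIT
  have hi1 := intervalIntegrable_mul_mlFun hα0 hα0 hα0 ht0 (-1)
  have hi2 := intervalIntegrable_mul_mlFun hα0 hα0 hα0 hT0 (-1)
  rw [← hr] at hi1 hi2
  have hi2a : IntervalIntegrable (fun s => (T - s) ^ (α - 1) * r s) volume 0 t :=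
    hi2.mono_set (by rw [uIcc_of_le ht0.le, uIcc_of_le hT0.le]; exact Icc_subset_Icc_right htT.le)
  have hi2b : IntervalIntegrable (fun s => (T - s) ^ (α - 1) * r s) volume t T :=
    hi2.mono_set (by rw [uIcc_of_le htT.le, uIcc_of_le hT0.le]; exact Icc_subset_Icc_left ht0.le)
  have hsplit := intervalIntegral.integral_add_adjacent_intervals hi2a hi2b
  -- Since `(T/t)(t-s) ≤ T-s` and `α - 1 ≤ 0`, the kernel at `T` is at most `(T/t)^(α-1)` times the
  -- kernel at `t`. The same factor carries the forcing term `t^(α-1)` exactly to `T^(α-1)`.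
  have hA : ∫ s in (0 : ℝ)..t, (T - s) ^ (α - 1) * r s
      ≤ (T / t) ^ (α - 1) * ∫ s in (0 : ℝ)..t, (t - s) ^ (α - 1) * r s := by
    rw [← intervalIntegral.integral_const_mul]
    apply intervalIntegral.integral_mono_on_of_le_Ioo ht0.le hi2a (hi1.const_mul _)
    intro s hs
    rw [← mul_assoc, ← Real.mul_rpow (by positivity) (by linarith [hs.2])]
    apply mul_le_mul_of_nonneg_right _ (hrpos s hs.1 (hs.2.trans htT)).le
    apply Real.rpow_le_rpow_of_nonpos _ _ (by linarith)
    · exact mul_pos (by positivity) (by linarith [hs.2])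
    · rw [div_mul_eq_mul_div, div_le_iff₀ ht0]
      nlinarith [hs.1]
  have hB : ∫ s in t..T, (T - s) ^ (α - 1) * r s ≤ r t * (η ^ α / α) := by
    have : ∫ s in t..T, (T - s) ^ (α - 1) * r s ≤ ∫ s in t..T, (T - s) ^ (α - 1) * r t := by
      apply intervalIntegral.integral_mono_on htT.le hi2b
        ((intervalIntegrable_sub_rpow hα0 _ _ _).mul_const _)
      intro s hs
      gcongr
      · exact Real.rpow_nonneg (by linarith [hs.2]) _
      · exact hmax s ⟨htm.1.trans hs.1, hs.2⟩
    refine this.trans ?_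
    rw [intervalIntegral.integral_mul_const, mul_comm,
      intervalIntegral.integral_comp_sub_left (fun s => s ^ (α - 1)), integral_rpow (Or.inl (by linarith))]
    simp only [sub_self, sub_add_cancel]
    rw [Real.zero_rpow hα0.ne', sub_zero]
    gcongr
    linarith [htm.1]
  have hk : (T / t) ^ (α - 1) * (t ^ (α - 1)) = T ^ (α - 1) := by
    rw [← Real.mul_rpow (by positivity) ht0.le, div_mul_cancel₀ _ ht0.ne']
  have hhalf : 1 / 2 ≤ (T / t) ^ (α - 1) := by
    have h2 : T / t ≤ 2 := by rw [div_le_iff₀ ht0]; linarith [htm.1]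
    calc (1 / 2 : ℝ) = 2 ^ (-1 : ℝ) := by rw [Real.rpow_neg_one]; norm_num
      _ ≤ 2 ^ (α - 1) := Real.rpow_le_rpow_of_exponent_le (by norm_num) (by linarith)
      _ ≤ (T / t) ^ (α - 1) :=
        Real.rpow_le_rpow_of_nonpos (by positivity) h2 (by linarith)
  have hGs : Real.Gamma (α + 1) = α * Real.Gamma α := Real.Gamma_add_one hα0.ne'
  rw [hGs] at hη
  have e1 : ∫ s in (0 : ℝ)..t, (t - s) ^ (α - 1) * r s = t ^ (α - 1) - Real.Gamma α * r t := by
    field_simp at hIt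
    linarith
  have e2 : T ^ (α - 1) ≤ ∫ s in (0 : ℝ)..T, (T - s) ^ (α - 1) * r s := by
    field_simp at hIT
    nlinarith
  rw [e1, mul_sub, hk] at hA
  have e3 : η ^ α / α < Real.Gamma α / 2 := by
    rw [div_lt_iff₀ hα0]; linarith
  -- The forcing terms cancel, leaving `(T/t)^(α-1) Γ(α) r(t) ≤ r(t) η^α/α`. This is impossible: the
  -- power is at least `1/2` and `η^α/α < Γ(α)/2`.
  nlinarith [mul_pos hG hrt, mul_le_mul_of_nonneg_right hhalf (mul_pos hG hrt).le,
    mul_lt_mul_of_pos_left e3 hrt]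

lemma exists_rpow_eq {α z : ℝ} (hα : 0 < α) (hz : 0 ≤ z) : ∃ t, 0 ≤ t ∧ t ^ α = z :=
  ⟨z ^ (1 / α), Real.rpow_nonneg hz _, by
    rw [← Real.rpow_mul hz, one_div_mul_cancel hα.ne', Real.rpow_one]⟩

lemma mittagLeffler_self_neg_pos {α z : ℝ} (hα0 : 0 < α) (hα1 : α ≤ 1) (hz : 0 ≤ z) :
    0 < mittagLeffler α α (-z) := by
  obtain ⟨t, ht, rfl⟩ := exists_rpow_eq hα0 hz
  simpa using mittagLeffler_self_neg_rpow_pos hα0 hα1 ht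

lemma fracInt_nonneg {a x : ℝ} (ha : 0 ≤ a) (hx : 0 < x) {f : ℝ → ℝ}
    (hf : ∀ s ∈ Ioc 0 x, 0 ≤ f s) : 0 ≤ fracInt a f x := by
  rcases ha.eq_or_lt with rfl | ha
  · rw [fracInt_zero]; exact hf x ⟨hx, le_rfl⟩
  · rw [fracInt_of_pos ha]
    refine mul_nonneg (inv_nonneg.2 (Real.Gamma_pos_of_pos ha).le) ?_
    rw [intervalIntegral.integral_of_le hx.le]
    apply setIntegral_nonneg measurableSet_Ioc
    intro s hs
    exact mul_nonneg (Real.rpow_nonneg (by linarith [hs.2]) _) (hf s hs)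

lemma mlFun_self_neg_one_nonneg {α t : ℝ} (hα0 : 0 < α) (hα1 : α ≤ 1) (ht : 0 ≤ t) :
    0 ≤ mlFun α α (-1) t :=
  mul_nonneg (Real.rpow_nonneg ht _) (mittagLeffler_self_neg_rpow_pos hα0 hα1 ht).le

/-- In the Volterra equation for `r = t^(α-1) E_{α,α}(-t^α)` the subtracted `J^α r` is nonnegative
because `r` is. -/
lemma mittagLeffler_self_neg_le {α z : ℝ} (hα0 : 0 < α) (hα1 : α ≤ 1) (hz : 0 ≤ z) :
    mittagLeffler α α (-z) ≤ (Real.Gamma α)⁻¹ := by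
  obtain ⟨t, ht, rfl⟩ := exists_rpow_eq hα0 hz
  rcases ht.eq_or_lt with rfl | ht
  · simp [Real.zero_rpow hα0.ne', mittagLeffler_zero]
  have h1 := mlFun_shift hα0 hα0 ht (-1)
  rw [← fracInt_mlFun hα0 hα0 hα0.le ht] at h1
  have h2 : 0 ≤ fracInt α (mlFun α α (-1)) t :=
    fracInt_nonneg hα0.le ht fun s hs => mlFun_self_neg_one_nonneg hα0 hα1 hs.1.le
  have h3 : t ^ (α - 1) * mittagLeffler α α (-1 * t ^ α) ≤ t ^ (α - 1) * (Real.Gamma α)⁻¹ := by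
    rw [mlFun] at h1
    rw [← div_eq_mul_inv]
    linarith
  have := le_of_mul_le_mul_left h3 (Real.rpow_pos_of_pos ht _)
  simpa using this

/-- With the same `r ≥ 0`, `E_{α,1}(-t^α)` equals both `J^(1-α) r`, which is nonnegative, and `1 - J
r`, which is at most `1`. -/
lemma mittagLeffler_one_neg_mem {α z : ℝ} (hα0 : 0 < α) (hα1 : α ≤ 1) (hz : 0 ≤ z) :
    mittagLeffler α 1 (-z) ∈ Icc (0 : ℝ) 1 := by
  obtain ⟨t, ht, rfl⟩ := exists_rpow_eq hα0 hz
  rcases ht.eq_or_lt with rfl | ht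
  · simp [Real.zero_rpow hα0.ne', mittagLeffler_zero]
  have h0 : mittagLeffler α 1 (-t ^ α) = mlFun α 1 (-1) t := by simp [mlFun]
  rw [h0]
  constructor
  · have := fracInt_mlFun hα0 hα0 (show 0 ≤ 1 - α by linarith) ht (-1)
    rw [add_sub_cancel] at this
    rw [← this]
    exact fracInt_nonneg (by linarith) ht fun s hs => mlFun_self_neg_one_nonneg hα0 hα1 hs.1.le
  · have h1 := mlFun_shift hα0 one_pos ht (-1)
    rw [add_comm 1 α, ← fracInt_mlFun hα0 hα0 zero_le_one ht] at h1
    have h2 : 0 ≤ fracInt 1 (mlFun α α (-1)) t :=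
      fracInt_nonneg zero_le_one ht fun s hs => mlFun_self_neg_one_nonneg hα0 hα1 hs.1.le
    simp at h1
    linarith

lemma Gamma_add_nat_le {X : ℝ} (hX : 0 < X) (N : ℕ) :
    Real.Gamma (X + N) ≤ Real.Gamma X * (X + N) ^ N := by
  induction N with
  | zero => simp
  | succ n ih =>
    have h0 : 0 < Real.Gamma X := Real.Gamma_pos_of_pos hX
    have e : X + ((n + 1 : ℕ) : ℝ) = (X + n) + 1 := by push_cast; ring
    rw [e, Real.Gamma_add_one (by positivity), pow_succ]
    calc (X + n) * Real.Gamma (X + n) ≤ (X + n) * (Real.Gamma X * (X + n) ^ n) := by gcongr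
      _ ≤ (X + n + 1) * (Real.Gamma X * (X + n + 1) ^ n) := by
          have h3 : (X + n) ^ n ≤ (X + n + 1) ^ n :=
            pow_le_pow_left₀ (by positivity) (by linarith) n
          exact mul_le_mul (by linarith) (by gcongr) (by positivity) (by positivity)
      _ = _ := by ring

/-- Convexity bounds `Γ` on `[X, X+N]` by the larger endpoint value, and the functional equation
handles the integer shift. So quotients of shifted Gamma values grow at most polynomially. -/
lemma Gamma_add_le {X s : ℝ} {N : ℕ} (hX : 0 < X) (hs : 0 ≤ s) (hsN : s ≤ N) :
    Real.Gamma (X + s) ≤ Real.Gamma X * (1 + (X + N) ^ N) := by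
  have h0 : 0 < Real.Gamma X := Real.Gamma_pos_of_pos hX
  have h1 : Real.Gamma (X + s) ≤ max (Real.Gamma X) (Real.Gamma (X + N)) := by
    refine Real.convexOn_Gamma.le_max_of_mem_Icc hX ?_ ⟨by linarith, by linarith⟩
    exact mem_Ioi.2 (by positivity)
  refine h1.trans (max_le ?_ ?_)
  · have : 0 ≤ (X + N) ^ N := by positivity
    nlinarith
  · refine (Gamma_add_nat_le hX N).trans ?_
    gcongr
    linarith

/-- `Γ(ak+d)/Γ(ak+b)` is at most of order `k^N` for `N ≥ d - b`, and `q^k` beats any power of `k`.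
-/
lemma exists_pow_mul_Gamma_le {a b d q : ℝ} (ha : 0 < a) (hb : 0 < b) (hbd : b ≤ d)
    (hq0 : 0 ≤ q) (hq1 : q < 1) :
    ∃ C, 0 ≤ C ∧ ∀ k : ℕ, q ^ k * Real.Gamma (a * k + d) ≤ C * Real.Gamma (a * k + b) := by
  obtain ⟨N, hN⟩ := exists_nat_ge (d - b)
  have ht : Tendsto (fun k : ℕ => (k : ℝ) ^ N * q ^ k) atTop (𝓝 0) :=
    tendsto_pow_const_mul_const_pow_of_abs_lt_one N (by rwa [abs_of_nonneg hq0])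
  obtain ⟨M, hM⟩ := ht.bddAbove_range
  have hM' : ∀ k : ℕ, (k : ℝ) ^ N * q ^ k ≤ M := fun k => hM ⟨k, rfl⟩
  set c := a + (b + N) with hc
  have hc0 : 0 < c := by positivity
  refine ⟨1 + c ^ N * (2 ^ N * (M + 1)), ?_, fun k => ?_⟩
  · have : 0 ≤ M := le_trans (by positivity) (hM' 0)
    positivity
  have hX : 0 < a * k + b := arg_pos ha hb k
  have hG := Real.Gamma_pos_of_pos hX
  have h1 := Gamma_add_le (s := d - b) hX (by linarith) hN
  rw [show a * k + b + (d - b) = a * k + d by ring] at h1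
  have hqk : q ^ k ≤ 1 := pow_le_one₀ hq0 hq1.le
  have hqk0 : 0 ≤ q ^ k := by positivity
  have h2 : (a * k + b + N) ^ N ≤ c ^ N * (2 ^ N * (k ^ N + 1)) := by
    have e1 : a * k + b + N ≤ c * (k + 1) := by
      rw [hc]
      have : 0 ≤ (b + N) * (k : ℝ) := by positivity
      nlinarith
    have e2 : ((k : ℝ) + 1) ^ N ≤ 2 ^ N * (k ^ N + 1) := by
      rcases Nat.eq_zero_or_pos k with rfl | hk
      · simp only [Nat.cast_zero, zero_add, one_pow]
        have : (1 : ℝ) ≤ 2 ^ N := one_le_pow₀ (by norm_num)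
        have h0 : (0 : ℝ) ≤ 0 ^ N := by positivity
        nlinarith
      · have hk1 : (1 : ℝ) ≤ k := by exact_mod_cast hk
        calc ((k : ℝ) + 1) ^ N ≤ (2 * k) ^ N := by gcongr; linarith
          _ = 2 ^ N * k ^ N := mul_pow _ _ _
          _ ≤ _ := by gcongr; linarith
    calc (a * k + b + N) ^ N ≤ (c * (k + 1)) ^ N := by gcongr
      _ = c ^ N * ((k : ℝ) + 1) ^ N := mul_pow _ _ _
      _ ≤ _ := by gcongr
  calc q ^ k * Real.Gamma (a * k + d)
      ≤ q ^ k * (Real.Gamma (a * k + b) * (1 + c ^ N * (2 ^ N * (k ^ N + 1)))) := by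
        gcongr
        exact h1.trans (by gcongr)
    _ = (q ^ k + c ^ N * (2 ^ N * (k ^ N * q ^ k + q ^ k))) * Real.Gamma (a * k + b) := by ring
    _ ≤ _ := by
        gcongr
        exact hM' k

/-- Comparison of Mittag-Leffler functions at proportional arguments. -/
lemma exists_mittagLeffler_le {a b d q : ℝ} (ha : 0 < a) (hb : 0 < b) (hbd : b ≤ d)
    (hq0 : 0 ≤ q) (hq1 : q < 1) :
    ∃ C, 0 ≤ C ∧ ∀ m z : ℝ, 0 ≤ m → 0 ≤ z → z ≤ q * m →
      (1 + m) * mittagLeffler a b z ≤ C * mittagLeffler a d m := by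
  have hd : 0 < d := hb.trans_le hbd
  obtain ⟨C₁, hC₁, h₁⟩ := exists_pow_mul_Gamma_le ha hb hbd hq0 hq1
  obtain ⟨C₂, hC₂, h₂⟩ := exists_pow_mul_Gamma_le (d := d + a) ha hb (by linarith) hq0 hq1
  refine ⟨C₁ + C₂, by positivity, fun m z hm hz hzm => ?_⟩
  have hsz := summable_mittagLeffler ha hb z
  have hsm := summable_mittagLeffler ha hd m
  have e1 : mittagLeffler a b z ≤ C₁ * mittagLeffler a d m := by
    unfold mittagLeffler
    rw [← tsum_mul_left]
    refine hsz.tsum_le_tsum (fun k => ?_) (hsm.mul_left _)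
    have hG1 := Real.Gamma_pos_of_pos (arg_pos ha hb k)
    have hG2 := Real.Gamma_pos_of_pos (arg_pos ha hd k)
    have hp : z ^ k ≤ q ^ k * m ^ k := by rw [← mul_pow]; gcongr
    rw [← mul_div_assoc, div_le_div_iff₀ hG1 hG2]
    calc z ^ k * Real.Gamma (a * k + d) ≤ q ^ k * m ^ k * Real.Gamma (a * k + d) := by gcongr
      _ = m ^ k * (q ^ k * Real.Gamma (a * k + d)) := by ring
      _ ≤ m ^ k * (C₁ * Real.Gamma (a * k + b)) := by exact mul_le_mul_of_nonneg_left (h₁ k) (by positivity)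
      _ = _ := by ring
  -- The extra factor `m` is absorbed by the shift: `m E_{a,d+a}(m)` is `E_{a,d}(m)` without its
  -- constant term.
  have e2 : m * mittagLeffler a b z ≤ C₂ * mittagLeffler a d m := by
    have e3 : C₂ * (m * mittagLeffler a (d + a) m) ≤ C₂ * mittagLeffler a d m := by
      rw [mittagLeffler_shift ha hd m]
      have : 0 < Real.Gamma d := Real.Gamma_pos_of_pos hd
      gcongr
      linarith [inv_pos.2 this]
    refine le_trans ?_ e3
    have hsm' := summable_mittagLeffler ha (add_pos hd ha) m
    unfold mittagLeffler
    rw [← tsum_mul_left, ← tsum_mul_left, ← tsum_mul_left]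
    refine (hsz.mul_left _).tsum_le_tsum (fun k => ?_) ((hsm'.mul_left _).mul_left _)
    have hG1 := Real.Gamma_pos_of_pos (arg_pos ha hb k)
    have hG2 := Real.Gamma_pos_of_pos (arg_pos ha (add_pos hd ha) k)
    have hp : z ^ k ≤ q ^ k * m ^ k := by rw [← mul_pow]; gcongr
    rw [← mul_div_assoc, ← mul_div_assoc, ← mul_div_assoc, div_le_div_iff₀ hG1 hG2]
    calc m * z ^ k * Real.Gamma (a * k + (d + a))
        ≤ m * (q ^ k * m ^ k) * Real.Gamma (a * k + (d + a)) := by gcongr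
      _ = m * m ^ k * (q ^ k * Real.Gamma (a * k + (d + a))) := by ring
      _ ≤ m * m ^ k * (C₂ * Real.Gamma (a * k + b)) := by exact mul_le_mul_of_nonneg_left (h₂ k) (by positivity)
      _ = _ := by ring
  linarith

end MittagLeffler

/-! ### Completeness, orthogonality and coefficient decay for the eigenfunctions -/

section Fourier

open Filter Topology

lemma neg_pi_le_pi : -π ≤ π := by linarith [Real.pi_pos]

lemma neg_pi_lt_pi : -π < π := by linarith [Real.pi_pos]

lemma neg_mem_Icc_pi {y : ℝ} (hy : y ∈ Icc (-π) π) : -y ∈ Icc (-π) π :=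
  ⟨by linarith [hy.2], by linarith [hy.1]⟩

lemma integral_reflect (g : ℝ → ℝ) (r : ℝ) : ∫ y in (-r)..r, g (-y) = ∫ y in (-r)..r, g y := by
  simp

lemma integral_odd_eq_zero {g : ℝ → ℝ} (hg : ∀ y ∈ Icc (-π) π, g (-y) = -g y) :
    ∫ y in (-π)..π, g y = 0 := by
  have h1 := integral_reflect g π
  have h2 : ∫ y in (-π)..π, g (-y) = ∫ y in (-π)..π, -g y := by
    apply intervalIntegral.integral_congr
    intro y hy
    rw [uIcc_of_le neg_pi_le_pi] at hy
    exact hg y hy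
  rw [h2, intervalIntegral.integral_neg] at h1
  linarith

/-- Completeness of the cosines among even functions. -/
lemma eq_zero_of_even_of_integral_cos {f : ℝ → ℝ} (hf : ContinuousOn f (Icc (-π) π))
    (he : ∀ y ∈ Icc (-π) π, f (-y) = f y)
    (h : ∀ k : ℕ, ∫ y in (-π)..π, f y * Real.cos (k * y) = 0) :
    ∀ y ∈ Icc (-π) π, f y = 0 := by
  have hT : Fact (0 < 2 * π) := ⟨by positivity⟩
  have hend : -π + 2 * π = π := by ring
  set F : AddCircle (2 * π) → ℂ := AddCircle.liftIco (2 * π) (-π) (fun y => (f y : ℂ)) with hF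
  have hFc : Continuous F := by
    apply AddCircle.liftIco_continuous
    -- Evenness makes the values at `±π` agree, so the lift to the circle is continuous. It also
    -- kills the sine coefficients, leaving the hypothesis on cosines to give all Fourier
    -- coefficients.
    · rw [hend, he π ⟨neg_pi_le_pi, le_rfl⟩]
    · rw [hend]
      exact Complex.continuous_ofReal.comp_continuousOn hf
  have hFv : ∀ y ∈ Ico (-π) π, F (y : AddCircle (2 * π)) = f y := by
    intro y hy
    rw [hF, AddCircle.liftIco_coe_apply]
    rwa [hend]
  have hcosc : ∀ n : ℤ, ContinuousOn (fun y => f y * Real.cos (n * y)) (uIcc (-π) π) := by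
    intro n
    rw [uIcc_of_le neg_pi_le_pi]
    exact hf.mul (by fun_prop)
  have hsinc : ∀ n : ℤ, ContinuousOn (fun y => f y * Real.sin (n * y)) (uIcc (-π) π) := by
    intro n
    rw [uIcc_of_le neg_pi_le_pi]
    exact hf.mul (by fun_prop)
  have hcos : ∀ n : ℤ, ∫ y in (-π)..π, f y * Real.cos (n * y) = 0 := by
    intro n
    obtain ⟨k, rfl | rfl⟩ := Int.eq_nat_or_neg n
    · exact_mod_cast h k
    · have := h k
      push_cast
      simpa only [neg_mul, Real.cos_neg] using this
  have hsin : ∀ n : ℤ, ∫ y in (-π)..π, f y * Real.sin (n * y) = 0 := by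
    intro n
    apply integral_odd_eq_zero
    intro y hy
    rw [he y hy, mul_neg, Real.sin_neg, mul_neg]
  have hcoef : ∀ n : ℤ, fourierCoeff F n = 0 := by
    intro n
    rw [fourierCoeff_eq_intervalIntegral F n (-π), hend]
    have hcongr : ∫ x in (-π)..π, (@fourier (2 * π) (-n) x • F x : ℂ)
        = ∫ x in (-π)..π, (((f x * Real.cos (n * x) : ℝ) : ℂ)
          - Complex.I * ((f x * Real.sin (n * x) : ℝ) : ℂ)) := by
      refine intervalIntegral.integral_congr_Ioo_of_le neg_pi_le_pi fun x hx => ?_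
      rw [hFv x (Ioo_subset_Ico_self hx), fourier_coe_apply]
      have e : (2 * (π : ℂ) * Complex.I * ((-n : ℤ) : ℂ) * x / ((2 * π : ℝ) : ℂ))
          = ((-(n * x) : ℝ) : ℂ) * Complex.I := by
        have : (π : ℂ) ≠ 0 := by exact_mod_cast Real.pi_ne_zero
        push_cast
        field_simp
      rw [e, Complex.exp_mul_I, ← Complex.ofReal_cos, ← Complex.ofReal_sin, Real.cos_neg,
        Real.sin_neg]
      push_cast
      rw [smul_eq_mul]
      ring
    have hi1 : IntervalIntegrable (fun x => ((f x * Real.cos (n * x) : ℝ) : ℂ)) volume (-π) π :=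
      (Complex.continuous_ofReal.comp_continuousOn (hcosc n)).intervalIntegrable
    have hi2 : IntervalIntegrable (fun x => Complex.I * ((f x * Real.sin (n * x) : ℝ) : ℂ))
        volume (-π) π :=
      (continuousOn_const.mul
        (Complex.continuous_ofReal.comp_continuousOn (hsinc n))).intervalIntegrable
    rw [hcongr, intervalIntegral.integral_sub hi1 hi2, intervalIntegral.integral_const_mul,
      intervalIntegral.integral_ofReal, intervalIntegral.integral_ofReal, hcos, hsin]
    simp
  have hsum : Summable (fourierCoeff (⟨F, hFc⟩ : C(AddCircle (2 * π), ℂ))) := by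
    have : fourierCoeff (⟨F, hFc⟩ : C(AddCircle (2 * π), ℂ)) = fun _ => 0 := funext hcoef
    rw [this]
    exact summable_zero
  have hF0 : ∀ x, F x = 0 := by
    intro x
    have h1 := has_pointwise_sum_fourier_series_of_summable hsum x
    have h2 : HasSum (fun i : ℤ => fourierCoeff (⟨F, hFc⟩ : C(AddCircle (2 * π), ℂ)) i • fourier i x)
        (0 : ℂ) := by
      have : ∀ i : ℤ, fourierCoeff (⟨F, hFc⟩ : C(AddCircle (2 * π), ℂ)) i • fourier i x
          = (0 : ℂ) := fun i => by
        rw [show fourierCoeff (⟨F, hFc⟩ : C(AddCircle (2 * π), ℂ)) i = 0 from hcoef i, zero_smul]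
      simp_rw [this]
      exact hasSum_zero
    exact h1.unique h2
  have hIco : ∀ y ∈ Ico (-π) π, f y = 0 := by
    intro y hy
    have := hFv y hy
    rw [hF0] at this
    exact_mod_cast this.symm
  intro y hy
  rcases hy.2.eq_or_lt with h | h
  · rw [← he y hy, h]
    exact hIco _ ⟨le_rfl, neg_pi_lt_pi⟩
  · exact hIco y ⟨hy.1, h⟩

/-- Completeness of the sines of half-integer frequencies among odd functions. -/
lemma eq_zero_of_odd_of_integral_sin {f : ℝ → ℝ} (hf : ContinuousOn f (Icc (-π) π))
    (ho : ∀ y ∈ Icc (-π) π, f (-y) = -f y)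
    (h : ∀ k : ℕ, ∫ y in (-π)..π, f y * Real.sin ((k + 1 / 2) * y) = 0) :
    ∀ y ∈ Icc (-π) π, f y = 0 := by
  have hc : ∀ k : ℕ, IntervalIntegrable (fun y => f y * Real.sin ((k + 1 / 2) * y))
      volume (-π) π := by
    intro k
    apply ContinuousOn.intervalIntegrable
    rw [uIcc_of_le neg_pi_le_pi]
    exact hf.mul (by fun_prop)
  -- Multiplication by `sin(y/2)` makes `f` even, and by the product-to-sum formula its cosine
  -- coefficients become half-differences of consecutive half-integer sine coefficients. The factor
  -- vanishes in `[-π,π]` only at `0`, where oddness takes over.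
  have hg : ∀ y ∈ Icc (-π) π, f y * Real.sin (y / 2) = 0 := by
    apply eq_zero_of_even_of_integral_cos
    · exact hf.mul (by fun_prop)
    · intro y hy
      rw [ho y hy, neg_div, Real.sin_neg]
      ring
    · intro k
      rcases k with _ | k
      · have := h 0
        simp only [Nat.cast_zero, zero_mul, Real.cos_zero, mul_one, zero_add] at this ⊢
        simpa only [one_div, inv_mul_eq_div] using this
      · have e : ∀ y, f y * Real.sin (y / 2) * Real.cos (((k + 1 : ℕ) : ℝ) * y)
            = 1 / 2 * (f y * Real.sin (((k + 1 : ℕ) + 1 / 2) * y)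
              - f y * Real.sin ((k + 1 / 2) * y)) := by
          intro y
          have e1 : (((k + 1 : ℕ) : ℝ) + 1 / 2) * y = (k + 1) * y + y / 2 := by push_cast; ring
          have e2 : ((k : ℝ) + 1 / 2) * y = (k + 1) * y - y / 2 := by ring
          rw [e1, e2, Real.sin_add, Real.sin_sub]
          push_cast
          ring
        simp_rw [e]
        rw [intervalIntegral.integral_const_mul, intervalIntegral.integral_sub (hc _) (hc _),
          h, h]
        simp
  intro y hy
  rcases eq_or_ne y 0 with rfl | hy0
  · have := ho 0 hy
    simp only [neg_zero] at this
    linarith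
  · refine (mul_eq_zero.1 (hg y hy)).resolve_right ?_
    intro hs
    have := (Real.sin_eq_zero_iff_of_lt_of_lt (by linarith [hy.1, Real.pi_pos])
      (by linarith [hy.2, Real.pi_pos])).1 hs
    apply hy0
    linarith

/-- The frequencies `k + 1/2` and `k` of the eigenfunctions. -/
noncomputable def modeFreq : ℕ ⊕ ℕ → ℝ
  | Sum.inl k => k + 1 / 2
  | Sum.inr k => k

/-- The eigenfunctions `sin ((k + 1/2) y)` and `cos (k y)`. -/
noncomputable def modeFun : ℕ ⊕ ℕ → ℝ → ℝ
  | Sum.inl k, y => Real.sin ((k + 1 / 2) * y)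
  | Sum.inr k, y => Real.cos (k * y)

/-- The conjugate functions `cos ((k + 1/2) y)` and `-sin (k y)`. -/
noncomputable def modeConj : ℕ ⊕ ℕ → ℝ → ℝ
  | Sum.inl k, y => Real.cos ((k + 1 / 2) * y)
  | Sum.inr k, y => -Real.sin (k * y)

/-- Fourier coefficients along the eigenfunctions. -/
noncomputable def modeCoeff (f : ℝ → ℝ) : ℕ ⊕ ℕ → ℝ
  | Sum.inl k => coeffSin f k
  | Sum.inr 0 => coeffZero f
  | Sum.inr (k + 1) => coeffCos f (k + 1)

lemma modeFreq_nonneg (i : ℕ ⊕ ℕ) : 0 ≤ modeFreq i := by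
  rcases i with k | k <;> simp only [modeFreq] <;> positivity

lemma half_le_modeFreq {i : ℕ ⊕ ℕ} (hi : i ≠ Sum.inr 0) : 1 / 2 ≤ modeFreq i := by
  rcases i with k | k
  · simp only [modeFreq]
    linarith [(Nat.cast_nonneg k : (0 : ℝ) ≤ k)]
  · simp only [modeFreq]
    have : k ≠ 0 := fun h => hi (by rw [h])
    have : (1 : ℝ) ≤ k := by exact_mod_cast Nat.one_le_iff_ne_zero.2 this
    linarith

/-- Doubled frequencies are odd in one family and even in the other. Hence a single orthogonality
proof covers both families and the mixed pairs. -/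
lemma modeFreq_injective : Function.Injective modeFreq := by
  rintro (j | j) (k | k) h
  · simp only [modeFreq, add_left_inj, Nat.cast_inj] at h
    rw [h]
  · exfalso
    simp only [modeFreq] at h
    have h2 : ((2 * j + 1 : ℕ) : ℝ) = ((2 * k : ℕ) : ℝ) := by push_cast; linarith
    have := Nat.cast_injective h2
    omega
  · exfalso
    simp only [modeFreq] at h
    have h2 : ((2 * j : ℕ) : ℝ) = ((2 * k + 1 : ℕ) : ℝ) := by push_cast; linarith
    have := Nat.cast_injective h2
    omega
  · simp only [modeFreq, Nat.cast_inj] at h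
    rw [h]

lemma hasDerivAt_modeFun (i : ℕ ⊕ ℕ) (y : ℝ) :
    HasDerivAt (modeFun i) (modeFreq i * modeConj i y) y := by
  rcases i with k | k
  · have := ((hasDerivAt_id y).const_mul ((k : ℝ) + 1 / 2)).sin
    exact this.congr_deriv (by simp [modeConj, modeFreq, mul_comm])
  · have := ((hasDerivAt_id y).const_mul (k : ℝ)).cos
    exact this.congr_deriv (by simp [modeConj, modeFreq, mul_comm])

lemma hasDerivAt_modeConj (i : ℕ ⊕ ℕ) (y : ℝ) :
    HasDerivAt (modeConj i) (-(modeFreq i * modeFun i y)) y := by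
  rcases i with k | k
  · have := ((hasDerivAt_id y).const_mul ((k : ℝ) + 1 / 2)).cos
    exact this.congr_deriv (by simp [modeFun, modeFreq, mul_comm])
  · have := (((hasDerivAt_id y).const_mul (k : ℝ)).sin).neg
    exact this.congr_deriv (by simp [modeFun, modeFreq, mul_comm])

lemma continuous_modeFun (i : ℕ ⊕ ℕ) : Continuous (modeFun i) :=
  continuous_iff_continuousAt.2 fun y => (hasDerivAt_modeFun i y).continuousAt

lemma continuous_modeConj (i : ℕ ⊕ ℕ) : Continuous (modeConj i) :=
  continuous_iff_continuousAt.2 fun y => (hasDerivAt_modeConj i y).continuousAt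

/-- This is the Neumann condition for the eigenfunctions; it removes the boundary terms when
integrating by parts against `modeConj`. -/
lemma modeConj_pi (i : ℕ ⊕ ℕ) : modeConj i π = 0 := by
  rcases i with k | k
  · simp only [modeConj]
    rw [add_mul, show (1 : ℝ) / 2 * π = π / 2 by ring, Real.cos_add_pi_div_two]
    simp
  · simp [modeConj]

lemma modeConj_neg_pi (i : ℕ ⊕ ℕ) : modeConj i (-π) = 0 := by
  have h := modeConj_pi i
  rcases i with k | k
  · simp only [modeConj] at h ⊢
    rw [mul_neg, Real.cos_neg, h]
  · simp [modeConj]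

lemma abs_modeFun_le (i : ℕ ⊕ ℕ) (y : ℝ) : |modeFun i y| ≤ 1 := by
  rcases i with k | k
  · exact Real.abs_sin_le_one _
  · exact Real.abs_cos_le_one _

lemma abs_modeConj_le (i : ℕ ⊕ ℕ) (y : ℝ) : |modeConj i y| ≤ 1 := by
  rcases i with k | k
  · exact Real.abs_cos_le_one _
  · simp only [modeConj, abs_neg]
    exact Real.abs_sin_le_one _

lemma modeFun_sq_add_modeConj_sq (i : ℕ ⊕ ℕ) (y : ℝ) : modeFun i y ^ 2 + modeConj i y ^ 2 = 1 := by
  rcases i with k | k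
  · simp [modeFun, modeConj]
  · simp [modeFun, modeConj]

/-- Integration by parts against an eigenfunction. -/
lemma integral_mul_modeConj_of_hasDeriv {f f' : ℝ → ℝ}
    (hf : ∀ y ∈ Icc (-π) π, HasDerivWithinAt f (f' y) (Icc (-π) π) y)
    (hf' : ContinuousOn f' (Icc (-π) π)) (i : ℕ ⊕ ℕ) :
    ∫ y in (-π)..π, f' y * modeConj i y = modeFreq i * ∫ y in (-π)..π, f y * modeFun i y := by
  have h := intervalIntegral.integral_mul_deriv_eq_deriv_mul_of_hasDerivWithinAt
    (a := -π) (b := π) (u := f) (u' := f') (v := modeConj i)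
    (v' := fun y => -(modeFreq i * modeFun i y))
    (by rw [uIcc_of_le neg_pi_le_pi]; exact hf)
    (fun y _ => (hasDerivAt_modeConj i y).hasDerivWithinAt)
    (by apply ContinuousOn.intervalIntegrable; rwa [uIcc_of_le neg_pi_le_pi])
    (((continuous_modeFun i).const_mul _).neg.intervalIntegrable _ _)
  rw [modeConj_pi, modeConj_neg_pi] at h
  rw [← intervalIntegral.integral_const_mul]
  have e : ∀ y, f y * -(modeFreq i * modeFun i y) = -(modeFreq i * (f y * modeFun i y)) :=
    fun y => by ring
  simp_rw [e] at h
  rw [intervalIntegral.integral_neg] at h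
  linarith

/-- The eigenfunctions need not vanish at `±π`, so the boundary terms must be removed by `f`; the
lemma is applied to a derivative satisfying the Neumann condition. -/
lemma integral_mul_modeFun_of_hasDeriv {f f' : ℝ → ℝ}
    (hf : ∀ y ∈ Icc (-π) π, HasDerivWithinAt f (f' y) (Icc (-π) π) y)
    (hf' : ContinuousOn f' (Icc (-π) π)) (hl : f (-π) = 0) (hr : f π = 0) (i : ℕ ⊕ ℕ) :
    ∫ y in (-π)..π, f' y * modeFun i y = -(modeFreq i * ∫ y in (-π)..π, f y * modeConj i y) := by
  have h := intervalIntegral.integral_mul_deriv_eq_deriv_mul_of_hasDerivWithinAt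
    (a := -π) (b := π) (u := f) (u' := f') (v := modeFun i)
    (v' := fun y => modeFreq i * modeConj i y)
    (by rw [uIcc_of_le neg_pi_le_pi]; exact hf)
    (fun y _ => (hasDerivAt_modeFun i y).hasDerivWithinAt)
    (by apply ContinuousOn.intervalIntegrable; rwa [uIcc_of_le neg_pi_le_pi])
    (((continuous_modeConj i).const_mul _).intervalIntegrable _ _)
  rw [hl, hr] at h
  rw [← intervalIntegral.integral_const_mul]
  have e : ∀ y, f y * (modeFreq i * modeConj i y) = modeFreq i * (f y * modeConj i y) :=
    fun y => by ring
  simp_rw [e] at h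
  linarith

lemma integral_modeConj_mul (i j : ℕ ⊕ ℕ) :
    modeFreq i * ∫ y in (-π)..π, modeConj i y * modeConj j y
      = modeFreq j * ∫ y in (-π)..π, modeFun i y * modeFun j y := by
  rw [← integral_mul_modeConj_of_hasDeriv (f := modeFun i)
    (f' := fun y => modeFreq i * modeConj i y)
    (fun y _ => (hasDerivAt_modeFun i y).hasDerivWithinAt)
    ((continuous_modeConj i).const_mul _).continuousOn, ← intervalIntegral.integral_const_mul]
  simp_rw [mul_assoc]

/-- Integration by parts in both orders relates the two inner products, `ω_i A = ω_j B` and `ω_j A =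
ω_i B`. Eliminating `A` leaves `(ω_j² - ω_i²) B = 0`. -/
lemma integral_modeFun_mul_of_ne {i j : ℕ ⊕ ℕ} (hij : i ≠ j) :
    ∫ y in (-π)..π, modeFun i y * modeFun j y = 0 := by
  have h1 := integral_modeConj_mul i j
  have h2 := integral_modeConj_mul j i
  simp_rw [mul_comm (modeConj j _), mul_comm (modeFun j _)] at h2
  have hne : modeFreq i ≠ modeFreq j := fun h => hij (modeFreq_injective h)
  have hi := modeFreq_nonneg i
  have hj := modeFreq_nonneg j
  set A := ∫ y in (-π)..π, modeConj i y * modeConj j y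
  set B := ∫ y in (-π)..π, modeFun i y * modeFun j y
  have h3 : (modeFreq j - modeFreq i) * ((modeFreq j + modeFreq i) * B) = 0 := by
    linear_combination modeFreq i * h2 - modeFreq j * h1
  have h4 : modeFreq j + modeFreq i ≠ 0 := by
    intro h
    apply hne
    linarith
  rcases mul_eq_zero.1 h3 with h | h
  · exact absurd (by linarith) hne
  · exact (mul_eq_zero.1 h).resolve_left h4

lemma integral_modeConj_mul_of_ne {i j : ℕ ⊕ ℕ} (hij : i ≠ j) :
    ∫ y in (-π)..π, modeConj i y * modeConj j y = 0 := by
  have key : ∀ i j : ℕ ⊕ ℕ, i ≠ j → modeFreq i ≠ 0 →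
      ∫ y in (-π)..π, modeConj i y * modeConj j y = 0 := by
    intro i j hij hi
    have h1 := integral_modeConj_mul i j
    rw [integral_modeFun_mul_of_ne hij, mul_zero] at h1
    exact (mul_eq_zero.1 h1).resolve_left hi
  by_cases hi : modeFreq i = 0
  · have hj : modeFreq j ≠ 0 := fun h => hij (modeFreq_injective (hi.trans h.symm))
    simpa only [mul_comm] using key j i hij.symm hj
  · exact key i j hij hi

lemma integral_modeFun_sq {i : ℕ ⊕ ℕ} (hi : i ≠ Sum.inr 0) :
    ∫ y in (-π)..π, modeFun i y * modeFun i y = π := by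
  have h1 := integral_modeConj_mul i i
  have hi := half_le_modeFreq hi
  have h2 := mul_left_cancel₀ (show modeFreq i ≠ 0 by linarith) h1
  have h3 : ∫ y in (-π)..π, (modeFun i y * modeFun i y + modeConj i y * modeConj i y) = 2 * π := by
    have : ∀ y, modeFun i y * modeFun i y + modeConj i y * modeConj i y = 1 := fun y => by
      rw [← modeFun_sq_add_modeConj_sq i y]; ring
    simp_rw [this]
    rw [intervalIntegral.integral_const]
    simp only [smul_eq_mul]
    ring
  have c1 := continuous_modeFun i
  have c2 := continuous_modeConj i
  rw [intervalIntegral.integral_add ((c1.fun_mul c1).intervalIntegrable _ _)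
    ((c2.fun_mul c2).intervalIntegrable _ _)] at h3
  linarith

lemma modeCoeff_eq {i : ℕ ⊕ ℕ} (hi : i ≠ Sum.inr 0) (f : ℝ → ℝ) :
    modeCoeff f i = π⁻¹ * ∫ y in (-π)..π, f y * modeFun i y := by
  rcases i with k | _ | k
  · rfl
  · exact absurd rfl hi
  · rfl

lemma modeCoeff_inr_zero (f : ℝ → ℝ) :
    modeCoeff f (Sum.inr 0) = (2 * π)⁻¹ * ∫ y in (-π)..π, f y * modeFun (Sum.inr 0) y := by
  simp [modeCoeff, coeffZero, modeFun]

/-- A continuous function all of whose Fourier coefficients vanish is zero. -/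
lemma eq_zero_of_integral_modeFun {f : ℝ → ℝ} (hf : ContinuousOn f (Icc (-π) π))
    (h : ∀ i, ∫ y in (-π)..π, f y * modeFun i y = 0) : ∀ y ∈ Icc (-π) π, f y = 0 := by
  have hfr : ContinuousOn (fun y => f (-y)) (Icc (-π) π) :=
    hf.comp continuous_neg.continuousOn fun y hy => neg_mem_Icc_pi hy
  have hint : ∀ g : ℝ → ℝ, ContinuousOn g (Icc (-π) π) → ∀ i,
      IntervalIntegrable (fun y => g y * modeFun i y) volume (-π) π := by
    intro g hg i
    apply ContinuousOn.intervalIntegrable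
    rw [uIcc_of_le neg_pi_le_pi]
    exact hg.mul (continuous_modeFun i).continuousOn
  have he : ∀ y ∈ Icc (-π) π, f y + f (-y) = 0 := by
    apply eq_zero_of_even_of_integral_cos (hf.fun_add hfr)
    · intro y _
      rw [neg_neg, add_comm]
    · intro k
      have h1 := hint _ hf (Sum.inr k)
      have h2 := hint _ hfr (Sum.inr k)
      simp only [modeFun] at h1 h2
      simp_rw [add_mul]
      rw [intervalIntegral.integral_add h1 h2]
      have h3 := integral_reflect (fun y => f y * Real.cos (k * y)) π
      simp only [mul_neg, Real.cos_neg] at h3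
      have h4 := h (Sum.inr k)
      simp only [modeFun] at h4
      rw [h3, h4, add_zero]
  have ho : ∀ y ∈ Icc (-π) π, f y - f (-y) = 0 := by
    apply eq_zero_of_odd_of_integral_sin (hf.fun_sub hfr)
    · intro y _
      rw [neg_neg, neg_sub]
    · intro k
      have h1 := hint _ hf (Sum.inl k)
      have h2 := hint _ hfr (Sum.inl k)
      simp only [modeFun] at h1 h2
      simp_rw [sub_mul]
      rw [intervalIntegral.integral_sub h1 h2]
      have h3 := integral_reflect (fun y => f y * Real.sin ((k + 1 / 2) * y)) π
      simp only [mul_neg, Real.sin_neg] at h3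
      rw [intervalIntegral.integral_neg] at h3
      have h4 := h (Sum.inl k)
      simp only [modeFun] at h4
      rw [h4] at h3 ⊢
      linarith
  intro y hy
  linarith [he y hy, ho y hy]

/-- Bessel's inequality. -/
lemma sum_sq_integral_le {ι : Type*} {Z : ι → ℝ → ℝ} (hZ : ∀ i, Continuous (Z i))
    (hb : ∀ i y, |Z i y| ≤ 1) (ho : ∀ i j, i ≠ j → ∫ y in (-π)..π, Z i y * Z j y = 0)
    {f : ℝ → ℝ} (hf : ContinuousOn f (Icc (-π) π)) (s : Finset ι) :
    ∑ i ∈ s, (∫ y in (-π)..π, f y * Z i y) ^ 2 ≤ 2 * π * ∫ y in (-π)..π, f y ^ 2 := by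
  classical
  have hpi := Real.pi_pos
  have hf' : ContinuousOn f (uIcc (-π) π) := by rwa [uIcc_of_le neg_pi_le_pi]
  -- The trial coefficients `β/(2π)` are not the exact projection. They need only `∫ Z_i² ≤ 2π`, so
  -- unnormalised families are admitted, including `modeConj`, whose member at `Sum.inr 0` is zero.
  set β : ι → ℝ := fun i => ∫ y in (-π)..π, f y * Z i y with hβ
  have h1 : ∀ s : Finset ι, ∀ y, (f y - ∑ i ∈ s, β i / (2 * π) * Z i y) ^ 2
      = f y ^ 2 - 2 * ∑ i ∈ s, β i / (2 * π) * (f y * Z i y)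
        + ∑ i ∈ s, ∑ j ∈ s, β i / (2 * π) * (β j / (2 * π)) * (Z i y * Z j y) := by
    intro s y
    rw [sub_sq, sq (∑ i ∈ s, _), Finset.sum_mul_sum, mul_assoc, Finset.mul_sum]
    congr 2
    · congr 2
      funext i
      ring
    · funext i
      apply Finset.sum_congr rfl
      intro j _
      ring
  have hpos : 0 ≤ ∫ y in (-π)..π, (f y - ∑ i ∈ s, β i / (2 * π) * Z i y) ^ 2 :=
    intervalIntegral.integral_nonneg neg_pi_le_pi fun y _ => sq_nonneg _
  simp_rw [h1] at hpos
  have i1 : IntervalIntegrable (fun y => f y ^ 2) volume (-π) π := (hf'.pow 2).intervalIntegrable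
  have i2 : ∀ i, IntervalIntegrable (fun y => β i / (2 * π) * (f y * Z i y)) volume (-π) π :=
    fun i => (continuousOn_const.mul (hf'.mul (hZ i).continuousOn)).intervalIntegrable
  have i3 : ∀ i j, IntervalIntegrable
      (fun y => β i / (2 * π) * (β j / (2 * π)) * (Z i y * Z j y)) volume (-π) π :=
    fun i j => (continuous_const.mul ((hZ i).mul (hZ j))).intervalIntegrable _ _
  have i2' : IntervalIntegrable (fun y => ∑ i ∈ s, β i / (2 * π) * (f y * Z i y)) volume (-π) π :=
by
    rw [← Finset.sum_fn]
    exact IntervalIntegrable.sum s (fun i _ => i2 i)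
  have i3'' : ∀ i, IntervalIntegrable
      (fun y => ∑ j ∈ s, β i / (2 * π) * (β j / (2 * π)) * (Z i y * Z j y)) volume (-π) π :=
    fun i => by
      rw [← Finset.sum_fn]
      exact IntervalIntegrable.sum s (fun j _ => i3 i j)
  have i3' : IntervalIntegrable
      (fun y => ∑ i ∈ s, ∑ j ∈ s, β i / (2 * π) * (β j / (2 * π)) * (Z i y * Z j y))
      volume (-π) π := by
    rw [← Finset.sum_fn]
    exact IntervalIntegrable.sum s (fun i _ => i3'' i)
  rw [intervalIntegral.integral_add (i1.sub (i2'.const_mul 2)) i3',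
    intervalIntegral.integral_sub i1 (i2'.const_mul 2), intervalIntegral.integral_const_mul,
    intervalIntegral.integral_finsetSum (fun i _ => i2 i),
    intervalIntegral.integral_finsetSum (fun i _ => i3'' i)] at hpos
  have h2 : ∀ i ∈ s, ∫ y in (-π)..π,
      (∑ j ∈ s, β i / (2 * π) * (β j / (2 * π)) * (Z i y * Z j y)) ≤ β i ^ 2 / (2 * π) := by
    intro i hi
    rw [intervalIntegral.integral_finsetSum (fun j _ => i3 i j)]
    simp_rw [intervalIntegral.integral_const_mul]
    rw [Finset.sum_eq_single i]
    · have h3 : ∫ y in (-π)..π, Z i y * Z i y ≤ 2 * π := by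
        have : ∫ y in (-π)..π, Z i y * Z i y ≤ ∫ y in (-π)..π, (1 : ℝ) := by
          apply intervalIntegral.integral_mono_on neg_pi_le_pi
            (((hZ i).fun_mul (hZ i)).intervalIntegrable _ _) (by simp)
          intro y _
          rw [← abs_mul_abs_self]
          nlinarith [hb i y, abs_nonneg (Z i y)]
        rw [intervalIntegral.integral_const] at this
        simp only [smul_eq_mul] at this
        linarith
      calc β i / (2 * π) * (β i / (2 * π)) * ∫ y in (-π)..π, Z i y * Z i y
          ≤ β i / (2 * π) * (β i / (2 * π)) * (2 * π) := by
            apply mul_le_mul_of_nonneg_left h3 (mul_self_nonneg _)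
        _ = β i ^ 2 / (2 * π) := by field_simp
    · intro j _ hj
      rw [ho i j hj.symm, mul_zero]
    · intro h
      exact absurd hi h
  have h4 := Finset.sum_le_sum h2
  have h5 : ∀ i ∈ s, ∫ y in (-π)..π, β i / (2 * π) * (f y * Z i y) = β i ^ 2 / (2 * π) := by
    intro i _
    rw [intervalIntegral.integral_const_mul]
    simp only [hβ]
    ring
  rw [Finset.sum_congr rfl h5] at hpos
  have h6 : ∑ i ∈ s, β i ^ 2 / (2 * π) ≤ ∫ y in (-π)..π, f y ^ 2 := by linarith
  rw [← Finset.sum_div, div_le_iff₀ (by positivity)] at h6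
  linarith

lemma summable_sq_integral {ι : Type*} {Z : ι → ℝ → ℝ} (hZ : ∀ i, Continuous (Z i))
    (hb : ∀ i y, |Z i y| ≤ 1) (ho : ∀ i j, i ≠ j → ∫ y in (-π)..π, Z i y * Z j y = 0)
    {f : ℝ → ℝ} (hf : ContinuousOn f (Icc (-π) π)) :
    Summable fun i => (∫ y in (-π)..π, f y * Z i y) ^ 2 :=
  summable_of_sum_le (fun _ => sq_nonneg _) (sum_sq_integral_le hZ hb ho hf)

/-- The zero frequency contributes `0⁻¹ = 0`, so no mode has to be removed. -/
lemma summable_inv_modeFreq_sq : Summable fun i => (modeFreq i ^ 2)⁻¹ := by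
  have h : Summable fun k : ℕ => (((k : ℝ)) ^ 2)⁻¹ :=
    Real.summable_nat_pow_inv.2 (by norm_num)
  refine Summable.sum _ ?_ h
  · refine Summable.of_norm_bounded_eventually_nat h ?_
    filter_upwards [eventually_ge_atTop 1] with k hk
    have hk' : (1 : ℝ) ≤ k := by exact_mod_cast hk
    simp only [Function.comp, modeFreq]
    rw [norm_inv, norm_pow, Real.norm_of_nonneg (by positivity)]
    gcongr
    linarith

/-- A weighted summability statement for coefficients of order `β i / ω i`. -/
lemma summable_abs_div_modeFreq {β : ℕ ⊕ ℕ → ℝ} (hβ : Summable fun i => β i ^ 2) :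
    Summable fun i => |β i| / modeFreq i := by
  refine Summable.of_nonneg_of_le (fun i => div_nonneg (abs_nonneg _) (modeFreq_nonneg i)) ?_
    (hβ.add summable_inv_modeFreq_sq)
  intro i
  have := two_mul_le_add_sq |β i| (modeFreq i)⁻¹
  have h2 : 0 ≤ |β i| * (modeFreq i)⁻¹ :=
    mul_nonneg (abs_nonneg _) (inv_nonneg.2 (modeFreq_nonneg i))
  rw [sq_abs, inv_pow] at this
  rw [div_eq_mul_inv]
  linarith

lemma contDiffOn_derivWithin_Icc {n : ℕ} {f : ℝ → ℝ}
    (hf : ContDiffOn ℝ (n + 1 : ℕ) f (Icc (-π) π)) :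
    ContDiffOn ℝ n (derivWithin f (Icc (-π) π)) (Icc (-π) π) ∧
    ∀ y ∈ Icc (-π) π, HasDerivWithinAt f (derivWithin f (Icc (-π) π) y) (Icc (-π) π) y := by
  have hu := uniqueDiffOn_Icc neg_pi_lt_pi
  constructor
  · exact hf.derivWithin hu (by norm_cast)
  · intro y hy
    exact ((hf.differentiableOn (by simp)) y hy).hasDerivWithinAt

/-- Two integrations by parts: the first boundary term vanishes by the Neumann condition on the
modes, the second by the one on `f`. -/
lemma modeFreq_sq_mul_integral {f : ℝ → ℝ} {n : ℕ}
    (hf : ContDiffOn ℝ (n + 2 : ℕ) f (Icc (-π) π))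
    (hl : derivWithin f (Icc (-π) π) (-π) = 0) (hr : derivWithin f (Icc (-π) π) π = 0) :
    ∃ f₂ : ℝ → ℝ, ContDiffOn ℝ n f₂ (Icc (-π) π) ∧ ∀ i,
      modeFreq i ^ 2 * ∫ y in (-π)..π, f y * modeFun i y = -∫ y in (-π)..π, f₂ y * modeFun i y := by
  obtain ⟨h1, h1'⟩ := contDiffOn_derivWithin_Icc hf
  obtain ⟨h2, h2'⟩ := contDiffOn_derivWithin_Icc h1
  refine ⟨_, h2, fun i => ?_⟩
  rw [integral_mul_modeFun_of_hasDeriv h2' h2.continuousOn hl hr,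
    integral_mul_modeConj_of_hasDeriv h1' h1.continuousOn]
  ring

lemma summable_of_ne_inr_zero {a b : ℕ ⊕ ℕ → ℝ} (hb : Summable b)
    (h : ∀ i, i ≠ Sum.inr 0 → |a i| ≤ b i) : Summable a := by
  refine Summable.of_norm_bounded_eventually hb ?_
  have : ({Sum.inr 0} : Set (ℕ ⊕ ℕ)).Finite := finite_singleton _
  refine this.subset fun i hi => ?_
  by_contra h'
  exact hi (h i h')

/-- The coefficient times `ω` is a square-summable sequence divided by `ω`, so it is summable. This
weight is what continuity of `u_y` up to `x = 1` asks of `ψ`. -/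
lemma summable_mul_modeCoeff_of_contDiffOn_two {f : ℝ → ℝ}
    (hf : ContDiffOn ℝ (2 : ℕ) f (Icc (-π) π))
    (hl : derivWithin f (Icc (-π) π) (-π) = 0) (hr : derivWithin f (Icc (-π) π) π = 0) :
    Summable fun i => (1 + modeFreq i) * |modeCoeff f i| := by
  obtain ⟨f₂, hf₂, h⟩ := modeFreq_sq_mul_integral (n := 0) hf hl hr
  have hs := summable_abs_div_modeFreq (summable_sq_integral continuous_modeFun abs_modeFun_le
    (fun i j => integral_modeFun_mul_of_ne) hf₂.continuousOn)
  refine summable_of_ne_inr_zero (hs.mul_left (3 * π⁻¹)) fun i hi => ?_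
  have hω := half_le_modeFreq hi
  have hω0 : 0 < modeFreq i := by linarith
  have hpi := Real.pi_pos
  rw [abs_mul, abs_abs, modeCoeff_eq hi, abs_mul, abs_of_pos (inv_pos.2 hpi),
    abs_of_pos (by linarith : 0 < 1 + modeFreq i)]
  have h2 := congrArg abs (h i)
  rw [abs_mul, abs_neg, abs_of_pos (by positivity)] at h2
  rw [← h2]
  set I := |∫ y in (-π)..π, f y * modeFun i y| with hI
  have hI0 : 0 ≤ I := abs_nonneg _
  rw [show 3 * π⁻¹ * (modeFreq i ^ 2 * I / modeFreq i) = 3 * modeFreq i * (π⁻¹ * I) by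
    field_simp]
  apply mul_le_mul_of_nonneg_right (by linarith) (by positivity)

/-- A third integration by parts, now against `modeConj` and hence without boundary terms, gains one
more power of `ω` over the `C²` case. The weight `ω²` on `φ` controls the second derivatives near `x
= 0`, where the modes need not decay in `μ`. -/
lemma summable_mul_modeCoeff_of_contDiffOn_three {f : ℝ → ℝ}
    (hf : ContDiffOn ℝ (3 : ℕ) f (Icc (-π) π))
    (hl : derivWithin f (Icc (-π) π) (-π) = 0) (hr : derivWithin f (Icc (-π) π) π = 0) :
    Summable fun i => (1 + modeFreq i ^ 2) * |modeCoeff f i| := by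
  obtain ⟨f₂, hf₂, h⟩ := modeFreq_sq_mul_integral (n := 1) hf hl hr
  obtain ⟨h3, h3'⟩ := contDiffOn_derivWithin_Icc (n := 0) hf₂
  have hs := summable_abs_div_modeFreq (summable_sq_integral continuous_modeConj abs_modeConj_le
    (fun i j => integral_modeConj_mul_of_ne) h3.continuousOn)
  refine summable_of_ne_inr_zero (hs.mul_left (5 * π⁻¹)) fun i hi => ?_
  have hω := half_le_modeFreq hi
  have hω0 : 0 < modeFreq i := by linarith
  have hpi := Real.pi_pos
  rw [abs_mul, abs_abs, modeCoeff_eq hi, abs_mul, abs_of_pos (inv_pos.2 hpi),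
    abs_of_pos (by positivity : 0 < 1 + modeFreq i ^ 2)]
  have h2 := congrArg abs (h i)
  have h4 := congrArg abs (integral_mul_modeConj_of_hasDeriv h3' h3.continuousOn i)
  rw [abs_mul, abs_neg, abs_of_pos (by positivity)] at h2
  rw [abs_mul, abs_of_pos hω0] at h4
  rw [h4, ← h2]
  set I := |∫ y in (-π)..π, f y * modeFun i y| with hI
  have hI0 : 0 ≤ I := abs_nonneg _
  rw [show 5 * π⁻¹ * (modeFreq i * (modeFreq i ^ 2 * I) / modeFreq i)
    = 5 * modeFreq i ^ 2 * (π⁻¹ * I) by field_simp]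
  apply mul_le_mul_of_nonneg_right (by nlinarith) (by positivity)

/-- An absolutely convergent Fourier series represents its function. -/
lemma tsum_modeCoeff_mul_modeFun {f : ℝ → ℝ} (hf : ContinuousOn f (Icc (-π) π))
    (hs : Summable fun i => |modeCoeff f i|) :
    ∀ y ∈ Icc (-π) π, ∑' i, modeCoeff f i * modeFun i y = f y := by
  have hpi := Real.pi_pos
  have hb : ∀ i y, ‖modeCoeff f i * modeFun i y‖ ≤ |modeCoeff f i| := by
    intro i y
    rw [norm_mul, Real.norm_eq_abs, Real.norm_eq_abs]
    exact mul_le_of_le_one_right (abs_nonneg _) (abs_modeFun_le i y)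
  have hc : Continuous fun y => ∑' i, modeCoeff f i * modeFun i y :=
    continuous_tsum (fun i => (continuous_modeFun i).const_mul _) hs hb
  have h0 := eq_zero_of_integral_modeFun (f := fun y => f y - ∑' i, modeCoeff f i * modeFun i y)
    (hf.fun_sub hc.continuousOn) ?_
  · intro y hy
    have := h0 y hy
    linarith
  intro j
  have hf1 : IntervalIntegrable (fun y => f y * modeFun j y) volume (-π) π := by
    apply ContinuousOn.intervalIntegrable
    rw [uIcc_of_le neg_pi_le_pi]
    exact hf.mul (continuous_modeFun j).continuousOn
  have hser : HasSum (fun i => ∫ y in (-π)..π, modeCoeff f i * modeFun i y * modeFun j y)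
      (∫ y in (-π)..π, (∑' i, modeCoeff f i * modeFun i y) * modeFun j y) := by
    apply intervalIntegral.hasSum_integral_of_dominated_convergence
      (fun i _ => |modeCoeff f i|)
    · intro i
      exact (((continuous_modeFun i).const_mul _).mul
        (continuous_modeFun j)).aestronglyMeasurable
    · intro i
      refine Eventually.of_forall fun y _ => ?_
      rw [norm_mul]
      calc _ ≤ ‖modeCoeff f i * modeFun i y‖ * 1 := by
            gcongr
            exact abs_modeFun_le j y
        _ ≤ _ := by rw [mul_one]; exact hb i y
    · exact Eventually.of_forall fun y _ => hs
    · simp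
    · refine Eventually.of_forall fun y _ => ?_
      exact (Summable.of_norm_bounded hs fun i => hb i y).hasSum.mul_right _
  have hval : ∫ y in (-π)..π, (∑' i, modeCoeff f i * modeFun i y) * modeFun j y
      = ∫ y in (-π)..π, f y * modeFun j y := by
    rw [← hser.tsum_eq, tsum_eq_single j]
    · simp_rw [mul_assoc]
      rw [intervalIntegral.integral_const_mul]
      by_cases hj : j = Sum.inr 0
      · rw [hj, modeCoeff_inr_zero]
        have : ∫ y in (-π)..π, modeFun (Sum.inr 0) y * modeFun (Sum.inr 0) y = 2 * π := by
          simp only [modeFun, Nat.cast_zero, zero_mul, Real.cos_zero, mul_one,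
            intervalIntegral.integral_const, smul_eq_mul]
          ring
        rw [this]
        field_simp
      · rw [modeCoeff_eq hj, integral_modeFun_sq hj]
        field_simp
    · intro i hij
      simp_rw [mul_assoc]
      rw [intervalIntegral.integral_const_mul, integral_modeFun_mul_of_ne hij, mul_zero]
  simp_rw [sub_mul]
  rw [intervalIntegral.integral_sub hf1 ((hc.fun_mul (continuous_modeFun j)).intervalIntegrable _ _),
    hval, sub_self]

end Fourier

/-! ### Termwise Caputo differentiation and joint continuity of series -/

section Series

open Filter Topology

/-- The Caputo derivative may be taken termwise in a series whose derivatives are dominated by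
`γ i * x ^ (α - 1)`. -/
theorem caputoDeriv_tsum {ι : Type*} [Countable ι] {α : ℝ} (hα0 : 0 < α) (hα1 : α ≤ 1)
    {f d n : ι → ℝ → ℝ} {γ : ι → ℝ} {F : ℝ → ℝ}
    (hF : ∀ x ∈ Ioo (0 : ℝ) 1, F x = ∑' i, f i x)
    (hf : ∀ x ∈ Ioo (0 : ℝ) 1, Summable fun i => f i x)
    (hd : ∀ i, ∀ x ∈ Ioo (0 : ℝ) 1, HasDerivAt (f i) (d i x) x)
    (hdc : ∀ i, ContinuousOn (d i) (Ioo 0 1))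
    (hn : ∀ i, ∀ x ∈ Ioo (0 : ℝ) 1, fracInt (1 - α) (d i) x = n i x)
    (hγ : Summable γ)
    (hb : ∀ ρ ∈ Ioo (0 : ℝ) 1, ∃ C, 0 ≤ C ∧ ∀ i, ∀ x ∈ Ioc (0 : ℝ) ρ,
      |d i x| ≤ C * γ i * x ^ (α - 1)) :
    CaputoDifferentiable α F ∧ ∀ x ∈ Ioo (0 : ℝ) 1, caputoDeriv α F x = ∑' i, n i x := by
  -- On an interval around `x` bounded away from `0` and `1` the weight `y^(α-1)` is at most
  -- `(x/2)^(α-1)`, so the differentiated series converges uniformly there.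
  have hder : ∀ x ∈ Ioo (0 : ℝ) 1, HasDerivAt F (∑' i, d i x) x := by
    intro x hx
    obtain ⟨C, hC, hCb⟩ := hb ((x + 1) / 2) ⟨by linarith [hx.1], by linarith [hx.2]⟩
    have hmem : ∀ y ∈ Ioo (x / 2) ((x + 1) / 2), y ∈ Ioo (0 : ℝ) 1 := fun y hy =>
      ⟨by linarith [hy.1, hx.1], by linarith [hy.2, hx.2]⟩
    have hxm : x ∈ Ioo (x / 2) ((x + 1) / 2) := ⟨by linarith [hx.1], by linarith [hx.2]⟩
    have h1 := hasDerivAt_tsum_of_isPreconnected (g := f) (g' := d)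
      (u := fun i => C * γ i * (x / 2) ^ (α - 1)) (t := Ioo (x / 2) ((x + 1) / 2))
      ((hγ.mul_left C).mul_right _) isOpen_Ioo isPreconnected_Ioo
      (fun i y hy => hd i y (hmem y hy)) ?_ hxm (hf x hx) hxm
    · refine h1.congr_of_eventuallyEq ?_
      filter_upwards [Ioo_mem_nhds hx.1 hx.2] with y hy
      exact hF y hy
    · intro i y hy
      have h2 := hCb i y ⟨by linarith [hy.1, hx.1], hy.2.le⟩
      refine h2.trans ?_
      have h3 : y ^ (α - 1) ≤ (x / 2) ^ (α - 1) :=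
        Real.rpow_le_rpow_of_nonpos (by linarith [hx.1]) hy.1.le (by linarith)
      have h4 : 0 ≤ C * γ i := by
        by_contra h
        have : C * γ i * y ^ (α - 1) < 0 :=
          mul_neg_of_neg_of_pos (not_le.1 h) (Real.rpow_pos_of_pos (by linarith [hy.1, hx.1]) _)
        linarith [abs_nonneg (d i y)]
      gcongr
  have hderiv : ∀ x ∈ Ioo (0 : ℝ) 1, deriv F x = ∑' i, d i x := fun x hx => (hder x hx).deriv
  have hkey : α < 1 → ∀ x ∈ Ioo (0 : ℝ) 1,
      IntervalIntegrable (fun s => (x - s) ^ (-α) * deriv F s) volume 0 x ∧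
      ∫ s in (0 : ℝ)..x, (x - s) ^ (-α) * deriv F s
        = ∑' i, ∫ s in (0 : ℝ)..x, (x - s) ^ (-α) * d i s := by
    intro hα x hx
    obtain ⟨C, hC, hCb⟩ := hb x hx
    -- The product of the Caputo kernel and the weight `s^(α-1)` is a Beta integrand, hence an
    -- integrable dominating function; the integrals reach down to `0`, where the derivatives may
    -- blow up.
    have hker : IntervalIntegrable (fun s => (x - s) ^ (-α) * s ^ (α - 1)) volume 0 x := by
      have := intervalIntegrable_beta (a := 1 - α) (by linarith) hα0 hx.1
      rwa [show (1 - α) - 1 = -α by ring] at this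
    have hsub : ∀ s ∈ Ioc 0 x, s ∈ Ioo (0 : ℝ) 1 := fun s hs => ⟨hs.1, hs.2.trans_lt hx.2⟩
    have hbd : ∀ i, ∀ s ∈ Ioc 0 x, ‖(x - s) ^ (-α) * d i s‖
        ≤ γ i * (C * ((x - s) ^ (-α) * s ^ (α - 1))) := by
      intro i s hs
      have h0 : 0 ≤ (x - s) ^ (-α) := Real.rpow_nonneg (by linarith [hs.2]) _
      rw [norm_mul, Real.norm_of_nonneg h0]
      calc (x - s) ^ (-α) * ‖d i s‖ ≤ (x - s) ^ (-α) * (C * γ i * s ^ (α - 1)) := by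
            gcongr
            exact hCb i s hs
        _ = _ := by ring
    have hsum : HasSum (fun i => ∫ s in (0 : ℝ)..x, (x - s) ^ (-α) * d i s)
        (∫ s in (0 : ℝ)..x, (x - s) ^ (-α) * deriv F s) := by
      apply intervalIntegral.hasSum_integral_of_dominated_convergence
        (fun i s => γ i * (C * ((x - s) ^ (-α) * s ^ (α - 1))))
      · intro i
        rw [uIoc_of_le hx.1.le]
        have h1 : ContinuousOn (d i) (Ioc 0 x) := (hdc i).mono hsub
        have h2 : Measurable fun s : ℝ => (x - s) ^ (-α) := by fun_prop
        exact h2.aestronglyMeasurable.mul (h1.aestronglyMeasurable measurableSet_Ioc)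
      · intro i
        refine Eventually.of_forall fun s hs => ?_
        rw [uIoc_of_le hx.1.le] at hs
        exact hbd i s hs
      · exact Eventually.of_forall fun s _ => hγ.mul_right _
      · simp_rw [tsum_mul_right]
        exact (hker.const_mul C).const_mul _
      · refine Eventually.of_forall fun s hs => ?_
        rw [uIoc_of_le hx.1.le] at hs
        rw [hderiv s (hsub s hs)]
        apply HasSum.mul_left
        apply Summable.hasSum
        refine Summable.of_norm_bounded ((hγ.mul_left C).mul_right (s ^ (α - 1))) fun i => ?_
        exact hCb i s hs
    refine ⟨?_, hsum.tsum_eq.symm⟩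
    have hdom := (hker.const_mul C).const_mul (∑' i, γ i)
    rw [intervalIntegrable_iff_integrableOn_Ioc_of_le hx.1.le] at hdom ⊢
    refine Integrable.mono' hdom ?_ ?_
    · have h2 : Measurable fun s : ℝ => (x - s) ^ (-α) := by fun_prop
      exact (h2.mul (measurable_deriv F)).aestronglyMeasurable
    · filter_upwards [ae_restrict_mem measurableSet_Ioc] with s hs
      rw [hderiv s (hsub s hs), ← tsum_mul_left]
      have hs1 : Summable fun i => γ i * (C * ((x - s) ^ (-α) * s ^ (α - 1))) := hγ.mul_right _
      rw [← tsum_mul_right]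
      exact tsum_of_norm_bounded hs1.hasSum fun i => hbd i s hs
  refine ⟨fun x hx => ⟨(hder x hx).differentiableAt, fun hα => (hkey hα x hx).1⟩, fun x hx => ?_⟩
  simp_rw [← hn _ x hx]
  rw [caputoDeriv_eq_fracInt]
  rcases hα1.eq_or_lt with rfl | hα
  · simp_rw [sub_self, fracInt_zero]
    exact hderiv x hx
  · have hα' : 0 < 1 - α := by linarith
    simp_rw [fracInt_of_pos hα', show (1 - α) - 1 = -α by ring]
    rw [(hkey hα x hx).2, tsum_mul_left]

/-- Joint continuity of a series of products that converges locally uniformly in `x < 1`. -/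
lemma continuousOn_tsum_mul {ι : Type*} {n Z : ι → ℝ → ℝ} {γ : ι → ℝ}
    (hn : ∀ i, ContinuousOn (n i) (Ioo 0 1)) (hZ : ∀ i, Continuous (Z i))
    (hZ1 : ∀ i y, |Z i y| ≤ 1) (hγ : Summable γ)
    (hb : ∀ ρ ∈ Ioo (0 : ℝ) 1, ∃ C, 0 ≤ C ∧ ∀ i, ∀ x ∈ Ioc (0 : ℝ) ρ, |n i x| ≤ C * γ i) :
    ContinuousOn (fun p : ℝ × ℝ => ∑' i, n i p.1 * Z i p.2) Omega := by
  intro p hp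
  obtain ⟨hp1, hp2⟩ := hp
  obtain ⟨C, hC, hCb⟩ := hb ((p.1 + 1) / 2) ⟨by linarith [hp1.1], by linarith [hp1.2]⟩
  have hmem : ∀ y ∈ Ioo 0 ((p.1 + 1) / 2), y ∈ Ioo (0 : ℝ) 1 := fun y hy =>
    ⟨hy.1, by linarith [hy.2, hp1.2]⟩
  have h1 : ContinuousOn (fun p : ℝ × ℝ => ∑' i, n i p.1 * Z i p.2)
      (Ioo 0 ((p.1 + 1) / 2) ×ˢ univ) := by
    refine continuousOn_tsum (u := fun i => C * γ i) (fun i => ?_) (hγ.mul_left C) ?_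
    · refine ContinuousOn.mul ?_ ((hZ i).comp continuous_snd).continuousOn
      exact ((hn i).mono hmem).comp continuous_fst.continuousOn fun q hq => hq.1
    · intro i q hq
      rw [norm_mul]
      calc ‖n i q.1‖ * ‖Z i q.2‖ ≤ (C * γ i) * 1 := by
            gcongr
            · exact le_trans (abs_nonneg _) (hCb i q.1 ⟨hq.1.1, hq.1.2.le⟩)
            · exact hCb i q.1 ⟨hq.1.1, hq.1.2.le⟩
            · exact hZ1 i q.2
        _ = C * γ i := mul_one _
  have h2 : Ioo 0 ((p.1 + 1) / 2) ×ˢ (univ : Set ℝ) ∈ 𝓝 p :=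
    (isOpen_Ioo.prod isOpen_univ).mem_nhds ⟨⟨hp1.1, by linarith [hp1.2]⟩, mem_univ _⟩
  exact (h1.continuousAt h2).continuousWithinAt

end Series

/-! ### The one-dimensional boundary value problem and bounds uniform in `μ` -/

section Modes

open Filter Topology

lemma mlFun_one (α l x : ℝ) : mlFun α 1 l x = mittagLeffler α 1 (l * x ^ α) := by
  simp [mlFun]

/-- The coefficient of `x ^ α E_{2α, α+1}(μ² x ^ (2α))` in the solution with boundary
values `a` and `b`. -/
noncomputable def solCoeff (α μ a b : ℝ) : ℝ :=
  (b - a * mittagLeffler α 1 (-μ)) / mittagLeffler (2 * α) (α + 1) (μ ^ 2)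

/-- The solution of `D^α D^α f = μ² f` with `f 0 = a` and `f 1 = b`. -/
noncomputable def modeSol (α μ a b x : ℝ) : ℝ :=
  a * mlFun α 1 (-μ) x + solCoeff α μ a b * mlFun (2 * α) (α + 1) (μ ^ 2) x

/-- The derivative of `modeSol`. -/
noncomputable def modeSolDeriv (α μ a b x : ℝ) : ℝ :=
  a * -μ * mlFun α α (-μ) x + solCoeff α μ a b * mlFun (2 * α) α (μ ^ 2) x

/-- The Caputo derivative of `modeSol`. -/
noncomputable def modeSolCaputo (α μ a b x : ℝ) : ℝ :=
  a * -μ * mlFun α 1 (-μ) x + solCoeff α μ a b * mlFun (2 * α) 1 (μ ^ 2) x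

/-- The derivative of `modeSolCaputo`. -/
noncomputable def modeSolCaputoDeriv (α μ a b x : ℝ) : ℝ :=
  a * μ ^ 2 * mlFun α α (-μ) x + solCoeff α μ a b * μ ^ 2 * mlFun (2 * α) (2 * α) (μ ^ 2) x

variable {α : ℝ}

lemma hasDerivAt_modeSol (hα : 0 < α) (μ a b : ℝ) {x : ℝ} (hx : 0 < x) :
    HasDerivAt (modeSol α μ a b) (modeSolDeriv α μ a b x) x := by
  have h1 := (hasDerivAt_mlFun_one hα hx (-μ)).const_mul a
  have h2 := (hasDerivAt_mlFun (a := 2 * α) (by positivity) hα hx (μ ^ 2)).const_mul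
    (solCoeff α μ a b)
  refine (h1.add h2).congr_deriv ?_
  unfold modeSolDeriv
  ring

lemma hasDerivAt_modeSolCaputo (hα : 0 < α) (μ a b : ℝ) {x : ℝ} (hx : 0 < x) :
    HasDerivAt (modeSolCaputo α μ a b) (modeSolCaputoDeriv α μ a b x) x := by
  have h1 := (hasDerivAt_mlFun_one hα hx (-μ)).const_mul (a * -μ)
  have h2 := (hasDerivAt_mlFun_one (a := 2 * α) (by positivity) hx (μ ^ 2)).const_mul
    (solCoeff α μ a b)
  refine (h1.add h2).congr_deriv ?_
  unfold modeSolCaputoDeriv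
  ring

lemma fracInt_linear_mlFun {a₁ b₁ l₁ a₂ b₂ l₂ c x : ℝ} (ha₁ : 0 < a₁) (hb₁ : 0 < b₁)
    (ha₂ : 0 < a₂) (hb₂ : 0 < b₂) (hc : 0 ≤ c) (hx : 0 < x) (p q : ℝ) :
    fracInt c (fun s => p * mlFun a₁ b₁ l₁ s + q * mlFun a₂ b₂ l₂ s) x
      = p * mlFun a₁ (b₁ + c) l₁ x + q * mlFun a₂ (b₂ + c) l₂ x := by
  rw [← fracInt_mlFun ha₁ hb₁ hc hx, ← fracInt_mlFun ha₂ hb₂ hc hx]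
  rcases hc.eq_or_lt with rfl | hc
  · simp_rw [fracInt_zero]
  · simp_rw [fracInt_of_pos hc]
    have e : ∀ s, (x - s) ^ (c - 1) * (p * mlFun a₁ b₁ l₁ s + q * mlFun a₂ b₂ l₂ s)
        = p * ((x - s) ^ (c - 1) * mlFun a₁ b₁ l₁ s)
          + q * ((x - s) ^ (c - 1) * mlFun a₂ b₂ l₂ s) := fun s => by ring
    simp_rw [e]
    rw [intervalIntegral.integral_add ((intervalIntegrable_mul_mlFun ha₁ hb₁ hc hx l₁).const_mul _)
      ((intervalIntegrable_mul_mlFun ha₂ hb₂ hc hx l₂).const_mul _),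
      intervalIntegral.integral_const_mul, intervalIntegral.integral_const_mul]
    ring

lemma fracInt_modeSolDeriv (hα0 : 0 < α) (hα1 : α ≤ 1) (μ a b : ℝ) {x : ℝ} (hx : 0 < x) :
    fracInt (1 - α) (modeSolDeriv α μ a b) x = modeSolCaputo α μ a b x := by
  have := fracInt_linear_mlFun (a₁ := α) (a₂ := 2 * α) (l₁ := -μ) (l₂ := μ ^ 2) (c := 1 - α)
    hα0 hα0 (by positivity) hα0 (by linarith) hx (a * -μ) (solCoeff α μ a b)
  rw [add_sub_cancel] at this
  exact this

/-- Raising the second parameters by `1 - α` gives `α + (1-α) = 1` and `2α + (1-α) = α + 1`, which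
are those of `modeSol`: the function reproduces itself with the factor `μ²`. -/
lemma fracInt_modeSolCaputoDeriv (hα0 : 0 < α) (hα1 : α ≤ 1) (μ a b : ℝ) {x : ℝ} (hx : 0 < x) :
    fracInt (1 - α) (modeSolCaputoDeriv α μ a b) x = μ ^ 2 * modeSol α μ a b x := by
  have := fracInt_linear_mlFun (a₁ := α) (a₂ := 2 * α) (b₂ := 2 * α) (l₁ := -μ) (l₂ := μ ^ 2)
    (c := 1 - α) hα0 hα0 (by positivity) (by positivity) (by linarith) hx (a * μ ^ 2)
    (solCoeff α μ a b * μ ^ 2)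
  rw [add_sub_cancel, show 2 * α + (1 - α) = α + 1 by ring] at this
  refine Eq.trans this ?_
  unfold modeSol
  ring

lemma continuousOn_mode_aux (hα : 0 < α) {b₁ b₂ l₁ l₂ : ℝ} (hb₁ : 0 < b₁) (hb₂ : 0 < b₂)
    (p q : ℝ) :
    ContinuousOn (fun x => p * mlFun α b₁ l₁ x + q * mlFun (2 * α) b₂ l₂ x) (Ioo 0 1) := by
  have h1 := (mlFun_continuousOn hα hb₁ l₁).mono (Ioo_subset_Ioi_self : Ioo (0 : ℝ) 1 ⊆ Ioi 0)
  have h2 := (mlFun_continuousOn (a := 2 * α) (by positivity) hb₂ l₂).mono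
    (Ioo_subset_Ioi_self : Ioo (0 : ℝ) 1 ⊆ Ioi 0)
  exact (continuousOn_const.mul h1).add (continuousOn_const.mul h2)

lemma continuousOn_modeSolDeriv (hα : 0 < α) (μ a b : ℝ) :
    ContinuousOn (modeSolDeriv α μ a b) (Ioo 0 1) :=
  continuousOn_mode_aux hα hα hα _ _

lemma continuousOn_modeSolCaputo (hα : 0 < α) (μ a b : ℝ) :
    ContinuousOn (modeSolCaputo α μ a b) (Ioo 0 1) :=
  continuousOn_mode_aux hα one_pos one_pos _ _

lemma continuousOn_modeSolCaputoDeriv (hα : 0 < α) (μ a b : ℝ) :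
    ContinuousOn (modeSolCaputoDeriv α μ a b) (Ioo 0 1) :=
  continuousOn_mode_aux hα hα (by positivity) _ _

lemma continuous_modeSol (hα : 0 < α) (μ a b : ℝ) : Continuous (modeSol α μ a b) := by
  unfold modeSol mlFun
  have h1 := continuous_mittagLeffler_rpow hα one_pos (-μ)
  have h2 := continuous_mittagLeffler_rpow (a := 2 * α) (b := α + 1) (by positivity)
    (by positivity) (μ ^ 2)
  have h3 : Continuous fun x : ℝ => x ^ (α + 1 - 1) :=
    Real.continuous_rpow_const (by linarith)
  have h4 : Continuous fun x : ℝ => x ^ ((1 : ℝ) - 1) :=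
    Real.continuous_rpow_const (by norm_num)
  fun_prop

lemma modeSol_zero (hα : 0 < α) (μ a b : ℝ) : modeSol α μ a b 0 = a := by
  unfold modeSol
  rw [mlFun_one, Real.zero_rpow hα.ne', mul_zero, mittagLeffler_zero]
  simp [mlFun, Real.zero_rpow hα.ne']

lemma modeSol_one (hα : 0 < α) (μ a b : ℝ) : modeSol α μ a b 1 = b := by
  have hN := mittagLeffler_pos (a := 2 * α) (b := α + 1) (z := μ ^ 2) (by positivity)
    (by positivity) (by positivity)
  unfold modeSol solCoeff
  rw [mlFun_one]
  simp only [mlFun, Real.one_rpow, mul_one, one_mul]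
  field_simp
  ring

lemma modeSol_eq_fracS (α μ a b x : ℝ) :
    modeSol α μ a b x = a * (mittagLeffler α 1 (-μ * x ^ α)
      - mittagLeffler α 1 (-μ) * fracS α μ x) + b * fracS α μ x := by
  unfold modeSol solCoeff fracS
  rw [mlFun_one]
  simp only [mlFun, add_sub_cancel_right]
  ring

lemma fracS_mem (hα : 0 < α) (μ : ℝ) {x : ℝ} (hx : x ∈ Icc (0 : ℝ) 1) :
    fracS α μ x ∈ Icc (0 : ℝ) 1 := by
  have hN := mittagLeffler_pos (a := 2 * α) (b := α + 1) (z := μ ^ 2) (by positivity)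
    (by positivity) (by positivity)
  have hx2 : x ^ (2 * α) ≤ 1 := Real.rpow_le_one hx.1 hx.2 (by positivity)
  have hx1 : x ^ α ≤ 1 := Real.rpow_le_one hx.1 hx.2 hα.le
  have hx20 : 0 ≤ x ^ (2 * α) := Real.rpow_nonneg hx.1 _
  have hx10 : 0 ≤ x ^ α := Real.rpow_nonneg hx.1 _
  have h0 : 0 < mittagLeffler (2 * α) (α + 1) (μ ^ 2 * x ^ (2 * α)) :=
    mittagLeffler_pos (by positivity) (by positivity) (by positivity)
  have h1 : mittagLeffler (2 * α) (α + 1) (μ ^ 2 * x ^ (2 * α))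
      ≤ mittagLeffler (2 * α) (α + 1) (μ ^ 2) :=
    mittagLeffler_mono (by positivity) (by positivity) (by positivity)
      (mul_le_of_le_one_right (sq_nonneg _) hx2)
  unfold fracS
  constructor
  · positivity
  · rw [div_le_one hN]
    exact (mul_le_of_le_one_left h0.le hx1).trans h1

/-- The odd-part identity, at `μ` and at `μ x^α`, eliminates `E_{α,1}` at positive arguments. What
remains involves no difference of exponentially large terms and still makes sense at `μ = 0`. -/
lemma fracC_eq (hα : 0 < α) {μ : ℝ} (hμ : 0 < μ) {x : ℝ} (hx : 0 ≤ x) :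
    fracC α μ x = mittagLeffler α 1 (-μ * x ^ α) - mittagLeffler α 1 (-μ) * fracS α μ x := by
  have hN := mittagLeffler_pos (a := 2 * α) (b := α + 1) (z := μ ^ 2) (by positivity)
    (by positivity) (by positivity)
  have h1 := mittagLeffler_sub_neg hα μ
  have h2 := mittagLeffler_sub_neg hα (μ * x ^ α)
  have h3 : (μ * x ^ α) ^ 2 = μ ^ 2 * x ^ (2 * α) := by
    rw [mul_pow, mul_comm 2 α, Real.rpow_mul hx, Real.rpow_two]
  rw [h3] at h2
  unfold fracC fracS
  rw [neg_mul]
  set A := mittagLeffler (2 * α) (α + 1) (μ ^ 2)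
  set B := mittagLeffler (2 * α) (α + 1) (μ ^ 2 * x ^ (2 * α))
  field_simp
  have h1' : mittagLeffler α 1 μ = mittagLeffler α 1 (-μ) + 2 * μ * A := by linarith
  have h2' : mittagLeffler α 1 (μ * x ^ α) = mittagLeffler α 1 (-(μ * x ^ α))
    + 2 * (μ * x ^ α) * B := by linarith
  rw [h1', h2']
  ring

lemma modeSol_eq (hα : 0 < α) {μ : ℝ} (hμ : 0 < μ) {x : ℝ} (hx : 0 ≤ x) (a b : ℝ) :
    modeSol α μ a b x = a * fracC α μ x + b * fracS α μ x := by
  rw [modeSol_eq_fracS, fracC_eq hα hμ hx]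

/-- The factor of `a` is a difference of two numbers in `[0,1]`, and the factor of `b` lies in
`[0,1]`. No summability beyond that of the coefficients is therefore needed up to `x = 0` and `x =
1`. -/
lemma abs_modeSol_le (hα0 : 0 < α) (hα1 : α ≤ 1) {μ : ℝ} (hμ : 0 ≤ μ) (a b : ℝ) {x : ℝ}
    (hx : x ∈ Icc (0 : ℝ) 1) : |modeSol α μ a b x| ≤ |a| + |b| := by
  have hS := fracS_mem hα0 μ hx
  have hE := mittagLeffler_one_neg_mem hα0 hα1 hμ
  have hE' := mittagLeffler_one_neg_mem hα0 hα1
    (mul_nonneg hμ (Real.rpow_nonneg hx.1 α))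
  rw [modeSol_eq_fracS, neg_mul]
  refine (abs_add_le _ _).trans ?_
  rw [abs_mul, abs_mul]
  have h1 : |mittagLeffler α 1 (-(μ * x ^ α)) - mittagLeffler α 1 (-μ) * fracS α μ x| ≤ 1 := by
    rw [abs_le]
    constructor <;> nlinarith [hS.1, hS.2, hE.1, hE.2, hE'.1, hE'.2, mul_nonneg hE.1 hS.1]
  have h2 : |fracS α μ x| ≤ 1 := by
    rw [abs_of_nonneg hS.1]
    exact hS.2
  exact add_le_add (mul_le_of_le_one_right (abs_nonneg _) h1)
    (mul_le_of_le_one_right (abs_nonneg _) h2)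

lemma abs_mlFun_self_neg_le (hα0 : 0 < α) (hα1 : α ≤ 1) {μ : ℝ} (hμ : 0 ≤ μ) {x : ℝ}
    (hx : 0 < x) : |mlFun α α (-μ) x| ≤ (Real.Gamma α)⁻¹ * x ^ (α - 1) := by
  have h0 : 0 ≤ μ * x ^ α := mul_nonneg hμ (Real.rpow_nonneg hx.le _)
  have h1 := mittagLeffler_self_neg_pos hα0 hα1 h0
  have h2 := mittagLeffler_self_neg_le hα0 hα1 h0
  unfold mlFun
  rw [neg_mul, abs_mul, abs_of_pos h1, abs_of_pos (Real.rpow_pos_of_pos hx _), mul_comm]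
  gcongr

lemma abs_mlFun_one_neg_le (hα0 : 0 < α) (hα1 : α ≤ 1) {μ : ℝ} (hμ : 0 ≤ μ) {x : ℝ}
    (hx : 0 < x) : |mlFun α 1 (-μ) x| ≤ 1 := by
  have h1 := mittagLeffler_one_neg_mem hα0 hα1 (mul_nonneg hμ (Real.rpow_nonneg hx.le α))
  rw [mlFun_one, neg_mul, abs_of_nonneg h1.1]
  exact h1.2

/-- For `x ≤ ρ` the argument is at most `ρ^(2α) μ²`, a fixed fraction of the argument in the
denominator, so the Mittag-Leffler comparison yields the gain `1 + μ²`. It fails as `ρ → 1`. -/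
lemma abs_solCoeff_mul_le (hα0 : 0 < α) (hα1 : α ≤ 1) {ρ b' : ℝ} (hρ : ρ ∈ Ioo (0 : ℝ) 1)
    (hb : 0 < b') (hb' : b' ≤ α + 1) :
    ∃ C, 0 ≤ C ∧ ∀ μ a b, 0 ≤ μ → ∀ x ∈ Ioc 0 ρ,
      (1 + μ ^ 2) * |solCoeff α μ a b * mlFun (2 * α) b' (μ ^ 2) x|
        ≤ C * (|a| + |b|) * x ^ (b' - 1) := by
  have h2α : 0 < 2 * α := by positivity
  obtain ⟨C, hC, h⟩ := exists_mittagLeffler_le (a := 2 * α) (d := α + 1) (q := ρ ^ (2 * α)) h2α hb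
    hb' (Real.rpow_nonneg hρ.1.le _) (Real.rpow_lt_one hρ.1.le hρ.2 h2α)
  refine ⟨C, hC, fun μ a b hμ x hx => ?_⟩
  have hx0 := hx.1
  have hN := mittagLeffler_pos (a := 2 * α) (b := α + 1) (z := μ ^ 2) (by positivity)
    (by positivity) (by positivity)
  have hE := mittagLeffler_one_neg_mem hα0 hα1 hμ
  have hz0 : 0 ≤ μ ^ 2 * x ^ (2 * α) := by positivity
  have hzρ : μ ^ 2 * x ^ (2 * α) ≤ ρ ^ (2 * α) * μ ^ 2 := by
    rw [mul_comm]
    have := hx.2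
    gcongr
  have h1 := h (μ ^ 2) (μ ^ 2 * x ^ (2 * α)) (by positivity) hz0 hzρ
  have hM := mittagLeffler_pos (a := 2 * α) (b := b') h2α hb hz0
  have h3 : |b - a * mittagLeffler α 1 (-μ)| ≤ |a| + |b| := by
    refine (abs_sub _ _).trans ?_
    rw [abs_mul, abs_of_nonneg hE.1, add_comm]
    gcongr
    exact mul_le_of_le_one_right (abs_nonneg _) hE.2
  unfold solCoeff mlFun
  rw [abs_mul, abs_mul, abs_div, abs_of_pos hN, abs_of_pos hM,
    abs_of_pos (Real.rpow_pos_of_pos hx0 _)]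
  set N := mittagLeffler (2 * α) (α + 1) (μ ^ 2)
  set M := mittagLeffler (2 * α) b' (μ ^ 2 * x ^ (2 * α))
  have hx' : 0 < x ^ (b' - 1) := Real.rpow_pos_of_pos hx0 _
  calc (1 + μ ^ 2) * (|b - a * mittagLeffler α 1 (-μ)| / N * (x ^ (b' - 1) * M))
      = |b - a * mittagLeffler α 1 (-μ)| / N * x ^ (b' - 1) * ((1 + μ ^ 2) * M) := by ring
    _ ≤ (|a| + |b|) / N * x ^ (b' - 1) * (C * N) := by gcongr
    _ = _ := by field_simp

/-- Bounds for the modes away from `x = 1`. -/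
lemma exists_mode_bound (hα0 : 0 < α) (hα1 : α ≤ 1) {ρ : ℝ} (hρ : ρ ∈ Ioo (0 : ℝ) 1) :
    ∃ C, 0 ≤ C ∧ ∀ μ a b, 0 ≤ μ → ∀ x ∈ Ioc 0 ρ,
      |modeSolDeriv α μ a b x| ≤ C * ((1 + μ ^ 2) * |a| + |b|) * x ^ (α - 1) ∧
      |modeSolCaputo α μ a b x| ≤ C * ((1 + μ ^ 2) * |a| + |b|) ∧
      |modeSolCaputoDeriv α μ a b x| ≤ C * ((1 + μ ^ 2) * |a| + |b|) * x ^ (α - 1) ∧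
      (1 + μ ^ 2) * |modeSol α μ a b x| ≤ C * ((1 + μ ^ 2) * |a| + |b|) := by
  obtain ⟨C₁, hC₁, h₁⟩ := abs_solCoeff_mul_le hα0 hα1 hρ hα0 (by linarith)
  obtain ⟨C₂, hC₂, h₂⟩ := abs_solCoeff_mul_le hα0 hα1 hρ one_pos (by linarith)
  obtain ⟨C₃, hC₃, h₃⟩ := abs_solCoeff_mul_le hα0 hα1 hρ (b' := 2 * α) (by positivity)
    (by linarith)
  obtain ⟨C₄, hC₄, h₄⟩ := abs_solCoeff_mul_le hα0 hα1 hρ (b' := α + 1) (by positivity) le_rfl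
  have hG := Real.Gamma_pos_of_pos hα0
  have hG' := inv_pos.2 hG
  obtain ⟨K, hK0, k₁, k₂, k₃, k₄⟩ : ∃ K, 0 ≤ K ∧ (Real.Gamma α)⁻¹ + C₁ ≤ K ∧ 1 + C₂ ≤ K ∧
      (Real.Gamma α)⁻¹ + C₃ ≤ K ∧ 1 + C₄ ≤ K := by
    refine ⟨(Real.Gamma α)⁻¹ + 1 + C₁ + C₂ + C₃ + C₄, by positivity, ?_, ?_, ?_, ?_⟩ <;> linarith
  refine ⟨K, hK0, fun μ a b hμ x hx => ?_⟩
  have hx0 := hx.1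
  have hx1 : x ≤ 1 := hx.2.trans hρ.2.le
  have ha := abs_nonneg a
  have hb := abs_nonneg b
  have hX : 0 < x ^ (α - 1) := Real.rpow_pos_of_pos hx0 _
  have e1 := abs_mlFun_self_neg_le hα0 hα1 hμ hx0
  have e2 := abs_mlFun_one_neg_le hα0 hα1 hμ hx0
  have hμ2 : μ ≤ 1 + μ ^ 2 := by nlinarith [sq_nonneg (μ - 1)]
  have hm1 : 1 ≤ 1 + μ ^ 2 := by nlinarith
  have hab : |a| + |b| ≤ (1 + μ ^ 2) * |a| + |b| := by nlinarith
  set γ := (1 + μ ^ 2) * |a| + |b| with hγ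
  have hγ0 : 0 ≤ γ := by positivity
  have haγ : (1 + μ ^ 2) * |a| ≤ γ := by linarith
  have weak : ∀ t : ℝ, |t| ≤ (1 + μ ^ 2) * |t| := fun t => by nlinarith [abs_nonneg t]
  refine ⟨?_, ?_, ?_, ?_⟩
  · have s2 := (weak _).trans (h₁ μ a b hμ x hx)
    have s1 : |a * -μ * mlFun α α (-μ) x| ≤ (Real.Gamma α)⁻¹ * γ * x ^ (α - 1) := by
      rw [abs_mul, abs_mul, abs_neg, abs_of_nonneg hμ]
      calc |a| * μ * |mlFun α α (-μ) x| ≤ γ * ((Real.Gamma α)⁻¹ * x ^ (α - 1)) := by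
            gcongr
            nlinarith
        _ = _ := by ring
    calc _ ≤ _ := abs_add_le _ _
      _ ≤ (Real.Gamma α)⁻¹ * γ * x ^ (α - 1) + C₁ * γ * x ^ (α - 1) :=
          add_le_add s1 (s2.trans (by gcongr))
      _ = ((Real.Gamma α)⁻¹ + C₁) * γ * x ^ (α - 1) := by ring
      _ ≤ _ := by gcongr
  · have s2 := (weak _).trans (h₂ μ a b hμ x hx)
    rw [sub_self, Real.rpow_zero, mul_one] at s2
    have s1 : |a * -μ * mlFun α 1 (-μ) x| ≤ γ := by
      rw [abs_mul, abs_mul, abs_neg, abs_of_nonneg hμ]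
      calc |a| * μ * |mlFun α 1 (-μ) x| ≤ γ * 1 := by
            gcongr
            nlinarith
        _ = _ := by ring
    calc _ ≤ _ := abs_add_le _ _
      _ ≤ γ + C₂ * γ := add_le_add s1 (s2.trans (by gcongr))
      _ = (1 + C₂) * γ := by ring
      _ ≤ _ := by gcongr
  · have s2 := h₃ μ a b hμ x hx
    have hXX : x ^ (2 * α - 1) ≤ x ^ (α - 1) :=
      Real.rpow_le_rpow_of_exponent_ge hx0 hx1 (by linarith)
    have s3 : |solCoeff α μ a b * μ ^ 2 * mlFun (2 * α) (2 * α) (μ ^ 2) x|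
        ≤ C₃ * γ * x ^ (α - 1) := by
      rw [mul_right_comm, abs_mul _ (μ ^ 2), abs_of_nonneg (sq_nonneg μ), mul_comm]
      calc _ ≤ (1 + μ ^ 2) * |solCoeff α μ a b * mlFun (2 * α) (2 * α) (μ ^ 2) x| := by
            gcongr
            linarith
        _ ≤ _ := s2
        _ ≤ _ := by gcongr
    have s1 : |a * μ ^ 2 * mlFun α α (-μ) x| ≤ (Real.Gamma α)⁻¹ * γ * x ^ (α - 1) := by
      rw [abs_mul, abs_mul, abs_of_nonneg (sq_nonneg μ)]
      calc |a| * μ ^ 2 * |mlFun α α (-μ) x| ≤ γ * ((Real.Gamma α)⁻¹ * x ^ (α - 1)) := by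
            gcongr
            nlinarith
        _ = _ := by ring
    calc _ ≤ _ := abs_add_le _ _
      _ ≤ (Real.Gamma α)⁻¹ * γ * x ^ (α - 1) + C₃ * γ * x ^ (α - 1) := add_le_add s1 s3
      _ = ((Real.Gamma α)⁻¹ + C₃) * γ * x ^ (α - 1) := by ring
      _ ≤ _ := by gcongr
  · have s2 := h₄ μ a b hμ x hx
    have hXX : x ^ (α + 1 - 1) ≤ 1 := Real.rpow_le_one hx0.le hx1 (by linarith)
    have s1 : (1 + μ ^ 2) * |a * mlFun α 1 (-μ) x| ≤ γ := by
      rw [abs_mul]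
      calc (1 + μ ^ 2) * (|a| * |mlFun α 1 (-μ) x|) ≤ (1 + μ ^ 2) * (|a| * 1) := by gcongr
        _ ≤ _ := by linarith
    calc _ ≤ (1 + μ ^ 2) * (|a * mlFun α 1 (-μ) x|
          + |solCoeff α μ a b * mlFun (2 * α) (α + 1) (μ ^ 2) x|) := by
          gcongr
          exact abs_add_le _ _
      _ ≤ γ + C₄ * γ := by
          rw [mul_add]
          refine add_le_add s1 (s2.trans ?_)
          calc C₄ * (|a| + |b|) * x ^ (α + 1 - 1) ≤ C₄ * (|a| + |b|) * 1 := by gcongr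
            _ ≤ C₄ * γ := by rw [mul_one]; gcongr
      _ = (1 + C₄) * γ := by ring
      _ ≤ _ := by gcongr

end Modes

/-! ### The Fourier series solves Problem N -/

section Existence

open Filter Topology

/-- The factor `1 ± ε` of the eigenvalues. -/
noncomputable def modeKappa (ε : ℝ) : ℕ ⊕ ℕ → ℝ
  | Sum.inl _ => 1 + ε
  | Sum.inr _ => 1 - ε

/-- The parameter `μ` of a mode. -/
noncomputable def modeMu (ε c : ℝ) (i : ℕ ⊕ ℕ) : ℝ :=
  √(modeKappa ε i * modeFreq i ^ 2 + c ^ 2)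

/-- The part depending on `x` of a mode. -/
noncomputable def modeX (α ε c : ℝ) (φ ψ : ℝ → ℝ) (i : ℕ ⊕ ℕ) (x : ℝ) : ℝ :=
  modeSol α (modeMu ε c i) (modeCoeff φ i) (modeCoeff ψ i) x

/-- The Fourier series of the solution. -/
noncomputable def fourierSol (α ε c : ℝ) (φ ψ : ℝ → ℝ) (x y : ℝ) : ℝ :=
  ∑' i, modeX α ε c φ ψ i x * modeFun i y

lemma modeKappa_pos {ε : ℝ} (hε : |ε| < 1) (i : ℕ ⊕ ℕ) : 0 < modeKappa ε i := by
  rw [abs_lt] at hε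
  rcases i with k | k <;> simp only [modeKappa] <;> linarith [hε.1, hε.2]

lemma modeMu_nonneg (ε c : ℝ) (i : ℕ ⊕ ℕ) : 0 ≤ modeMu ε c i := Real.sqrt_nonneg _

lemma modeMu_sq {ε : ℝ} (hε : |ε| < 1) (c : ℝ) (i : ℕ ⊕ ℕ) :
    modeMu ε c i ^ 2 = modeKappa ε i * modeFreq i ^ 2 + c ^ 2 := by
  have := modeKappa_pos hε i
  exact Real.sq_sqrt (by positivity)

lemma modeMu_pos {ε : ℝ} (hε : |ε| < 1) (c : ℝ) {i : ℕ ⊕ ℕ} (hi : i ≠ Sum.inr 0) :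
    0 < modeMu ε c i := by
  have := modeKappa_pos hε i
  have h2 := half_le_modeFreq hi
  apply Real.sqrt_pos.2
  have : 0 < modeFreq i := by linarith
  positivity

lemma one_add_modeMu_sq_le {ε : ℝ} (hε : |ε| < 1) (c : ℝ) (i : ℕ ⊕ ℕ) :
    1 + modeMu ε c i ^ 2 ≤ (2 + c ^ 2) * (1 + modeFreq i ^ 2) := by
  rw [modeMu_sq hε]
  have h2 : modeKappa ε i ≤ 2 := by
    rw [abs_lt] at hε
    rcases i with k | k <;> simp only [modeKappa] <;> linarith [hε.1, hε.2]
  nlinarith [sq_nonneg (modeFreq i), sq_nonneg c, mul_nonneg (sq_nonneg c) (sq_nonneg (modeFreq i))]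

variable {α ε c : ℝ} {φ ψ : ℝ → ℝ}

lemma summable_abs_of_weight {w a : ℕ ⊕ ℕ → ℝ} (hw : ∀ i, 1 ≤ w i)
    (h : Summable fun i => w i * |a i|) : Summable fun i => |a i| :=
  h.of_nonneg_of_le (fun _ => abs_nonneg _) fun i => le_mul_of_one_le_left (abs_nonneg _) (hw i)

lemma summable_mode_weight (hε : |ε| < 1)
    (hφs : Summable fun i => (1 + modeFreq i ^ 2) * |modeCoeff φ i|)
    (hψs : Summable fun i => (1 + modeFreq i) * |modeCoeff ψ i|) :
    Summable fun i => (1 + modeMu ε c i ^ 2) * |modeCoeff φ i| + |modeCoeff ψ i| := by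
  refine Summable.add ?_ (summable_abs_of_weight (fun i => by linarith [modeFreq_nonneg i]) hψs)
  refine (hφs.mul_left (2 + c ^ 2)).of_nonneg_of_le (fun i => by positivity) fun i => ?_
  rw [← mul_assoc]
  gcongr
  exact one_add_modeMu_sq_le hε c i

/-- The weight needed for `u_y` on the closed rectangle, where the modes are bounded only by `|φ_i|
+ |ψ_i|`. -/
lemma summable_freq_weight
    (hφs : Summable fun i => (1 + modeFreq i ^ 2) * |modeCoeff φ i|)
    (hψs : Summable fun i => (1 + modeFreq i) * |modeCoeff ψ i|) :
    Summable fun i => (1 + modeFreq i) * (|modeCoeff φ i| + |modeCoeff ψ i|) := by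
  refine ((hφs.mul_left 2).add hψs).of_nonneg_of_le
    (fun i => mul_nonneg (by linarith [modeFreq_nonneg i]) (by positivity)) fun i => ?_
  rw [mul_add, ← mul_assoc]
  gcongr
  nlinarith [sq_nonneg (modeFreq i - 1), sq_nonneg (modeFreq i)]

lemma hasDerivAt_series {s : ℕ ⊕ ℕ → ℝ} (hs : Summable fun i => (1 + modeFreq i) * |s i|) (y : ℝ) :
    HasDerivAt (fun y => ∑' i, s i * modeFun i y) (∑' i, s i * (modeFreq i * modeConj i y)) y := by
  have hω := modeFreq_nonneg
  refine hasDerivAt_tsum (u := fun i => (1 + modeFreq i) * |s i|) hs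
    (fun i z => (hasDerivAt_modeFun i z).const_mul (s i)) (fun i z => ?_) (y₀ := 0) ?_ y
  · rw [norm_mul, norm_mul, Real.norm_of_nonneg (hω i), mul_comm]
    have := abs_modeConj_le i z
    simp only [Real.norm_eq_abs]
    gcongr
    calc modeFreq i * |modeConj i z| ≤ modeFreq i * 1 :=
          mul_le_mul_of_nonneg_left this (hω i)
      _ ≤ 1 + modeFreq i := by linarith
  · refine Summable.of_norm_bounded (summable_abs_of_weight (fun i => by linarith [hω i]) hs)
      fun i => ?_
    rw [norm_mul]
    exact mul_le_of_le_one_right (norm_nonneg _) (abs_modeFun_le i 0)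

lemma hasDerivAt_series_conj {s : ℕ ⊕ ℕ → ℝ} (hs : Summable fun i => (1 + modeFreq i ^ 2) * |s i|)
    (y : ℝ) :
    HasDerivAt (fun y => ∑' i, s i * (modeFreq i * modeConj i y))
      (∑' i, s i * (modeFreq i * -(modeFreq i * modeFun i y))) y := by
  have hω := modeFreq_nonneg
  refine hasDerivAt_tsum (u := fun i => (1 + modeFreq i ^ 2) * |s i|) hs
    (fun i z => ((hasDerivAt_modeConj i z).const_mul (modeFreq i)).const_mul (s i))
    (fun i z => ?_) (y₀ := 0) ?_ y
  · rw [norm_mul, norm_mul, norm_neg, norm_mul, Real.norm_of_nonneg (hω i), mul_comm]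
    have := abs_modeFun_le i z
    simp only [Real.norm_eq_abs]
    gcongr
    calc modeFreq i * (modeFreq i * |modeFun i z|) ≤ modeFreq i * (modeFreq i * 1) :=
          mul_le_mul_of_nonneg_left (mul_le_mul_of_nonneg_left this (hω i)) (hω i)
      _ ≤ 1 + modeFreq i ^ 2 := by nlinarith
  · refine Summable.of_norm_bounded hs fun i => ?_
    rw [norm_mul, norm_mul, Real.norm_of_nonneg (hω i), mul_comm]
    have := abs_modeConj_le i 0
    simp only [Real.norm_eq_abs]
    gcongr
    calc modeFreq i * |modeConj i 0| ≤ modeFreq i * 1 :=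
          mul_le_mul_of_nonneg_left this (hω i)
      _ ≤ 1 + modeFreq i ^ 2 := by nlinarith [sq_nonneg (modeFreq i - 1)]

lemma abs_modeX_le (hα0 : 0 < α) (hα1 : α ≤ 1) (i : ℕ ⊕ ℕ) {x : ℝ} (hx : x ∈ Icc (0 : ℝ) 1) :
    |modeX α ε c φ ψ i x| ≤ |modeCoeff φ i| + |modeCoeff ψ i| :=
  abs_modeSol_le hα0 hα1 (modeMu_nonneg _ _ _) _ _ hx

/-- Reflection acts on the eigenfunctions by `±1`, so it only changes `ω²` to `(1 ± ε)ω²`, which is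
what `μ² - c²` was defined to be. -/
lemma modeFun_neg_eq (hε : |ε| < 1) (c : ℝ) (i : ℕ ⊕ ℕ) (y : ℝ) :
    modeMu ε c i ^ 2 * modeFun i y - modeFreq i ^ 2 * modeFun i y
      + ε * (modeFreq i ^ 2 * modeFun i (-y)) - c ^ 2 * modeFun i y = 0 := by
  rw [modeMu_sq hε]
  rcases i with k | k
  · simp only [modeFun, modeKappa, mul_neg, Real.sin_neg]
    ring
  · simp only [modeFun, modeKappa, mul_neg, Real.cos_neg]
    ring

/-- For `x ≤ ρ < 1` both Caputo derivatives and `u_yy` are dominated by the summable weights `(1 +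
μ_i²)|φ_i| + |ψ_i|`, up to powers of `x`. The data `ψ` carry no weight because their modes decay in
`μ` away from `x = 1`. -/
theorem isRegularSolution_fourierSol (hα0 : 0 < α) (hα1 : α ≤ 1) (hε : |ε| < 1)
    (hφs : Summable fun i => (1 + modeFreq i ^ 2) * |modeCoeff φ i|)
    (hψs : Summable fun i => (1 + modeFreq i) * |modeCoeff ψ i|) :
    IsRegularSolution α ε c (fourierSol α ε c φ ψ) := by
  set a := modeCoeff φ with ha
  set b := modeCoeff ψ with hb
  set μ := modeMu ε c with hμ
  set γ : ℕ ⊕ ℕ → ℝ := fun i => (1 + μ i ^ 2) * |a i| + |b i| with hγ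
  have hγs : Summable γ := summable_mode_weight hε hφs hψs
  have hγ0 : ∀ i, 0 ≤ γ i := fun i => by positivity
  have hμ0 : ∀ i, 0 ≤ μ i := fun i => modeMu_nonneg _ _ _
  have hω := modeFreq_nonneg
  set sol : ℕ ⊕ ℕ → ℝ → ℝ := fun i => modeSol α (μ i) (a i) (b i) with hsol
  have hu : ∀ x y, fourierSol α ε c φ ψ x y = ∑' i, sol i x * modeFun i y := fun x y => rfl
  have habs : Summable fun i => |a i| + |b i| :=
    (summable_abs_of_weight (fun i => by nlinarith [sq_nonneg (modeFreq i)]) hφs).add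
      (summable_abs_of_weight (fun i => by linarith [hω i]) hψs)
  have hsolb : ∀ i, ∀ x ∈ Icc (0 : ℝ) 1, |sol i x| ≤ |a i| + |b i| := fun i x hx =>
    abs_modeSol_le hα0 hα1 (hμ0 i) _ _ hx
  have hsolω : ∀ x ∈ Icc (0 : ℝ) 1, Summable fun i => (1 + modeFreq i) * |sol i x| := by
    intro x hx
    refine (summable_freq_weight hφs hψs).of_nonneg_of_le
      (fun i => mul_nonneg (by linarith [hω i]) (abs_nonneg _)) fun i => ?_
    exact mul_le_mul_of_nonneg_left (hsolb i x hx) (by linarith [hω i])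
  -- comparison of frequencies
  obtain ⟨κ, hκ0, hκ⟩ : ∃ κ : ℝ, 0 < κ ∧ ∀ i, 1 + modeFreq i ^ 2 ≤ κ * (1 + μ i ^ 2) := by
    have hε' : 0 < 1 - |ε| := by linarith
    refine ⟨1 + (1 - |ε|)⁻¹, by positivity, fun i => ?_⟩
    have h1 : 1 - |ε| ≤ modeKappa ε i := by
      rcases i with k | k <;> simp only [modeKappa] <;> linarith [neg_abs_le ε, le_abs_self ε]
    have h2 : (1 - |ε|) * modeFreq i ^ 2 ≤ μ i ^ 2 := by
      rw [hμ, modeMu_sq hε]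
      nlinarith [sq_nonneg (modeFreq i), sq_nonneg c]
    have h3 : modeFreq i ^ 2 ≤ (1 - |ε|)⁻¹ * μ i ^ 2 := by
      rw [inv_mul_eq_div, le_div_iff₀ hε']
      linarith
    have h4 : 0 < (1 - |ε|)⁻¹ := inv_pos.2 hε'
    nlinarith [sq_nonneg (μ i)]
  have hmode : ∀ ρ ∈ Ioo (0 : ℝ) 1, ∃ C, 0 ≤ C ∧ ∀ i, ∀ x ∈ Ioc 0 ρ,
      |modeSolDeriv α (μ i) (a i) (b i) x| ≤ C * γ i * x ^ (α - 1) ∧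
      |modeSolCaputo α (μ i) (a i) (b i) x| ≤ C * γ i ∧
      |modeSolCaputoDeriv α (μ i) (a i) (b i) x| ≤ C * γ i * x ^ (α - 1) ∧
      (1 + μ i ^ 2) * |sol i x| ≤ C * γ i := by
    intro ρ hρ
    obtain ⟨C, hC, h⟩ := exists_mode_bound hα0 hα1 hρ
    exact ⟨C, hC, fun i x hx => h (μ i) (a i) (b i) (hμ0 i) x hx⟩
  have hsolω2 : ∀ ρ ∈ Ioo (0 : ℝ) 1, ∃ C, 0 ≤ C ∧ ∀ i, ∀ x ∈ Ioc 0 ρ,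
      (1 + modeFreq i ^ 2) * |sol i x| ≤ C * γ i := by
    intro ρ hρ
    obtain ⟨C, hC, h⟩ := hmode ρ hρ
    refine ⟨κ * C, by positivity, fun i x hx => ?_⟩
    calc (1 + modeFreq i ^ 2) * |sol i x| ≤ κ * (1 + μ i ^ 2) * |sol i x| :=
          mul_le_mul_of_nonneg_right (hκ i) (abs_nonneg _)
      _ = κ * ((1 + μ i ^ 2) * |sol i x|) := by ring
      _ ≤ κ * (C * γ i) := by exact mul_le_mul_of_nonneg_left (h i x hx).2.2.2 hκ0.le
      _ = _ := by ring
  have hsolω2s : ∀ x ∈ Ioo (0 : ℝ) 1, Summable fun i => (1 + modeFreq i ^ 2) * |sol i x| := by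
    intro x hx
    obtain ⟨C, hC, h⟩ := hsolω2 x hx
    exact (hγs.mul_left C).of_nonneg_of_le (fun i => by positivity)
      fun i => h i x ⟨hx.1, le_rfl⟩
  have hXb : ∀ (t : ℝ) i y, |t * modeFun i y| ≤ |t| := fun t i y => by
    rw [abs_mul]
    exact mul_le_of_le_one_right (abs_nonneg _) (abs_modeFun_le i y)
  have hfrac : ∀ (d : ℕ ⊕ ℕ → ℝ → ℝ) i y x, fracInt (1 - α) (fun s => d i s * modeFun i y) x
      = fracInt (1 - α) (d i) x * modeFun i y := by
    intro d i y x
    unfold fracInt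
    split_ifs with h
    · rfl
    · simp_rw [← mul_assoc]
      rw [intervalIntegral.integral_mul_const, mul_assoc]
  have hdx : ∀ y, CaputoDifferentiable α (fun x => fourierSol α ε c φ ψ x y) ∧
      ∀ x ∈ Ioo (0 : ℝ) 1, caputoDeriv α (fun x => fourierSol α ε c φ ψ x y) x
        = ∑' i, modeSolCaputo α (μ i) (a i) (b i) x * modeFun i y := by
    intro y
    refine caputoDeriv_tsum hα0 hα1 (f := fun i x => sol i x * modeFun i y)
      (d := fun i x => modeSolDeriv α (μ i) (a i) (b i) x * modeFun i y) (γ := γ)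
      (fun x _ => hu x y) ?_ ?_ ?_ ?_ hγs ?_
    · intro x hx
      refine Summable.of_norm_bounded habs fun i => ?_
      exact (hXb _ i y).trans (hsolb i x (Ioo_subset_Icc_self hx))
    · intro i x hx
      exact (hasDerivAt_modeSol hα0 _ _ _ hx.1).mul_const _
    · intro i
      exact (continuousOn_modeSolDeriv hα0 _ _ _).mul continuousOn_const
    · intro i x hx
      rw [hfrac (fun i => modeSolDeriv α (μ i) (a i) (b i)), fracInt_modeSolDeriv hα0 hα1 _ _ _ hx.1]
    · intro ρ hρ
      obtain ⟨C, hC, h⟩ := hmode ρ hρ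
      exact ⟨C, hC, fun i x hx => (hXb _ i y).trans (h i x hx).1⟩
  have hdx' : ∀ x ∈ Ioo (0 : ℝ) 1, ∀ y, dx α (fourierSol α ε c φ ψ) x y
      = ∑' i, modeSolCaputo α (μ i) (a i) (b i) x * modeFun i y := fun x hx y => (hdx y).2 x hx
  have hdxdx : ∀ y, CaputoDifferentiable α (fun x => dx α (fourierSol α ε c φ ψ) x y) ∧
      ∀ x ∈ Ioo (0 : ℝ) 1, caputoDeriv α (fun x => dx α (fourierSol α ε c φ ψ) x y) x
        = ∑' i, μ i ^ 2 * sol i x * modeFun i y := by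
    intro y
    refine caputoDeriv_tsum hα0 hα1
      (f := fun i x => modeSolCaputo α (μ i) (a i) (b i) x * modeFun i y)
      (d := fun i x => modeSolCaputoDeriv α (μ i) (a i) (b i) x * modeFun i y) (γ := γ)
      (fun x hx => hdx' x hx y) ?_ ?_ ?_ ?_ hγs ?_
    · intro x hx
      obtain ⟨C, hC, h⟩ := hmode x hx
      refine Summable.of_norm_bounded (hγs.mul_left C) fun i => ?_
      exact (hXb _ i y).trans (h i x ⟨hx.1, le_rfl⟩).2.1
    · intro i x hx
      exact (hasDerivAt_modeSolCaputo hα0 _ _ _ hx.1).mul_const _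
    · intro i
      exact (continuousOn_modeSolCaputoDeriv hα0 _ _ _).mul continuousOn_const
    · intro i x hx
      rw [hfrac (fun i => modeSolCaputoDeriv α (μ i) (a i) (b i)),
        fracInt_modeSolCaputoDeriv hα0 hα1 _ _ _ hx.1]
    · intro ρ hρ
      obtain ⟨C, hC, h⟩ := hmode ρ hρ
      exact ⟨C, hC, fun i x hx => (hXb _ i y).trans (h i x hx).2.2.1⟩
  have hdxdx' : ∀ x ∈ Ioo (0 : ℝ) 1, ∀ y, dx α (dx α (fourierSol α ε c φ ψ)) x y
      = ∑' i, μ i ^ 2 * sol i x * modeFun i y := fun x hx y => (hdxdx y).2 x hx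
  have hderiv : ∀ x ∈ Icc (0 : ℝ) 1, ∀ y, HasDerivAt (fourierSol α ε c φ ψ x)
      (∑' i, sol i x * (modeFreq i * modeConj i y)) y :=
    fun x hx y => hasDerivAt_series (hsolω x hx) y
  have hderiv_eq : ∀ x ∈ Icc (0 : ℝ) 1, deriv (fourierSol α ε c φ ψ x)
      = fun y => ∑' i, sol i x * (modeFreq i * modeConj i y) :=
    fun x hx => funext fun y => (hderiv x hx y).deriv
  have hderiv2 : ∀ x ∈ Ioo (0 : ℝ) 1, ∀ y, HasDerivAt (deriv (fourierSol α ε c φ ψ x))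
      (∑' i, -(modeFreq i ^ 2 * sol i x) * modeFun i y) y := by
    intro x hx y
    rw [hderiv_eq x (Ioo_subset_Icc_self hx)]
    refine (hasDerivAt_series_conj (hsolω2s x hx) y).congr_deriv (tsum_congr fun i => ?_)
    ring
  have huyy : ∀ x ∈ Ioo (0 : ℝ) 1, ∀ y, uyy (fourierSol α ε c φ ψ) x y
      = ∑' i, -(modeFreq i ^ 2 * sol i x) * modeFun i y := fun x hx y => (hderiv2 x hx y).deriv
  have hsolc : ∀ i, Continuous (sol i) := fun i => continuous_modeSol hα0 _ _ _
  have hμb : ∀ ρ ∈ Ioo (0 : ℝ) 1, ∃ C, 0 ≤ C ∧ ∀ i, ∀ x ∈ Ioc 0 ρ,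
      |μ i ^ 2 * sol i x| ≤ C * γ i := by
    intro ρ hρ
    obtain ⟨C, hC, h⟩ := hmode ρ hρ
    refine ⟨C, hC, fun i x hx => le_trans ?_ (h i x hx).2.2.2⟩
    rw [abs_mul, abs_of_nonneg (sq_nonneg _)]
    gcongr
    linarith
  have hωb : ∀ ρ ∈ Ioo (0 : ℝ) 1, ∃ C, 0 ≤ C ∧ ∀ i, ∀ x ∈ Ioc 0 ρ,
      |(-(modeFreq i ^ 2 * sol i x))| ≤ C * γ i := by
    intro ρ hρ
    obtain ⟨C, hC, h⟩ := hsolω2 ρ hρ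
    refine ⟨C, hC, fun i x hx => le_trans ?_ (h i x hx)⟩
    rw [abs_neg, abs_mul, abs_of_nonneg (sq_nonneg _)]
    gcongr
    linarith
  refine ⟨?_, fun y _ => (hdx y).1, ?_, fun y _ => (hdxdx y).1, ?_, ?_, ?_, ?_, ?_⟩
  · refine continuousOn_tsum (u := fun i => |a i| + |b i|) (fun i => ?_) habs ?_
    · exact (((hsolc i).comp continuous_fst).mul
        ((continuous_modeFun i).comp continuous_snd)).continuousOn
    · intro i p hp
      exact (hXb _ i p.2).trans (hsolb i p.1 hp.1)
  · refine (continuousOn_tsum_mul (fun i => continuousOn_modeSolCaputo hα0 _ _ _)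
      continuous_modeFun abs_modeFun_le hγs ?_).congr fun p hp => hdx' p.1 hp.1 p.2
    intro ρ hρ
    obtain ⟨C, hC, h⟩ := hmode ρ hρ
    exact ⟨C, hC, fun i x hx => (h i x hx).2.1⟩
  · exact (continuousOn_tsum_mul (fun i => (continuous_const.mul (hsolc i)).continuousOn)
      continuous_modeFun abs_modeFun_le hγs hμb).congr fun p hp => hdxdx' p.1 hp.1 p.2
  · exact fun p hp => (hderiv p.1 (Ioo_subset_Icc_self hp.1) p.2).differentiableAt
  · exact fun p hp => (hderiv2 p.1 hp.1 p.2).differentiableAt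
  · exact (continuousOn_tsum_mul (fun i => ((continuous_const.mul (hsolc i)).neg).continuousOn)
      continuous_modeFun abs_modeFun_le hγs hωb).congr fun p hp => huyy p.1 hp.1 p.2
  · intro x hx y hy
    rw [hdxdx' x hx, huyy x hx, huyy x hx, hu]
    obtain ⟨C₁, hC₁, h₁⟩ := hμb x hx
    obtain ⟨C₂, hC₂, h₂⟩ := hωb x hx
    have hxm : x ∈ Ioc 0 x := ⟨hx.1, le_rfl⟩
    have s1 : Summable fun i => μ i ^ 2 * sol i x * modeFun i y :=
      Summable.of_norm_bounded (hγs.mul_left C₁) fun i => (hXb _ i y).trans (h₁ i x hxm)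
    have s2 : ∀ y, Summable fun i => -(modeFreq i ^ 2 * sol i x) * modeFun i y := fun y =>
      Summable.of_norm_bounded (hγs.mul_left C₂) fun i => (hXb _ i y).trans (h₂ i x hxm)
    have s3 : Summable fun i => sol i x * modeFun i y :=
      Summable.of_norm_bounded habs fun i =>
        (hXb _ i y).trans (hsolb i x (Ioo_subset_Icc_self hx))
    rw [← tsum_mul_left, ← tsum_mul_left, ← s1.tsum_add (s2 y),
      ← (s1.add (s2 y)).tsum_sub ((s2 (-y)).mul_left ε),
      ← ((s1.add (s2 y)).sub ((s2 (-y)).mul_left ε)).tsum_sub (s3.mul_left (c ^ 2))]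
    refine (tsum_congr fun i => ?_).trans tsum_zero
    linear_combination sol i x * modeFun_neg_eq hε c i y

theorem isSolutionN_fourierSol (hα0 : 0 < α) (hα1 : α ≤ 1) (hε : |ε| < 1)
    (hφ : ContinuousOn φ (Icc (-π) π)) (hψ : ContinuousOn ψ (Icc (-π) π))
    (hφs : Summable fun i => (1 + modeFreq i ^ 2) * |modeCoeff φ i|)
    (hψs : Summable fun i => (1 + modeFreq i) * |modeCoeff ψ i|) :
    IsSolutionN α ε c φ ψ (fourierSol α ε c φ ψ) := by
  have hω := modeFreq_nonneg
  have hw := summable_freq_weight hφs hψs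
  have hφa : Summable fun i => |modeCoeff φ i| :=
    summable_abs_of_weight (fun i => by nlinarith [sq_nonneg (modeFreq i)]) hφs
  have hψa : Summable fun i => |modeCoeff ψ i| :=
    summable_abs_of_weight (fun i => by linarith [hω i]) hψs
  have hderiv : ∀ x ∈ Icc (0 : ℝ) 1, ∀ y, HasDerivAt (fourierSol α ε c φ ψ x)
      (∑' i, modeX α ε c φ ψ i x * (modeFreq i * modeConj i y)) y := by
    intro x hx y
    refine hasDerivAt_series (hw.of_nonneg_of_le
      (fun i => mul_nonneg (by linarith [hω i]) (abs_nonneg _)) fun i => ?_) y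
    exact mul_le_mul_of_nonneg_left (abs_modeX_le hα0 hα1 i hx) (by linarith [hω i])
  have hbar : ∀ x ∈ Icc (0 : ℝ) 1, ∀ y ∈ Icc (-π) π, uyBar (fourierSol α ε c φ ψ) x y
      = ∑' i, modeX α ε c φ ψ i x * (modeFreq i * modeConj i y) := fun x hx y hy =>
    (hderiv x hx y).hasDerivWithinAt.derivWithin (uniqueDiffOn_Icc neg_pi_lt_pi y hy)
  refine ⟨isRegularSolution_fourierSol hα0 hα1 hε hφs hψs, ?_, ?_, ?_, ?_, ?_, ?_⟩
  · exact fun p hp => (hderiv p.1 hp.1 p.2).differentiableAt.differentiableWithinAt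
  · refine ContinuousOn.congr ?_ fun p hp => hbar p.1 hp.1 p.2 hp.2
    refine continuousOn_tsum
      (u := fun i => (1 + modeFreq i) * (|modeCoeff φ i| + |modeCoeff ψ i|)) (fun i => ?_) hw ?_
    · exact (((continuous_modeSol hα0 _ _ _).comp continuous_fst).mul
        (continuous_const.mul ((continuous_modeConj i).comp continuous_snd))).continuousOn
    · intro i p hp
      rw [norm_mul, norm_mul, Real.norm_of_nonneg (hω i), mul_comm]
      have h1 : modeFreq i * ‖modeConj i p.2‖ ≤ 1 + modeFreq i := by
        calc modeFreq i * ‖modeConj i p.2‖ ≤ modeFreq i * 1 :=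
              mul_le_mul_of_nonneg_left (abs_modeConj_le i p.2) (hω i)
          _ ≤ 1 + modeFreq i := by linarith
      exact mul_le_mul h1 (abs_modeX_le hα0 hα1 i hp.1) (norm_nonneg _) (by linarith [hω i])
  · intro y hy
    rw [← tsum_modeCoeff_mul_modeFun hφ hφa y hy]
    unfold fourierSol modeX
    simp_rw [modeSol_zero hα0]
  · intro y hy
    rw [← tsum_modeCoeff_mul_modeFun hψ hψa y hy]
    unfold fourierSol modeX
    simp_rw [modeSol_one hα0]
  · intro x hx
    rw [hbar x hx _ ⟨le_rfl, neg_pi_le_pi⟩]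
    simp_rw [modeConj_neg_pi]
    simp
  · intro x hx
    rw [hbar x hx _ ⟨neg_pi_le_pi, le_rfl⟩]
    simp_rw [modeConj_pi]
    simp

lemma modeX_inl (hα0 : 0 < α) (hε : |ε| < 1) {x : ℝ} (hx : 0 ≤ x) (y : ℝ) (k : ℕ) :
    modeX α ε c φ ψ (Sum.inl k) x * modeFun (Sum.inl k) y = sinTerm α ε c φ ψ x y k := by
  unfold modeX
  rw [modeSol_eq hα0 (modeMu_pos hε c (by simp)) hx]
  rfl

lemma modeX_inr_succ (hα0 : 0 < α) (hε : |ε| < 1) {x : ℝ} (hx : 0 ≤ x) (y : ℝ) (k : ℕ) :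
    modeX α ε c φ ψ (Sum.inr (k + 1)) x * modeFun (Sum.inr (k + 1)) y
      = cosTerm α ε c φ ψ x y (k + 1) := by
  unfold modeX
  rw [modeSol_eq hα0 (modeMu_pos hε c (by simp)) hx]
  rfl

/-- For `c = 0` one has `μ = 0`, where `C_μ` is not available. There `E_{α,1}` equals `1` and
`S_0(x) = x^α`, so `modeSol` itself is the affine interpolation in `x^α`. -/
lemma modeX_inr_zero (hα0 : 0 < α) {x : ℝ} (hx : 0 ≤ x) (y : ℝ) :
    modeX α ε c φ ψ (Sum.inr 0) x * modeFun (Sum.inr 0) y = zeroMode α c φ ψ x := by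
  have hμ : modeMu ε c (Sum.inr 0) = |c| := by
    simp [modeMu, modeFreq, Real.sqrt_sq_eq_abs]
  have hX : modeFun (Sum.inr 0) y = 1 := by simp [modeFun]
  unfold modeX zeroMode
  rw [hμ, hX, mul_one]
  simp only [modeCoeff]
  split_ifs with hc
  · subst hc
    have hG : 0 < Real.Gamma (α + 1) := Real.Gamma_pos_of_pos (by linarith)
    rw [modeSol_eq_fracS]
    simp only [fracS, abs_zero, neg_zero, zero_mul, mittagLeffler_zero, Real.Gamma_one, inv_one,
      ne_eq, OfNat.ofNat_ne_zero, not_false_eq_true, zero_pow]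
    field_simp
  · exact modeSol_eq hα0 (abs_pos.2 hc) hx _ _

theorem fourierSol_eq (hα0 : 0 < α) (hα1 : α ≤ 1) (hε : |ε| < 1)
    (hφs : Summable fun i => (1 + modeFreq i ^ 2) * |modeCoeff φ i|)
    (hψs : Summable fun i => (1 + modeFreq i) * |modeCoeff ψ i|)
    {x : ℝ} (hx : x ∈ Icc (0 : ℝ) 1) (y : ℝ) :
    Summable (fun k : ℕ => sinTerm α ε c φ ψ x y k) ∧
    Summable (fun k : ℕ => cosTerm α ε c φ ψ x y (k + 1)) ∧
    fourierSol α ε c φ ψ x y = zeroMode α c φ ψ x + ∑' k : ℕ, sinTerm α ε c φ ψ x y k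
      + ∑' k : ℕ, cosTerm α ε c φ ψ x y (k + 1) := by
  have hω := modeFreq_nonneg
  have hs : Summable fun i => modeX α ε c φ ψ i x * modeFun i y := by
    refine Summable.of_norm_bounded (summable_abs_of_weight (w := fun i => 1 + modeFreq i)
      (a := fun i => |modeCoeff φ i| + |modeCoeff ψ i|) (fun i => by linarith [hω i]) ?_) fun i => ?_
    · refine (summable_freq_weight hφs hψs).congr fun i => ?_
      rw [abs_of_nonneg (by positivity : 0 ≤ |modeCoeff φ i| + |modeCoeff ψ i|)]
    · rw [norm_mul]
      refine (mul_le_of_le_one_right (norm_nonneg _) (abs_modeFun_le i y)).trans ?_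
      exact (abs_modeX_le hα0 hα1 i hx).trans (le_abs_self _)
  have h1 := hs.comp_injective (Sum.inl_injective (α := ℕ) (β := ℕ))
  have h2 := hs.comp_injective (Sum.inr_injective (α := ℕ) (β := ℕ))
  have e1 : (fun i => modeX α ε c φ ψ i x * modeFun i y) ∘ Sum.inl
      = fun k => sinTerm α ε c φ ψ x y k := funext fun k => modeX_inl hα0 hε hx.1 y k
  have e2 : (fun k => modeX α ε c φ ψ (Sum.inr (k + 1)) x * modeFun (Sum.inr (k + 1)) y)
      = fun k => cosTerm α ε c φ ψ x y (k + 1) := funext fun k => modeX_inr_succ hα0 hε hx.1 y k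
  have h3 := (summable_nat_add_iff 1).2 h2
  refine ⟨e1 ▸ h1, e2 ▸ h3, ?_⟩
  unfold fourierSol
  rw [h1.tsum_sum h2, ← e1, ← e2]
  have h4 := h2.tsum_eq_zero_add
  simp only [Function.comp_def] at h4 ⊢
  rw [h4, modeX_inr_zero hα0 hx.1]
  ring

end Existence

/-! ### Fractional integrals with parameters and fractional Volterra equations -/

section FractionalIntegralContinuous

open Filter Topology

lemma intervalIntegrable_mul_continuous {a x : ℝ} (ha : 0 < a) {f : ℝ → ℝ} (hf : Continuous f) :
    IntervalIntegrable (fun s => (x - s) ^ (a - 1) * f s) volume 0 x :=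
  (intervalIntegrable_sub_rpow ha x 0 x).mul_continuousOn hf.continuousOn

lemma fracInt_linear {a x : ℝ} (ha : 0 ≤ a) {f g : ℝ → ℝ} (hf : Continuous f) (hg : Continuous g)
    (p q : ℝ) :
    fracInt a (fun s => p * f s + q * g s) x = p * fracInt a f x + q * fracInt a g x := by
  rcases ha.eq_or_lt with rfl | ha
  · simp_rw [fracInt_zero]
  · simp_rw [fracInt_of_pos ha]
    have e : ∀ s, (x - s) ^ (a - 1) * (p * f s + q * g s)
        = p * ((x - s) ^ (a - 1) * f s) + q * ((x - s) ^ (a - 1) * g s) := fun s => by ring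
    simp_rw [e]
    rw [intervalIntegral.integral_add ((intervalIntegrable_mul_continuous ha hf).const_mul _)
      ((intervalIntegrable_mul_continuous ha hg).const_mul _),
      intervalIntegral.integral_const_mul, intervalIntegral.integral_const_mul]
    ring

lemma fracInt_const_mul {a x : ℝ} (p : ℝ) (f : ℝ → ℝ) :
    fracInt a (fun s => p * f s) x = p * fracInt a f x := by
  unfold fracInt
  split_ifs with h
  · rfl
  · simp_rw [mul_left_comm _ p]
    rw [intervalIntegral.integral_const_mul]
    ring

lemma abs_fracInt_le_of_rpow {a b x M : ℝ} (ha : 0 ≤ a) (hb : 0 < b) (hx : 0 < x) {f : ℝ → ℝ}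
    (hM : ∀ s ∈ Ioc 0 x, |f s| ≤ M * s ^ (b - 1)) :
    |fracInt a f x| ≤ M * (Real.Gamma b / Real.Gamma (b + a) * x ^ (b + a - 1)) := by
  rw [← fracInt_rpow ha hb hx]
  rcases ha.eq_or_lt with rfl | ha
  · simp_rw [fracInt_zero]
    exact hM x ⟨hx, le_rfl⟩
  · have hG := Real.Gamma_pos_of_pos ha
    rw [fracInt_of_pos ha, fracInt_of_pos ha, abs_mul, abs_of_pos (inv_pos.2 hG), mul_left_comm,
      ← intervalIntegral.integral_const_mul]
    refine mul_le_mul_of_nonneg_left ?_ (inv_pos.2 hG).le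
    rw [← Real.norm_eq_abs]
    refine intervalIntegral.norm_integral_le_of_norm_le hx.le ?_
      ((intervalIntegrable_beta ha hb hx).const_mul M)
    refine Eventually.of_forall fun s hs => ?_
    have h0 : 0 ≤ (x - s) ^ (a - 1) := Real.rpow_nonneg (by linarith [hs.2]) _
    rw [norm_mul, Real.norm_of_nonneg h0]
    calc (x - s) ^ (a - 1) * ‖f s‖ ≤ (x - s) ^ (a - 1) * (M * s ^ (b - 1)) := by
          gcongr
          exact hM s hs
      _ = _ := by ring

lemma abs_fracInt_le {a x M : ℝ} (ha : 0 ≤ a) (hx : 0 < x) {f : ℝ → ℝ}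
    (hM : ∀ s ∈ Ioc 0 x, |f s| ≤ M) :
    |fracInt a f x| ≤ M * x ^ a / Real.Gamma (a + 1) := by
  have := abs_fracInt_le_of_rpow (b := 1) ha one_pos hx (M := M) (f := f) (by simpa using hM)
  simp only [Real.Gamma_one, add_sub_cancel_left] at this
  rw [add_comm 1 a] at this
  refine this.trans (le_of_eq ?_)
  ring

/-- Scaling to `[0,1]` moves the dependence on `x` into a prefactor and the argument of `f`; the
singular kernel is then fixed and dominated convergence gives continuity, also at `x = 0`. -/
lemma fracInt_eq_scaled {a x : ℝ} (ha : 0 < a) (hx : 0 ≤ x) (f : ℝ → ℝ) :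
    fracInt a f x
      = x ^ a * ((Real.Gamma a)⁻¹ * ∫ t in (0 : ℝ)..1, (1 - t) ^ (a - 1) * f (x * t)) := by
  rcases hx.eq_or_lt with rfl | hx
  · rw [fracInt_of_pos ha, Real.zero_rpow ha.ne']
    simp
  · have h := intervalIntegral.mul_integral_comp_mul_left (a := 0) (b := 1) (c := x)
      (f := fun s => (x - s) ^ (a - 1) * f s)
    rw [mul_zero, mul_one] at h
    rw [fracInt_of_pos ha, ← h]
    have e : ∫ t in (0 : ℝ)..1, (x - x * t) ^ (a - 1) * f (x * t)
        = x ^ (a - 1) * ∫ t in (0 : ℝ)..1, (1 - t) ^ (a - 1) * f (x * t) := by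
      rw [← intervalIntegral.integral_const_mul]
      apply intervalIntegral.integral_congr
      intro t ht
      rw [uIcc_of_le zero_le_one] at ht
      simp only
      rw [show x - x * t = x * (1 - t) by ring, Real.mul_rpow hx.le (by linarith [ht.2])]
      ring
    rw [e]
    have : x ^ a = x * x ^ (a - 1) := by
      rw [mul_comm, ← Real.rpow_add_one hx.ne', sub_add_cancel]
    rw [this]
    ring

/-- The fractional integral in the first variable, extended by a constant to `x < 0`. -/
noncomputable def fracInt₂ (a : ℝ) (F : ℝ → ℝ → ℝ) (x y : ℝ) : ℝ :=
  fracInt a (fun s => F s y) (max x 0)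

lemma fracInt₂_of_nonneg {x : ℝ} (hx : 0 ≤ x) (a : ℝ) (F : ℝ → ℝ → ℝ) (y : ℝ) :
    fracInt₂ a F x y = fracInt a (fun s => F s y) x := by
  rw [fracInt₂, max_eq_left hx]

lemma continuous_fracInt₂ {a : ℝ} (ha : 0 ≤ a) {F : ℝ → ℝ → ℝ}
    (hF : Continuous (Function.uncurry F)) : Continuous (Function.uncurry (fracInt₂ a F)) := by
  rcases ha.eq_or_lt with rfl | ha
  · have : Function.uncurry (fracInt₂ 0 F)
        = fun p : ℝ × ℝ => Function.uncurry F (max p.1 0, p.2) := by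
      ext p
      simp [fracInt₂, Function.uncurry, fracInt_zero]
    rw [this]
    fun_prop
  · have : Function.uncurry (fracInt₂ a F) = fun p : ℝ × ℝ => (max p.1 0) ^ a * ((Real.Gamma a)⁻¹ *
        ∫ t in (0 : ℝ)..1, (1 - t) ^ (a - 1) * Function.uncurry F (max p.1 0 * t, p.2)) := by
      ext p
      simp only [fracInt₂, Function.uncurry]
      rw [fracInt_eq_scaled ha (le_max_right _ _)]
    rw [this]
    have h1 : Continuous fun p : ℝ × ℝ => (max p.1 0) ^ a :=
      (Real.continuous_rpow_const ha.le).comp (by fun_prop)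
    refine h1.mul (continuous_const.mul ?_)
    rw [continuous_iff_continuousAt]
    intro p₀
    have hH : Continuous fun q : (ℝ × ℝ) × ℝ => Function.uncurry F (max q.1.1 0 * q.2, q.1.2) := by
      fun_prop
    obtain ⟨M, hM⟩ := ((isCompact_closedBall p₀ 1).prod
      (isCompact_Icc (a := (0 : ℝ)) (b := 1))).exists_bound_of_continuousOn hH.continuousOn
    refine intervalIntegral.continuousAt_of_dominated_interval
      (bound := fun t => (1 - t) ^ (a - 1) * M) ?_ ?_ ?_ ?_
    · refine Eventually.of_forall fun p => ?_
      have h2 : Measurable fun t : ℝ => (1 - t) ^ (a - 1) := by fun_prop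
      have h3 : Continuous fun t : ℝ => Function.uncurry F (max p.1 0 * t, p.2) := by fun_prop
      exact (h2.aestronglyMeasurable.mul h3.aestronglyMeasurable)
    · filter_upwards [Metric.closedBall_mem_nhds p₀ one_pos] with p hp
      refine Eventually.of_forall fun t ht => ?_
      rw [uIoc_of_le zero_le_one] at ht
      have h0 : 0 ≤ (1 - t) ^ (a - 1) := Real.rpow_nonneg (by linarith [ht.2]) _
      rw [norm_mul, Real.norm_of_nonneg h0]
      gcongr
      exact hM (p, t) ⟨hp, ht.1.le, ht.2⟩
    · exact (intervalIntegrable_sub_rpow ha 1 0 1).mul_const M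
    · refine Eventually.of_forall fun t _ => ?_
      exact (continuous_const.mul (by fun_prop :
        Continuous fun p : ℝ × ℝ => Function.uncurry F (max p.1 0 * t, p.2))).continuousAt

lemma continuous_fracInt_max {a : ℝ} (ha : 0 ≤ a) {f : ℝ → ℝ} (hf : Continuous f) :
    Continuous fun x => fracInt a f (max x 0) := by
  have h := continuous_fracInt₂ ha (F := fun s _ => f s) (hf.comp continuous_fst)
  exact h.comp (continuous_id.prodMk continuous_const : Continuous fun x : ℝ => (x, (0 : ℝ)))

/-- Fractional integrals commute with integrals in the second variable. -/
lemma fracInt_integral {a x : ℝ} (ha : 0 ≤ a) (hx : 0 < x) {F : ℝ → ℝ → ℝ}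
    (hF : Continuous (Function.uncurry F)) (c d : ℝ) :
    fracInt a (fun s => ∫ y in c..d, F s y) x = ∫ y in c..d, fracInt a (fun s => F s y) x := by
  rcases ha.eq_or_lt with rfl | ha
  · simp_rw [fracInt_zero]
  · simp_rw [fracInt_of_pos ha]
    rw [intervalIntegral.integral_const_mul]
    congr 1
    simp_rw [← intervalIntegral.integral_const_mul]
    apply intervalIntegral_intervalIntegral_swap
    obtain ⟨M, hM⟩ := ((isCompact_uIcc (a := (0 : ℝ)) (b := x)).prod
      (isCompact_uIcc (a := c) (b := d))).exists_bound_of_continuousOn hF.continuousOn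
    have hk : IntegrableOn (fun s => (x - s) ^ (a - 1)) (uIoc 0 x) :=
      intervalIntegrable_iff.1 (intervalIntegrable_sub_rpow ha x 0 x)
    rw [IntegrableOn, Measure.volume_eq_prod, ← Measure.prod_restrict]
    have hfin : IsFiniteMeasure (volume.restrict (uIoc c d)) := by
      rw [uIoc]
      infer_instance
    have h1 : Integrable (fun p : ℝ × ℝ => (x - p.1) ^ (a - 1) * M)
        ((volume.restrict (uIoc 0 x)).prod (volume.restrict (uIoc c d))) :=
      (Integrable.comp_fst hk _).mul_const M
    refine Integrable.mono' h1 ?_ ?_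
    · have h2 : Measurable fun p : ℝ × ℝ => (x - p.1) ^ (a - 1) := by fun_prop
      exact h2.aestronglyMeasurable.mul hF.aestronglyMeasurable
    · rw [Measure.prod_restrict]
      filter_upwards [ae_restrict_mem (measurableSet_uIoc.prod measurableSet_uIoc)] with p hp
      have hp1 : p.1 ∈ Ioc 0 x := by
        have := hp.1
        rwa [uIoc_of_le hx.le] at this
      have h0 : 0 ≤ (x - p.1) ^ (a - 1) := Real.rpow_nonneg (by linarith [hp1.2]) _
      simp only [Function.uncurry]
      rw [norm_mul, Real.norm_of_nonneg h0]
      gcongr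
      exact hM p ⟨uIoc_subset_uIcc hp.1, uIoc_subset_uIcc hp.2⟩

lemma fracInt₂_integral {a x : ℝ} (ha : 0 ≤ a) (hx : 0 < x) {F : ℝ → ℝ → ℝ}
    (hF : Continuous (Function.uncurry F)) (c d : ℝ) :
    fracInt a (fun s => ∫ y in c..d, F s y) x = ∫ y in c..d, fracInt₂ a F x y := by
  rw [fracInt_integral ha hx hF]
  simp_rw [fracInt₂_of_nonneg hx.le]

/-- Iterated fractional integrals commute with integrals in the second variable. -/
lemma fracInt_fracInt_integral {a b x : ℝ} (ha : 0 ≤ a) (hb : 0 ≤ b) (hx : 0 < x)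
    {F : ℝ → ℝ → ℝ} (hF : Continuous (Function.uncurry F)) (c d : ℝ) :
    fracInt a (fracInt b (fun s => ∫ y in c..d, F s y)) x
      = ∫ y in c..d, fracInt₂ a (fracInt₂ b F) x y := by
  rw [← fracInt₂_integral ha hx (continuous_fracInt₂ hb hF)]
  exact fracInt_congr ha hx fun s hs => fracInt₂_integral hb hs.1 hF c d

lemma fracInt₂_mul_right (a : ℝ) (F : ℝ → ℝ → ℝ) (X : ℝ → ℝ) (x y : ℝ) :
    fracInt₂ a (fun s y => F s y * X y) x y = fracInt₂ a F x y * X y := by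
  unfold fracInt₂
  simp_rw [mul_comm _ (X y)]
  exact fracInt_const_mul _ _

lemma abs_fracInt₂_le {a x M : ℝ} (ha : 0 ≤ a) (hx : 0 < x) {F : ℝ → ℝ → ℝ} {y : ℝ}
    (hM : ∀ s ∈ Ioc 0 x, |F s y| ≤ M) :
    |fracInt₂ a F x y| ≤ M * x ^ a / Real.Gamma (a + 1) := by
  rw [fracInt₂_of_nonneg hx.le]
  exact abs_fracInt_le ha hx hM

lemma continuous_left {F : ℝ → ℝ → ℝ} (hF : Continuous (Function.uncurry F)) (y : ℝ) :
    Continuous fun s => F s y :=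
  hF.comp (by fun_prop : Continuous fun s : ℝ => (s, y))

lemma continuous_right {F : ℝ → ℝ → ℝ} (hF : Continuous (Function.uncurry F)) (x : ℝ) :
    Continuous fun y => F x y :=
  hF.comp (by fun_prop : Continuous fun y : ℝ => (x, y))

lemma abs_fracInt₂_sub_le {a x M : ℝ} (ha : 0 ≤ a) (hx : 0 < x) {F : ℝ → ℝ → ℝ}
    (hF : Continuous (Function.uncurry F)) {y y' : ℝ}
    (hM : ∀ s ∈ Ioc 0 x, |F s y - F s y'| ≤ M) :
    |fracInt₂ a F x y - fracInt₂ a F x y'| ≤ M * x ^ a / Real.Gamma (a + 1) := by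
  rw [fracInt₂_of_nonneg hx.le, fracInt₂_of_nonneg hx.le]
  have h := fracInt_linear (x := x) ha (continuous_left hF y) (continuous_left hF y') 1 (-1)
  have e : fracInt a (fun s => F s y) x - fracInt a (fun s => F s y') x
      = fracInt a (fun s => F s y - F s y') x := by
    have e2 : (fun s => F s y - F s y') = fun s => 1 * F s y + -1 * F s y' := by
      ext s
      ring
    rw [e2, h]
    ring
  rw [e]
  exact abs_fracInt_le ha hx hM

lemma abs_fracInt₂_fracInt₂_le {a x M : ℝ} (ha : 0 ≤ a) (hx : 0 < x) (hM0 : 0 ≤ M)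
    {F : ℝ → ℝ → ℝ} {y : ℝ} (hM : ∀ s ∈ Ioc 0 x, |F s y| ≤ M) :
    |fracInt₂ a (fracInt₂ a F) x y| ≤ M * (x ^ a / Real.Gamma (a + 1)) ^ 2 := by
  have hG : 0 < Real.Gamma (a + 1) := Real.Gamma_pos_of_pos (by linarith)
  refine (abs_fracInt₂_le ha hx (M := M * x ^ a / Real.Gamma (a + 1)) fun s hs => ?_).trans
    (le_of_eq (by ring))
  refine (abs_fracInt₂_le ha hs.1 fun t ht => hM t ⟨ht.1, ht.2.trans hs.2⟩).trans ?_
  have := hs.1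
  have := hs.2
  gcongr

lemma abs_fracInt₂_fracInt₂_sub_le {a x M : ℝ} (ha : 0 ≤ a) (hx : 0 < x) (hM0 : 0 ≤ M)
    {F : ℝ → ℝ → ℝ} (hF : Continuous (Function.uncurry F)) {y y' : ℝ}
    (hM : ∀ s ∈ Ioc 0 x, |F s y - F s y'| ≤ M) :
    |fracInt₂ a (fracInt₂ a F) x y - fracInt₂ a (fracInt₂ a F) x y'|
      ≤ M * (x ^ a / Real.Gamma (a + 1)) ^ 2 := by
  have hG : 0 < Real.Gamma (a + 1) := Real.Gamma_pos_of_pos (by linarith)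
  refine (abs_fracInt₂_sub_le ha hx (continuous_fracInt₂ ha hF)
    (M := M * x ^ a / Real.Gamma (a + 1)) fun s hs => ?_).trans (le_of_eq (by ring))
  refine (abs_fracInt₂_sub_le ha hs.1 hF fun t ht => hM t ⟨ht.1, ht.2.trans hs.2⟩).trans ?_
  have := hs.1
  have := hs.2
  gcongr

lemma hasDerivAt_fracInt_one {f : ℝ → ℝ} (hf : Continuous f) (x : ℝ) :
    HasDerivAt (fracInt 1 f) (f x) x := by
  have : fracInt 1 f = fun x => ∫ s in (0 : ℝ)..x, f s := funext fun x => fracInt_one f x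
  rw [this]
  exact intervalIntegral.integral_hasDerivAt_right (hf.intervalIntegrable _ _)
    hf.stronglyMeasurable.stronglyMeasurableAtFilter hf.continuousAt

/-- Differentiation in the second variable under a fractional integral. -/
lemma hasDerivAt_fracInt₂ {a x y l r : ℝ} (ha : 0 ≤ a) (hx : 0 < x) {F F' : ℝ → ℝ → ℝ}
    (hF : Continuous (Function.uncurry F)) (hF' : Continuous (Function.uncurry F'))
    (hd : ∀ s ∈ Ioc 0 x, ∀ y ∈ Ioo l r, HasDerivAt (F s) (F' s y) y) (hy : y ∈ Ioo l r) :
    HasDerivAt (fracInt₂ a F x) (fracInt₂ a F' x y) y := by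
  have hc : Continuous fun z => fracInt₂ a F' x z := continuous_right (continuous_fracInt₂ ha hF') x
  have h1 : HasDerivAt (fun z => ∫ t in y..z, fracInt₂ a F' x t) (fracInt₂ a F' x y) y :=
    intervalIntegral.integral_hasDerivAt_right (hc.intervalIntegrable _ _)
      hc.stronglyMeasurable.stronglyMeasurableAtFilter hc.continuousAt
  refine (h1.const_add (fracInt₂ a F x y)).congr_of_eventuallyEq ?_
  filter_upwards [Ioo_mem_nhds hy.1 hy.2] with z hz
  rw [← fracInt₂_integral ha hx hF']
  have e : ∀ s ∈ Ioc 0 x, ∫ t in y..z, F' s t = 1 * F s z + -1 * F s y := by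
    intro s hs
    rw [intervalIntegral.integral_eq_sub_of_hasDerivAt (f := F s)
      (fun t ht => hd s hs t ?_) ((continuous_right hF' s).intervalIntegrable _ _)]
    · ring
    · exact (convex_Ioo l r).ordConnected.uIcc_subset hy hz ht
  rw [fracInt_congr ha hx e, fracInt_linear ha (continuous_left hF z) (continuous_left hF y),
    fracInt₂_of_nonneg hx.le, fracInt₂_of_nonneg hx.le]
  ring

/-- A continuous solution of a homogeneous Volterra equation with fractional kernel is zero. -/
lemma eq_zero_of_eq_mul_fracInt {α m : ℝ} (hα : 0 < α) (hm : 0 ≤ m) {Z : ℝ → ℝ}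
    (hZ : Continuous Z) (h : ∀ x ∈ Ioo (0 : ℝ) 1, Z x = m * fracInt α (fracInt α Z) x) :
    ∀ x ∈ Ioo (0 : ℝ) 1, Z x = 0 := by
  obtain ⟨M, hM⟩ := (isCompact_Icc (a := (0 : ℝ)) (b := 1)).exists_bound_of_continuousOn
    hZ.continuousOn
  have h2α : 0 < 2 * α := by positivity
  have hG : ∀ n : ℕ, 0 < Real.Gamma (2 * α * n + 1) := fun n =>
    Real.Gamma_pos_of_pos (arg_pos h2α one_pos n)
  -- Each substitution of the bound into the equation adds `2α` to the exponent and to the Gamma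
  -- argument. At the end the constants are terms of the convergent series `E_{2α,1}(m)`, so they
  -- tend to `0`.
  have key : ∀ n : ℕ, ∀ x ∈ Ioo (0 : ℝ) 1,
      |Z x| ≤ M * (m ^ n / Real.Gamma (2 * α * n + 1)) * x ^ (2 * α * n + 1 - 1) := by
    intro n
    induction n with
    | zero =>
      intro x hx
      simpa using hM x (Ioo_subset_Icc_self hx)
    | succ n ih =>
      intro x hx
      have hx0 := hx.1
      set D := M * (m ^ n / Real.Gamma (2 * α * n + 1)) with hD
      have h1 : ∀ s ∈ Ioc 0 x, |fracInt α Z s| ≤ D * (Real.Gamma (2 * α * n + 1)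
          / Real.Gamma (2 * α * n + 1 + α)) * s ^ (2 * α * n + 1 + α - 1) := by
        intro s hs
        refine (abs_fracInt_le_of_rpow hα.le (arg_pos h2α one_pos n) hs.1
          fun t ht => ih t ⟨ht.1, ht.2.trans_lt (hs.2.trans_lt hx.2)⟩).trans (le_of_eq ?_)
        ring
      have h2 := abs_fracInt_le_of_rpow hα.le
        (by have := arg_pos h2α one_pos n; positivity) hx0 h1
      rw [h x hx, abs_mul, abs_of_nonneg hm]
      refine (mul_le_mul_of_nonneg_left h2 hm).trans (le_of_eq ?_)
      have e1 : 2 * α * n + 1 + α + α = 2 * α * ((n + 1 : ℕ) : ℝ) + 1 := by push_cast; ring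
      rw [e1, hD]
      have g1 := (hG n).ne'
      have g2 : Real.Gamma (2 * α * n + 1 + α) ≠ 0 := by
        refine (Real.Gamma_pos_of_pos ?_).ne'
        have := arg_pos h2α one_pos n
        positivity
      have g3 := (hG (n + 1)).ne'
      field_simp
      ring
  intro x hx
  have ht : Tendsto (fun n : ℕ => M * (m ^ n / Real.Gamma (2 * α * n + 1))) atTop (𝓝 0) := by
    have := (summable_mittagLeffler h2α one_pos m).tendsto_atTop_zero.const_mul M
    rwa [mul_zero] at this
  have hM0 : 0 ≤ M := (norm_nonneg _).trans (hM 0 ⟨le_rfl, zero_le_one⟩)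
  have hle : |Z x| ≤ 0 := by
    refine ge_of_tendsto' ht fun n => (key n x hx).trans ?_
    refine mul_le_of_le_one_right ?_ (Real.rpow_le_one hx.1.le hx.2.le ?_)
    · have := hG n
      positivity
    · rw [add_sub_cancel_right]
      positivity
  exact abs_eq_zero.1 (le_antisymm hle (abs_nonneg _))

lemma fracInt_max_congr {a x : ℝ} (ha : 0 ≤ a) (hx : 0 < x) (b : ℝ) (f : ℝ → ℝ) :
    fracInt a (fun s => fracInt b f (max s 0)) x = fracInt a (fracInt b f) x :=
  fracInt_congr ha hx fun s hs => by rw [max_eq_left hs.1.le]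

/-- Uniqueness for `J^(1-α) J^(1-α) z = m J² z`. -/
lemma eq_zero_of_fracInt_eq {α m : ℝ} (hα0 : 0 < α) (hα1 : α ≤ 1) (hm : 0 ≤ m) {z : ℝ → ℝ}
    (hz : Continuous z)
    (h : ∀ x ∈ Ioo (0 : ℝ) 1,
      fracInt (1 - α) (fracInt (1 - α) z) x = m * fracInt 1 (fracInt 1 z) x) :
    ∀ x ∈ Ioo (0 : ℝ) 1, z x = 0 := by
  have hα' : 0 ≤ 1 - α := by linarith
  have ii : ∀ {f : ℝ → ℝ} (_ : Continuous f) (x : ℝ), IntervalIntegrable f volume 0 x :=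
    fun hf x => hf.intervalIntegrable _ _
  -- The truncation makes the inner integral continuous on the whole line, so the semigroup law
  -- applies to it.
  set k : ℝ → ℝ := fun x => fracInt (1 - α) z (max x 0) with hk
  have hkc : Continuous k := continuous_fracInt_max hα' hz
  have hk' : ∀ s, 0 < s → k s = fracInt (1 - α) z s := fun s hs => by
    simp only [hk, max_eq_left hs.le]
  have c1 : Continuous (fracInt 1 z) :=
    continuous_iff_continuousAt.2 fun x => (hasDerivAt_fracInt_one hz x).continuousAt
  have c2 : Continuous (fracInt 1 (fracInt 1 z)) :=
    continuous_iff_continuousAt.2 fun x => (hasDerivAt_fracInt_one c1 x).continuousAt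
  have step1 : ∀ x, 0 < x → fracInt α (fracInt (1 - α) k) x = fracInt 1 k x := fun x hx => by
    rw [fracInt_fracInt hα0.le hα' hx (by linarith) (ii hkc x), add_sub_cancel]
  have step2 : ∀ x, 0 < x → fracInt α k x = fracInt 1 z x := fun x hx => by
    rw [fracInt_congr hα0.le hx fun s hs => hk' s hs.1,
      fracInt_fracInt hα0.le hα' hx (by linarith) (ii hz x), add_sub_cancel]
  have step3 : ∀ x, 0 < x → fracInt α (fracInt 1 k) x = fracInt 1 (fracInt 1 z) x := fun x hx => by
    rw [fracInt_fracInt hα0.le zero_le_one hx (by linarith) (ii hkc x), add_comm,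
      ← fracInt_fracInt zero_le_one hα0.le hx (by linarith) (ii hkc x)]
    exact fracInt_congr zero_le_one hx fun s hs => step2 s hs.1
  -- Applying `J^α` twice turns the left side into `J² z`, so `Z = J² z` solves `Z = m J^α J^α Z`.
  -- Then `z` is recovered by differentiating `Z` twice.
  have hZ : ∀ x ∈ Ioo (0 : ℝ) 1, fracInt 1 (fracInt 1 z) x
      = m * fracInt α (fracInt α (fracInt 1 (fracInt 1 z))) x := by
    intro x hx
    rw [← step3 x hx.1, ← fracInt_const_mul]
    refine fracInt_congr hα0.le hx.1 fun s hs => ?_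
    rw [← step1 s hs.1, ← fracInt_const_mul]
    refine fracInt_congr hα0.le hs.1 fun t ht => ?_
    rw [fracInt_congr hα' ht.1 fun v hv => hk' v hv.1]
    rw [h t ⟨ht.1, ht.2.trans_lt (hs.2.trans_lt hx.2)⟩]
  have h0 := eq_zero_of_eq_mul_fracInt hα0 hm c2 hZ
  have h1 : ∀ x ∈ Ioo (0 : ℝ) 1, fracInt 1 z x = 0 := by
    intro x hx
    have hd := hasDerivAt_fracInt_one c1 x
    have hd0 : HasDerivAt (fracInt 1 (fracInt 1 z)) 0 x :=
      (hasDerivAt_const x (0 : ℝ)).congr_of_eventuallyEq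
        (by filter_upwards [Ioo_mem_nhds hx.1 hx.2] with t ht using h0 t ht)
    exact hd.unique hd0
  intro x hx
  have hd := hasDerivAt_fracInt_one hz x
  have hd0 : HasDerivAt (fracInt 1 z) 0 x :=
    (hasDerivAt_const x (0 : ℝ)).congr_of_eventuallyEq
      (by filter_upwards [Ioo_mem_nhds hx.1 hx.2] with t ht using h1 t ht)
  exact hd.unique hd0

/-- A continuous solution of `J^(1-α) J^(1-α) f = β x^(2-α) + m J² f` with `f 1 = 0` is zero. -/
lemma eq_zero_of_fracInt_eq_add {α m β : ℝ} (hα0 : 0 < α) (hα1 : α ≤ 1) (hm : 0 ≤ m) {f : ℝ → ℝ}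
    (hf : Continuous f) (hf1 : f 1 = 0)
    (h : ∀ x ∈ Ioo (0 : ℝ) 1, fracInt (1 - α) (fracInt (1 - α) f) x
      = β * x ^ (2 - α) + m * fracInt 1 (fracInt 1 f) x) :
    ∀ x ∈ Ioo (0 : ℝ) 1, f x = 0 := by
  have h2α : 0 < 2 * α := by positivity
  have hα' : 0 ≤ 1 - α := by linarith
  set S : ℝ → ℝ := mlFun (2 * α) (α + 1) m with hS
  have hSc : Continuous S := by
    rw [hS]
    unfold mlFun
    have h1 := continuous_mittagLeffler_rpow (a := 2 * α) (b := α + 1) h2α (by positivity) m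
    have h3 : Continuous fun x : ℝ => x ^ (α + 1 - 1) := Real.continuous_rpow_const (by linarith)
    fun_prop
  have hS1 : 0 < S 1 := by
    have := mittagLeffler_pos (a := 2 * α) (b := α + 1) h2α (by positivity) hm
    simpa [hS, mlFun] using this
  have hG : 0 < Real.Gamma (3 - α) := Real.Gamma_pos_of_pos (by linarith)
  have hS2 : ∀ b c, 0 ≤ b → 0 ≤ c → ∀ x, 0 < x →
      fracInt c (fracInt b S) x = mlFun (2 * α) (α + 1 + b + c) m x := by
    intro b c hb hc x hx
    rw [fracInt_congr hc hx fun s hs => fracInt_mlFun h2α (by positivity) hb hs.1 m,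
      fracInt_mlFun h2α (by positivity) hc hx]
  -- By the shift, `J^(1-α)J^(1-α) S = x^(2-α)/Γ(3-α) + m J² S`; this multiple of `S` is therefore a
  -- particular solution, and subtracting it leaves the homogeneous equation.
  set β' := β * Real.Gamma (3 - α) with hβ'
  set z : ℝ → ℝ := fun x => 1 * f x + -β' * S x with hz
  have hzc : Continuous z := by fun_prop
  have hlin : ∀ b c, 0 ≤ b → 0 ≤ c → ∀ x, 0 < x →
      fracInt c (fracInt b z) x = 1 * fracInt c (fracInt b f) x + -β' * fracInt c (fracInt b S) x := by
    intro b c hb hc x hx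
    rw [← fracInt_max_congr hc hx b f, ← fracInt_max_congr hc hx b S,
      ← fracInt_linear hc (continuous_fracInt_max hb hf) (continuous_fracInt_max hb hSc)]
    refine fracInt_congr hc hx fun s hs => ?_
    rw [max_eq_left hs.1.le, hz, fracInt_linear hb hf hSc]
  have hz0 := eq_zero_of_fracInt_eq hα0 hα1 hm hzc (fun x hx => by
    rw [hlin _ _ hα' hα' x hx.1, hlin _ _ zero_le_one zero_le_one x hx.1, h x hx,
      hS2 _ _ hα' hα' x hx.1, hS2 _ _ zero_le_one zero_le_one x hx.1]
    have e1 : α + 1 + (1 - α) + (1 - α) = 3 - α := by ring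
    rw [e1, mlFun_shift h2α (by linarith) hx.1]
    have e2 : 3 - α + 2 * α = α + 1 + 1 + 1 := by ring
    have e3 : 3 - α - 1 = 2 - α := by ring
    rw [e2, e3, hβ']
    field_simp
    ring)
  -- Continuity carries `z = 0` to `x = 1`, where `f(1) = 0` and `S(1) > 0` force the coefficient to
  -- vanish.
  have hz1 : z 1 = 0 := by
    have h1 : Tendsto z (𝓝[<] 1) (𝓝 (z 1)) := hzc.continuousAt.tendsto.mono_left nhdsWithin_le_nhds
    have h2 : Tendsto z (𝓝[<] 1) (𝓝 0) := by
      refine tendsto_const_nhds.congr' ?_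
      filter_upwards [Ioo_mem_nhdsLT (zero_lt_one' ℝ)] with x hx
      exact (hz0 x hx).symm
    exact tendsto_nhds_unique h1 h2
  have hβ0 : β' = 0 := by
    simp only [hz, hf1] at hz1
    have : β' * S 1 = 0 := by linarith
    exact (mul_eq_zero.1 this).resolve_right hS1.ne'
  intro x hx
  have := hz0 x hx
  simp only [hz, hβ0] at this
  linarith

end FractionalIntegralContinuous

/-! ### Caputo derivatives in twice integrated form -/

section SecondPrimitive

open Filter Topology

/-- The deviation of `F` from its affine interpolant at `1 / 4` and `3 / 4`. -/
noncomputable def secDiff (F : ℝ → ℝ) (x : ℝ) : ℝ :=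
  F x - F (1 / 4) - (2 * x - 1 / 2) * (F (3 / 4) - F (1 / 4))

/-- The second primitive of `h` that vanishes at `1 / 4` and `3 / 4`. -/
noncomputable def secInt (h : ℝ → ℝ) (x : ℝ) : ℝ :=
  (∫ s in (1 / 4 : ℝ)..x, (x - s) * h s)
    - (2 * x - 1 / 2) * ∫ s in (1 / 4 : ℝ)..(3 / 4), (3 / 4 - s) * h s

lemma uIcc_subset_Ioo_unit {a b : ℝ} (ha : a ∈ Ioo (0 : ℝ) 1) (hb : b ∈ Ioo (0 : ℝ) 1) :
    uIcc a b ⊆ Ioo 0 1 :=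
  (convex_Ioo (0 : ℝ) 1).ordConnected.uIcc_subset ha hb

lemma intervalIntegrable_taylor {h : ℝ → ℝ} (hh : ContinuousOn h (Ioo 0 1)) {a b : ℝ}
    (ha : a ∈ Ioo (0 : ℝ) 1) (hb : b ∈ Ioo (0 : ℝ) 1) (x : ℝ) :
    IntervalIntegrable (fun s => (x - s) * h s) volume a b := by
  apply ContinuousOn.intervalIntegrable
  have := hh.mono (uIcc_subset_Ioo_unit ha hb)
  fun_prop

lemma eq_taylor {F L h : ℝ → ℝ} (hF : ∀ x ∈ Ioo (0 : ℝ) 1, HasDerivAt F (L x) x)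
    (hL : ∀ x ∈ Ioo (0 : ℝ) 1, HasDerivAt L (h x) x) (hh : ContinuousOn h (Ioo 0 1)) {a x : ℝ}
    (ha : a ∈ Ioo (0 : ℝ) 1) (hx : x ∈ Ioo (0 : ℝ) 1) :
    ∫ s in a..x, (x - s) * h s = F x - F a - (x - a) * L a := by
  have h1 : ∀ s ∈ uIcc a x, HasDerivAt (fun s => F s + (x - s) * L s) ((x - s) * h s) s := by
    intro s hs
    have hs' := uIcc_subset_Ioo_unit ha hx hs
    have h2 := (hF s hs').add ((((hasDerivAt_id s).const_sub x)).mul (hL s hs'))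
    refine h2.congr_deriv ?_
    simp
  rw [intervalIntegral.integral_eq_sub_of_hasDerivAt h1 (intervalIntegrable_taylor hh ha hx x)]
  ring

lemma quarter_mem : (1 / 4 : ℝ) ∈ Ioo (0 : ℝ) 1 := by constructor <;> norm_num

lemma three_quarters_mem : (3 / 4 : ℝ) ∈ Ioo (0 : ℝ) 1 := by constructor <;> norm_num

/-- Taylor's formula at `1/4` contains the unknown slope there; evaluating it at `3/4` eliminates
the slope. Only interior points occur, so nothing is required of `h` at `0` or `1`. -/
lemma secDiff_eq_secInt {F L h : ℝ → ℝ} (hF : ∀ x ∈ Ioo (0 : ℝ) 1, HasDerivAt F (L x) x)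
    (hL : ∀ x ∈ Ioo (0 : ℝ) 1, HasDerivAt L (h x) x) (hh : ContinuousOn h (Ioo 0 1)) {x : ℝ}
    (hx : x ∈ Ioo (0 : ℝ) 1) : secDiff F x = secInt h x := by
  rw [secDiff, secInt, eq_taylor hF hL hh quarter_mem hx,
    eq_taylor hF hL hh quarter_mem three_quarters_mem]
  ring

lemma secInt_linear {g h : ℝ → ℝ} (hg : ContinuousOn g (Ioo 0 1)) (hh : ContinuousOn h (Ioo 0 1))
    (p q : ℝ) {x : ℝ} (hx : x ∈ Ioo (0 : ℝ) 1) :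
    secInt (fun s => p * g s + q * h s) x = p * secInt g x + q * secInt h x := by
  have e : ∀ {b : ℝ}, b ∈ Ioo (0 : ℝ) 1 → ∫ s in (1 / 4 : ℝ)..b, (b - s) * (p * g s + q * h s)
      = p * (∫ s in (1 / 4 : ℝ)..b, (b - s) * g s) + q * ∫ s in (1 / 4 : ℝ)..b, (b - s) * h s := by
    intro b hb
    rw [← intervalIntegral.integral_const_mul, ← intervalIntegral.integral_const_mul,
      ← intervalIntegral.integral_add ((intervalIntegrable_taylor hg quarter_mem hb b).const_mul p)
        ((intervalIntegrable_taylor hh quarter_mem hb b).const_mul q)]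
    congr 1
    ext s
    ring
  rw [secInt, secInt, secInt, e hx, e three_quarters_mem]
  ring

lemma secInt_congr {g h : ℝ → ℝ} {x : ℝ} (hx : x ∈ Ioo (0 : ℝ) 1)
    (H : ∀ s ∈ Ioo (0 : ℝ) 1, g s = h s) : secInt g x = secInt h x := by
  have e : ∀ {b : ℝ}, b ∈ Ioo (0 : ℝ) 1 → ∫ s in (1 / 4 : ℝ)..b, (b - s) * g s
      = ∫ s in (1 / 4 : ℝ)..b, (b - s) * h s := fun {b} hb =>
    intervalIntegral.integral_congr fun s hs => by
      simp only [H s (uIcc_subset_Ioo_unit quarter_mem hb hs)]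
  rw [secInt, secInt, e hx, e three_quarters_mem]

lemma secDiff_congr {F G : ℝ → ℝ} {x : ℝ} (hx : x ∈ Ioo (0 : ℝ) 1)
    (H : ∀ s ∈ Ioo (0 : ℝ) 1, F s = G s) : secDiff F x = secDiff G x := by
  rw [secDiff, secDiff, H x hx, H _ quarter_mem, H _ three_quarters_mem]

/-- Multiply by the continuous function `(x - s)^a`, which cancels the kernel except at `s = x`. -/
lemma intervalIntegrable_of_rpow_mul {a x : ℝ} (ha : 0 ≤ a) (hx : 0 < x) {g : ℝ → ℝ}
    (hg : IntervalIntegrable (fun s => (x - s) ^ (-a) * g s) volume 0 x) :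
    IntervalIntegrable g volume 0 x := by
  have hc : Continuous fun s => (x - s) ^ a :=
    (Real.continuous_rpow_const ha).comp (by fun_prop)
  refine (hg.continuousOn_mul hc.continuousOn).congr_ae ?_
  rw [uIoc_of_le hx.le, EventuallyEq, ae_restrict_iff' measurableSet_Ioc]
  filter_upwards [Measure.ae_ne volume x] with s hs hsx
  have h0 : 0 < x - s := sub_pos.2 (lt_of_le_of_ne hsx.2 hs)
  rw [← mul_assoc, ← Real.rpow_add h0, add_neg_cancel, Real.rpow_zero, one_mul]

lemma intervalIntegrable_fracInt {b x : ℝ} (hb : 0 ≤ b) (hx : 0 < x) {f : ℝ → ℝ}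
    (hf : IntervalIntegrable f volume 0 x) : IntervalIntegrable (fracInt b f) volume 0 x := by
  simpa using intervalIntegrable_mul_fracInt one_pos hb hx (by linarith) hf

lemma fracInt_comm_one {a x : ℝ} (ha : 0 ≤ a) (hx : 0 < x) {f : ℝ → ℝ}
    (hf : IntervalIntegrable f volume 0 x) :
    fracInt a (fracInt 1 f) x = fracInt 1 (fracInt a f) x := by
  rw [fracInt_fracInt ha zero_le_one hx (by linarith) hf,
    fracInt_fracInt zero_le_one ha hx (by linarith) hf, add_comm]

/-- Second primitives of `D^α D^α f`, for `α < 1`. -/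
lemma fracInt_eq_add_fracInt_caputoDeriv {α : ℝ} (hα0 : 0 < α) (hα1 : α < 1) {f : ℝ → ℝ}
    (hf : ContinuousOn f (Icc 0 1)) (hd : CaputoDifferentiable α f)
    (hdd : CaputoDifferentiable α (caputoDeriv α f)) :
    (∀ x ∈ Ioo (0 : ℝ) 1,
      IntervalIntegrable (caputoDeriv α (caputoDeriv α f)) volume 0 x) ∧
    ∃ B : ℝ, ∀ x ∈ Ioo (0 : ℝ) 1,
      fracInt (1 - α) (fracInt (1 - α) fun t => f t - f 0) x
        = B * x ^ (2 - α) + fracInt 1 (fracInt 1 (caputoDeriv α (caputoDeriv α f))) x := by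
  have hα' : 0 < 1 - α := by linarith
  set g := caputoDeriv α f with hg
  have hgf : g = fracInt (1 - α) (deriv f) := funext fun x => caputoDeriv_eq_fracInt α f x
  have hhf : caputoDeriv α g = fracInt (1 - α) (deriv g) :=
    funext fun x => caputoDeriv_eq_fracInt α g x
  have if' : ∀ x ∈ Ioo (0 : ℝ) 1, IntervalIntegrable (deriv f) volume 0 x := fun x hx =>
    intervalIntegrable_of_rpow_mul hα0.le hx.1 ((hd x hx).2 hα1)
  have ig' : ∀ x ∈ Ioo (0 : ℝ) 1, IntervalIntegrable (deriv g) volume 0 x := fun x hx =>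
    intervalIntegrable_of_rpow_mul hα0.le hx.1 ((hdd x hx).2 hα1)
  have mem : ∀ {x s : ℝ}, x ∈ Ioo (0 : ℝ) 1 → s ∈ Ioc 0 x → s ∈ Ioo (0 : ℝ) 1 :=
    fun hx hs => ⟨hs.1, hs.2.trans_lt hx.2⟩
  have prim : ∀ x ∈ Ioo (0 : ℝ) 1, f x - f 0 = fracInt 1 (deriv f) x := by
    intro x hx
    rw [fracInt_one, intervalIntegral.integral_eq_sub_of_hasDerivAt_of_le hx.1.le
      (hf.mono (Icc_subset_Icc_right hx.2.le))
      (fun s hs => (hd s ⟨hs.1, hs.2.trans hx.2⟩).1.hasDerivAt) (if' x hx)]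
  have half : (1 / 2 : ℝ) ∈ Ioo (0 : ℝ) 1 := by constructor <;> norm_num
  -- This is the limit of `D^α f` at `0+`. It exists because the derivative of `D^α f` is integrable
  -- near `0`, and it is not prescribed by the problem.
  set B₀ := g (1 / 2) - ∫ s in (0 : ℝ)..(1 / 2), deriv g s with hB₀
  have primg : ∀ x ∈ Ioo (0 : ℝ) 1, g x = B₀ + fracInt 1 (deriv g) x := by
    intro x hx
    have h1 := intervalIntegral.integral_eq_sub_of_hasDerivAt (a := 1 / 2) (b := x) (f := g)
      (fun s hs => (hdd s (uIcc_subset_Ioo_unit half hx hs)).1.hasDerivAt)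
      ((ig' _ half).symm.trans (ig' x hx))
    have h2 := intervalIntegral.integral_add_adjacent_intervals (ig' _ half)
      ((ig' _ half).symm.trans (ig' x hx))
    rw [fracInt_one, ← h2, h1, hB₀]
    ring
  have iI : ∀ x ∈ Ioo (0 : ℝ) 1, IntervalIntegrable (fracInt 1 (deriv g)) volume 0 x :=
    fun x hx => intervalIntegrable_fracInt zero_le_one hx.1 (ig' x hx)
  -- From `f - f 0 = J f'` one gets `J^(1-α)(f - f 0) = J D^α f`, into which the primitive of `D^α
  -- f` is inserted. Another `J^(1-α)` turns `B₀ x` into a multiple of `x^(2-α)`.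
  have key : ∀ x ∈ Ioo (0 : ℝ) 1, fracInt (1 - α) (fun t => f t - f 0) x
      = B₀ * x ^ ((2 : ℝ) - 1) + fracInt 1 (fracInt 1 (deriv g)) x := by
    intro x hx
    rw [fracInt_congr hα'.le hx.1 fun s hs => prim s (mem hx hs),
      fracInt_comm_one hα'.le hx.1 (if' x hx), ← hgf,
      fracInt_congr zero_le_one hx.1 fun s hs => primg s (mem hx hs), fracInt_one, fracInt_one,
      intervalIntegral.integral_add _root_.intervalIntegrable_const (iI x hx)]
    simp
    norm_num
    ring
  refine ⟨fun x hx => ?_, B₀ * (Real.Gamma 2 / Real.Gamma (2 + (1 - α))), fun x hx => ?_⟩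
  · rw [hhf]
    exact intervalIntegrable_fracInt hα'.le hx.1 (ig' x hx)
  · have hx0 := hx.1
    rw [fracInt_congr hα'.le hx0 fun s hs => key s (mem hx hs)]
    have split : fracInt (1 - α)
        (fun s => B₀ * s ^ ((2 : ℝ) - 1) + fracInt 1 (fracInt 1 (deriv g)) s) x
        = B₀ * fracInt (1 - α) (fun s => s ^ ((2 : ℝ) - 1)) x
          + fracInt (1 - α) (fracInt 1 (fracInt 1 (deriv g))) x := by
      rw [fracInt_of_pos hα', fracInt_of_pos hα', fracInt_of_pos hα']
      simp_rw [mul_add, mul_left_comm _ B₀]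
      rw [intervalIntegral.integral_add ((intervalIntegrable_beta hα' two_pos hx0).const_mul _)
        (intervalIntegrable_mul_fracInt hα' zero_le_one hx0 (by linarith) (iI x hx)),
        intervalIntegral.integral_const_mul]
      ring
    rw [split, fracInt_rpow hα'.le two_pos hx0, fracInt_comm_one hα'.le hx0 (iI x hx)]
    have e : ∀ s ∈ Ioc 0 x, fracInt (1 - α) (fracInt 1 (deriv g)) s
        = fracInt 1 (caputoDeriv α g) s := fun s hs => by
      rw [fracInt_comm_one hα'.le hs.1 (ig' s (mem hx hs)), hhf]
    rw [fracInt_congr zero_le_one hx0 e]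
    have e2 : (2 : ℝ) + (1 - α) - 1 = 2 - α := by ring
    rw [e2]
    ring

/-- The first primitive tends to `0` at the origin, so the second is `o(x)`. -/
lemma tendsto_fracInt_one_fracInt_one_div {h : ℝ → ℝ} {r : ℝ} (hr : 0 < r)
    (hh : IntervalIntegrable h volume 0 r) :
    Tendsto (fun x => fracInt 1 (fracInt 1 h) x / x) (𝓝[>] 0) (𝓝 0) := by
  have hc : ContinuousOn (fun x => ∫ s in (0 : ℝ)..x, h s) (uIcc 0 r) :=
    intervalIntegral.continuousOn_primitive_interval
      ((intervalIntegrable_iff' (by simp)).1 hh)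
  rw [uIcc_of_le hr.le] at hc
  have h0 : Tendsto (fun x => ∫ s in (0 : ℝ)..x, h s) (𝓝[>] 0) (𝓝 0) := by
    have := (hc 0 ⟨le_rfl, hr.le⟩).tendsto
    rw [intervalIntegral.integral_same] at this
    refine this.mono_left ?_
    rw [← nhdsWithin_Ioc_eq_nhdsGT hr]
    exact nhdsWithin_mono _ Ioc_subset_Icc_self
  rw [Metric.tendsto_nhdsWithin_nhds] at h0 ⊢
  intro η hη
  obtain ⟨d, hd, H⟩ := h0 (η / 2) (half_pos hη)
  refine ⟨d, hd, fun {x} hx hxd => ?_⟩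
  have hx' : 0 < x := hx
  rw [dist_zero_right, Real.norm_of_nonneg hx'.le] at hxd
  rw [dist_zero_right, norm_div, Real.norm_of_nonneg hx'.le, div_lt_iff₀ hx', fracInt_one]
  have h1 : ‖∫ s in (0 : ℝ)..x, fracInt 1 h s‖ ≤ η / 2 * |x - 0| := by
    refine intervalIntegral.norm_integral_le_of_norm_le_const fun s hs => ?_
    rw [uIoc_of_le hx'.le] at hs
    rw [fracInt_one]
    have := H (x := s) hs.1 (by
      rw [dist_zero_right, Real.norm_of_nonneg hs.1.le]
      linarith [hs.2])
    rw [dist_zero_right] at this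
    exact this.le
  rw [sub_zero, abs_of_pos hx'] at h1
  nlinarith

/-- The pointwise content of the existence of `D^α D^α f`: up to a multiple of `x ^ (2 - α)`,
the function `J^(1-α) J^(1-α) (f - f 0)` is a second primitive of `D^α D^α f`. -/
lemma exists_secDiff_eq_secInt {α : ℝ} (hα0 : 0 < α) (hα1 : α ≤ 1) {f : ℝ → ℝ}
    (hf : ContinuousOn f (Icc 0 1)) (hd : CaputoDifferentiable α f)
    (hdd : CaputoDifferentiable α (caputoDeriv α f))
    (hc : ContinuousOn (caputoDeriv α (caputoDeriv α f)) (Ioo 0 1)) :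
    ∃ B : ℝ, (∀ x ∈ Ioo (0 : ℝ) 1,
      secDiff (fun s => fracInt (1 - α) (fracInt (1 - α) fun t => f t - f 0) s
        - B * s ^ (2 - α)) x = secInt (caputoDeriv α (caputoDeriv α f)) x) ∧
      (α < 1 → Tendsto (fun x => (fracInt (1 - α) (fracInt (1 - α) fun t => f t - f 0) x
        - B * x ^ (2 - α)) / x) (𝓝[>] 0) (𝓝 0)) ∧ (α = 1 → B = 0) := by
  rcases hα1.eq_or_lt with rfl | hα1
  -- For `α = 1` the Caputo hypotheses give no integrability at `0`. None is needed: `x^(2-α) = x`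
  -- is affine and invisible to `secDiff`, so `B = 0` may be taken.
  · refine ⟨0, fun x hx => ?_, fun h => absurd h (lt_irrefl _), fun _ => rfl⟩
    have e : ∀ f : ℝ → ℝ, caputoDeriv 1 f = deriv f := fun f => funext fun x => if_pos rfl
    simp only [e] at hdd hc ⊢
    simp only [sub_self, fracInt_zero, zero_mul, sub_zero]
    exact secDiff_eq_secInt (fun x hx => (hd x hx).1.hasDerivAt.sub_const _)
      (fun x hx => (hdd x hx).1.hasDerivAt) hc hx
  · obtain ⟨hi, B, hB⟩ := fracInt_eq_add_fracInt_caputoDeriv hα0 hα1 hf hd hdd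
    set h := caputoDeriv α (caputoDeriv α f) with hh
    have eA : ∀ x ∈ Ioo (0 : ℝ) 1, fracInt (1 - α) (fracInt (1 - α) fun t => f t - f 0) x
        - B * x ^ (2 - α) = fracInt 1 (fracInt 1 h) x := fun x hx => by
      rw [hB x hx]
      ring
    have one_eq : ∀ k : ℝ → ℝ, fracInt 1 k = fun x => ∫ s in (0 : ℝ)..x, k s :=
      fun k => funext fun x => fracInt_one k x
    have dL : ∀ x ∈ Ioo (0 : ℝ) 1, HasDerivAt (fracInt 1 h) (h x) x := by
      intro x hx
      rw [one_eq]
      exact intervalIntegral.integral_hasDerivAt_right (hi x hx)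
        (hc.stronglyMeasurableAtFilter isOpen_Ioo x hx) (hc.continuousAt (Ioo_mem_nhds hx.1 hx.2))
    have cL : ContinuousOn (fracInt 1 h) (Ioo 0 1) := fun x hx =>
      (dL x hx).continuousAt.continuousWithinAt
    have dA : ∀ x ∈ Ioo (0 : ℝ) 1, HasDerivAt (fracInt 1 (fracInt 1 h)) (fracInt 1 h x) x := by
      intro x hx
      have := intervalIntegral.integral_hasDerivAt_right
        (intervalIntegrable_fracInt zero_le_one hx.1 (hi x hx))
        (cL.stronglyMeasurableAtFilter isOpen_Ioo x hx) (dL x hx).continuousAt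
      rwa [← one_eq] at this
    refine ⟨B, fun x hx => ?_, fun _ => ?_, fun h => absurd h hα1.ne⟩
    · rw [secDiff_congr hx eA]
      exact secDiff_eq_secInt dA dL hc hx
    · refine (tendsto_fracInt_one_fracInt_one_div quarter_mem.1 (hi _ quarter_mem)).congr' ?_
      filter_upwards [Ioo_mem_nhdsGT (zero_lt_one' ℝ)] with x hx
      rw [eA x hx]

end SecondPrimitive

/-! ### The local problem for one parity, integrated in `x` and `y` -/

section ReducedProblem

open Filter Topology

/-- The nearest point of `[l, u]`. -/
noncomputable def clamp (l u x : ℝ) : ℝ := max l (min x u)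

lemma continuous_clamp (l u : ℝ) : Continuous (clamp l u) := by
  unfold clamp
  fun_prop

lemma clamp_mem {l u : ℝ} (h : l ≤ u) (x : ℝ) : clamp l u x ∈ Icc l u :=
  ⟨le_max_left _ _, max_le h (min_le_right _ _)⟩

lemma clamp_of_mem {l u x : ℝ} (hx : x ∈ Icc l u) : clamp l u x = x := by
  rw [clamp, min_eq_left hx.2, max_eq_right hx.1]

lemma continuousOn_integral_Omega {G : ℝ → ℝ → ℝ} (hG : ContinuousOn (Function.uncurry G) Omega)
    {a b : ℝ} (ha : a ∈ Ioo (0 : ℝ) 1) (hb : b ∈ Ioo (0 : ℝ) 1) :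
    ContinuousOn (fun y => ∫ s in a..b, G s y) (Ioo (-π) π) := by
  intro y hy
  obtain ⟨l, hl1, hl2⟩ := exists_between hy.1
  obtain ⟨u, hu1, hu2⟩ := exists_between hy.2
  have hlu : l ≤ u := (hl2.trans hu1).le
  -- Clamping to a compact rectangle inside the domain replaces `G` by a globally continuous
  -- function with the same values near `y`.
  have hc : Continuous (Function.uncurry fun y s =>
      G (clamp (min a b) (max a b) s) (clamp l u y)) := by
    refine hG.comp_continuous (f := fun p : ℝ × ℝ =>
      (clamp (min a b) (max a b) p.2, clamp l u p.1)) ?_ fun p => ⟨?_, ?_⟩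
    · exact ((continuous_clamp _ _).comp continuous_snd).prodMk
        ((continuous_clamp _ _).comp continuous_fst)
    · exact uIcc_subset_Ioo_unit ha hb (clamp_mem min_le_max p.2)
    · have := clamp_mem hlu p.1
      exact ⟨hl1.trans_le this.1, this.2.trans_lt hu2⟩
  have h1 := intervalIntegral.continuous_parametric_intervalIntegral_of_continuous' (μ := volume)
    hc a b
  refine (h1.continuousAt.congr ?_).continuousWithinAt
  filter_upwards [Ioo_mem_nhds hl2 hu1] with z hz
  apply intervalIntegral.integral_congr
  intro s hs
  simp only
  rw [clamp_of_mem (Ioo_subset_Icc_self hz), clamp_of_mem hs]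

lemma uIcc_subset_Ioo_pi {a b : ℝ} (ha : a ∈ Ioo (-π) π) (hb : b ∈ Ioo (-π) π) :
    uIcc a b ⊆ Ioo (-π) π :=
  (convex_Ioo (-π) π).ordConnected.uIcc_subset ha hb

lemma integral_integral_swap_Omega {G : ℝ → ℝ → ℝ}
    (hG : ContinuousOn (Function.uncurry G) Omega)
    {a b c d : ℝ} (ha : a ∈ Ioo (0 : ℝ) 1) (hb : b ∈ Ioo (0 : ℝ) 1) (hc : c ∈ Ioo (-π) π)
    (hd : d ∈ Ioo (-π) π) :
    ∫ s in a..b, ∫ t in c..d, G s t = ∫ t in c..d, ∫ s in a..b, G s t := by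
  apply intervalIntegral_intervalIntegral_swap
  have h1 : IntegrableOn (Function.uncurry G) (uIcc a b ×ˢ uIcc c d) :=
    (hG.mono (prod_mono (uIcc_subset_Ioo_unit ha hb)
      (uIcc_subset_Ioo_pi hc hd))).integrableOn_compact (isCompact_uIcc.prod isCompact_uIcc)
  exact h1.mono_set (prod_mono uIoc_subset_uIcc uIoc_subset_uIcc)

lemma continuousOn_secInt {G : ℝ → ℝ → ℝ} (hG : ContinuousOn (Function.uncurry G) Omega) {x : ℝ}
    (hx : x ∈ Ioo (0 : ℝ) 1) :
    ContinuousOn (fun y => secInt (fun s => G s y) x) (Ioo (-π) π) := by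
  have e : ∀ b : ℝ, ContinuousOn (Function.uncurry fun s y => (b - s) * G s y) Omega := fun b => by
    have : Continuous fun p : ℝ × ℝ => b - p.1 := by fun_prop
    exact this.continuousOn.mul hG
  exact (continuousOn_integral_Omega (e x) quarter_mem hx).sub
    (continuousOn_const.mul (continuousOn_integral_Omega (e _) quarter_mem three_quarters_mem))

lemma integral_secInt {G : ℝ → ℝ → ℝ} (hG : ContinuousOn (Function.uncurry G) Omega) {x c d : ℝ}
    (hx : x ∈ Ioo (0 : ℝ) 1) (hc : c ∈ Ioo (-π) π) (hd : d ∈ Ioo (-π) π) :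
    ∫ y in c..d, secInt (fun s => G s y) x = secInt (fun s => ∫ y in c..d, G s y) x := by
  have e : ∀ b : ℝ, ContinuousOn (Function.uncurry fun s y => (b - s) * G s y) Omega := fun b => by
    have : Continuous fun p : ℝ × ℝ => b - p.1 := by fun_prop
    exact this.continuousOn.mul hG
  have i : ∀ {b : ℝ}, b ∈ Ioo (0 : ℝ) 1 →
      IntervalIntegrable (fun y => ∫ s in (1 / 4 : ℝ)..b, (b - s) * G s y) volume c d := fun hb =>
    ((continuousOn_integral_Omega (e _) quarter_mem hb).mono
      (uIcc_subset_Ioo_pi hc hd)).intervalIntegrable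
  simp only [secInt]
  rw [intervalIntegral.integral_sub (i hx) ((i three_quarters_mem).const_mul _),
    intervalIntegral.integral_const_mul,
    ← integral_integral_swap_Omega (e _) quarter_mem hx hc hd,
    ← integral_integral_swap_Omega (e _) quarter_mem three_quarters_mem hc hd]
  simp only [intervalIntegral.integral_const_mul]

lemma secDiff_fracInt₂ {F : ℝ → ℝ → ℝ} (hF : Continuous (Function.uncurry F)) (y : ℝ) {x : ℝ}
    (hx : x ∈ Ioo (0 : ℝ) 1) :
    secDiff (fun s => fracInt₂ 1 (fracInt₂ 1 F) s y) x = secInt (fun s => F s y) x := by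
  have d : ∀ {H : ℝ → ℝ → ℝ} (_ : Continuous (Function.uncurry H)), ∀ x ∈ Ioo (0 : ℝ) 1,
      HasDerivAt (fun s => fracInt₂ 1 H s y) (H x y) x := by
    intro H hH x hx
    refine (hasDerivAt_fracInt_one (continuous_left hH y) x).congr_of_eventuallyEq ?_
    filter_upwards [Ioo_mem_nhds hx.1 hx.2] with s hs
    exact fracInt₂_of_nonneg hs.1.le _ _ _
  exact secDiff_eq_secInt (d (continuous_fracInt₂ zero_le_one hF)) (d hF)
    (continuous_left hF y).continuousOn hx

/-- The twice iterated fractional integral of order `1 - α` in the first variable. -/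
noncomputable def kInt (α : ℝ) (w : ℝ → ℝ → ℝ) : ℝ → ℝ → ℝ :=
  fracInt₂ (1 - α) (fracInt₂ (1 - α) w)

/-- The twice iterated integral in the first variable. -/
noncomputable def tInt (w : ℝ → ℝ → ℝ) : ℝ → ℝ → ℝ := fracInt₂ 1 (fracInt₂ 1 w)

/-- The local problem `D^α D^α w + κ w_yy - c² w = 0` with zero Dirichlet data at `x = 0, 1` and
zero Neumann data at `y = ±π`. The equation is stated in terms of second primitives of
`D^α D^α w`, with `B` collecting the constants of integration. -/
structure ReducedSolution (α κ c : ℝ) (w wy wyy : ℝ → ℝ → ℝ) (B : ℝ → ℝ) : Prop where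
  pos : 0 < α
  le_one : α ≤ 1
  kappa_pos : 0 < κ
  cont : Continuous (Function.uncurry w)
  cont_wy : Continuous (Function.uncurry wy)
  hasDerivAt : ∀ x, ∀ y ∈ Ioo (-π) π, HasDerivAt (w x) (wy x y) y
  hasDerivAt_wy : ∀ x ∈ Ioo (0 : ℝ) 1, ∀ y ∈ Ioo (-π) π, HasDerivAt (wy x) (wyy x y) y
  cont_wyy : ContinuousOn (Function.uncurry wyy) Omega
  left : ∀ y, w 0 y = 0
  right : ∀ y, w 1 y = 0
  bottom : ∀ x, wy x (-π) = 0
  top : ∀ x, wy x π = 0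
  secDiff_eq : ∀ x ∈ Ioo (0 : ℝ) 1, ∀ y ∈ Ioo (-π) π,
    secDiff (fun s => kInt α w s y - B y * s ^ (2 - α)) x
      = secInt (fun s => c ^ 2 * w s y - κ * wyy s y) x
  tendsto : α < 1 → ∀ y ∈ Ioo (-π) π,
    Tendsto (fun x => (kInt α w x y - B y * x ^ (2 - α)) / x) (𝓝[>] 0) (𝓝 0)
  eq_zero_of_eq_one : α = 1 → ∀ y, B y = 0

namespace ReducedSolution

variable {α κ c : ℝ} {w wy wyy : ℝ → ℝ → ℝ} {B : ℝ → ℝ}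

lemma continuous_kInt (h : ReducedSolution α κ c w wy wyy B) :
    Continuous (Function.uncurry (kInt α w)) := by
  have : 0 ≤ 1 - α := by linarith [h.le_one]
  exact continuous_fracInt₂ this (continuous_fracInt₂ this h.cont)

lemma continuous_tInt (h : ReducedSolution α κ c w wy wyy B) :
    Continuous (Function.uncurry (tInt w)) :=
  continuous_fracInt₂ zero_le_one (continuous_fracInt₂ zero_le_one h.cont)

lemma continuous_tInt_wy (h : ReducedSolution α κ c w wy wyy B) :
    Continuous (Function.uncurry (tInt wy)) :=
  continuous_fracInt₂ zero_le_one (continuous_fracInt₂ zero_le_one h.cont_wy)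

/-- For `α < 1` strict convexity makes `secDiff` of `x^(2-α)` nonzero at `1/2`, so the equation
there can be solved for `B(y)` in terms of continuous functions of `y`. -/
lemma continuousOn_B (h : ReducedSolution α κ c w wy wyy B) : ContinuousOn B (Ioo (-π) π) := by
  rcases h.le_one.eq_or_lt with h1 | h1
  · have : B = fun _ => 0 := funext (h.eq_zero_of_eq_one h1)
    rw [this]
    exact continuousOn_const
  · have half : (1 / 2 : ℝ) ∈ Ioo (0 : ℝ) 1 := by constructor <;> norm_num
    have hconv := strictConvexOn_rpow (p := 2 - α) (by linarith)
    have hneg : secDiff (fun s => s ^ (2 - α)) (1 / 2) < 0 := by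
      have := hconv.2 (show (1 / 4 : ℝ) ∈ Ici 0 by norm_num [mem_Ici])
        (show (3 / 4 : ℝ) ∈ Ici 0 by norm_num [mem_Ici]) (by norm_num)
        (show (0 : ℝ) < 1 / 2 by norm_num) (show (0 : ℝ) < 1 / 2 by norm_num) (by norm_num)
      simp only [smul_eq_mul] at this
      norm_num [secDiff] at this ⊢
      linarith
    have hKy : Continuous fun y => secDiff (fun s => kInt α w s y) (1 / 2) := by
      have := fun s => continuous_right h.continuous_kInt s
      unfold secDiff
      fun_prop
    have hG : ContinuousOn (Function.uncurry fun s y => c ^ 2 * w s y - κ * wyy s y) Omega :=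
      (continuousOn_const.mul h.cont.continuousOn).sub (continuousOn_const.mul h.cont_wyy)
    refine ((hKy.continuousOn.sub (continuousOn_secInt hG half)).div_const
      (secDiff (fun s => s ^ (2 - α)) (1 / 2))).congr fun y hy => ?_
    have e := h.secDiff_eq _ half y hy
    rw [eq_div_iff hneg.ne]
    simp only [secDiff, Pi.sub_apply] at e ⊢
    linarith

/-- The equation, integrated twice in `x` and once in `y`. -/
noncomputable def defect (_ : ReducedSolution α κ c w wy wyy B) (x y : ℝ) : ℝ :=
  κ * (tInt wy x y - tInt wy x 0)
    + ∫ t in (0 : ℝ)..y, (kInt α w x t - B t * x ^ (2 - α) - c ^ 2 * tInt w x t)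

lemma zero_mem : (0 : ℝ) ∈ Ioo (-π) π := ⟨by linarith [Real.pi_pos], Real.pi_pos⟩

lemma continuousOn_integrand (h : ReducedSolution α κ c w wy wyy B) (x : ℝ) :
    ContinuousOn (fun t => kInt α w x t - B t * x ^ (2 - α) - c ^ 2 * tInt w x t)
      (Ioo (-π) π) := by
  have h1 := (continuous_right h.continuous_kInt x).continuousOn (s := Ioo (-π) π)
  have h2 := (continuous_right h.continuous_tInt x).continuousOn (s := Ioo (-π) π)
  have h3 := h.continuousOn_B
  fun_prop

lemma intervalIntegrable_integrand (h : ReducedSolution α κ c w wy wyy B) (x : ℝ) {y z : ℝ}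
    (hy : y ∈ Ioo (-π) π) (hz : z ∈ Ioo (-π) π) :
    IntervalIntegrable (fun t => kInt α w x t - B t * x ^ (2 - α) - c ^ 2 * tInt w x t)
      volume y z :=
  ((h.continuousOn_integrand x).mono (uIcc_subset_Ioo_pi hy hz)).intervalIntegrable

/-- `secDiff` passes under the `y`-integral, where the equation replaces it by `secInt` of `w_yy`.
Integrating in `y` gives the difference of `w_y`, which cancels the first term of the defect. -/
lemma secDiff_defect (h : ReducedSolution α κ c w wy wyy B) {x y : ℝ} (hx : x ∈ Ioo (0 : ℝ) 1)
    (hy : y ∈ Ioo (-π) π) : secDiff (fun s => h.defect s y) x = 0 := by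
  have hi := fun s => h.intervalIntegrable_integrand s zero_mem hy
  have e1 : secDiff (fun s => h.defect s y) x
      = κ * (secDiff (fun s => tInt wy s y) x - secDiff (fun s => tInt wy s 0) x)
        + ∫ t in (0 : ℝ)..y, (secDiff (fun s => kInt α w s t - B t * s ^ (2 - α)) x
          - c ^ 2 * secDiff (fun s => tInt w s t) x) := by
    have e2 : ∫ t in (0 : ℝ)..y, (secDiff (fun s => kInt α w s t - B t * s ^ (2 - α)) x
          - c ^ 2 * secDiff (fun s => tInt w s t) x)
        = secDiff (fun s => ∫ t in (0 : ℝ)..y,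
            (kInt α w s t - B t * s ^ (2 - α) - c ^ 2 * tInt w s t)) x := by
      rw [secDiff, ← intervalIntegral.integral_sub (hi _) (hi _),
        ← intervalIntegral.integral_sub (hi _) (hi _), ← intervalIntegral.integral_const_mul,
        ← intervalIntegral.integral_sub ((hi _).sub (hi _)) (((hi _).sub (hi _)).const_mul _)]
      congr 1
      ext t
      simp only [secDiff]
      ring
    rw [e2]
    simp only [secDiff, defect]
    ring
  have hcw : ∀ t, ContinuousOn (fun s => w s t) (Ioo 0 1) := fun t =>
    (continuous_left h.cont t).continuousOn
  have hcwy : ∀ t, ContinuousOn (fun s => wy s t) (Ioo 0 1) := fun t =>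
    (continuous_left h.cont_wy t).continuousOn
  have hcwyy : ∀ t ∈ Ioo (-π) π, ContinuousOn (fun s => wyy s t) (Ioo 0 1) := fun t ht =>
    h.cont_wyy.comp (f := fun s : ℝ => (s, t)) (by fun_prop) fun s hs => ⟨hs, ht⟩
  have e3 : ∫ t in (0 : ℝ)..y, (secDiff (fun s => kInt α w s t - B t * s ^ (2 - α)) x
      - c ^ 2 * secDiff (fun s => tInt w s t) x)
      = ∫ t in (0 : ℝ)..y, -κ * secInt (fun s => wyy s t) x := by
    apply intervalIntegral.integral_congr
    intro t ht
    have ht' := uIcc_subset_Ioo_pi zero_mem hy ht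
    simp only
    rw [h.secDiff_eq x hx t ht', tInt, secDiff_fracInt₂ h.cont t hx]
    have := secInt_linear (hcw t) (hcwyy t ht') (c ^ 2) (-κ) hx
    rw [show (fun s => c ^ 2 * w s t - κ * wyy s t)
      = fun s => c ^ 2 * w s t + -κ * wyy s t by ext s; ring, this]
    ring
  have e4 : secInt (fun s => ∫ t in (0 : ℝ)..y, wyy s t) x
      = secInt (fun s => wy s y) x - secInt (fun s => wy s 0) x := by
    have := secInt_linear (hcwy y) (hcwy 0) 1 (-1) hx
    rw [secInt_congr hx (h := fun s => 1 * wy s y + -1 * wy s 0), this]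
    · ring
    · intro s hs
      rw [intervalIntegral.integral_eq_sub_of_hasDerivAt (f := wy s)]
      · ring
      · exact fun t ht => h.hasDerivAt_wy s hs t (uIcc_subset_Ioo_pi zero_mem hy ht)
      · refine (h.cont_wyy.comp (f := fun t : ℝ => (s, t)) (by fun_prop) fun t ht =>
          ⟨hs, uIcc_subset_Ioo_pi zero_mem hy ht⟩).intervalIntegrable
  rw [e1, e3, intervalIntegral.integral_const_mul, integral_secInt h.cont_wyy hx zero_mem hy, e4,
    tInt, secDiff_fracInt₂ h.cont_wy y hx, secDiff_fracInt₂ h.cont_wy 0 hx]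
  ring

lemma kInt_zero_left (h : ReducedSolution α κ c w wy wyy B) (y : ℝ) : kInt α w 0 y = 0 := by
  rcases h.le_one.eq_or_lt with h1 | h1
  · rw [kInt, h1, sub_self, fracInt₂_of_nonneg le_rfl, fracInt_zero,
      fracInt₂_of_nonneg le_rfl, fracInt_zero, h.left]
  · rw [kInt, fracInt₂_of_nonneg le_rfl, fracInt_of_pos (by linarith)]
    simp

lemma tInt_zero_left (F : ℝ → ℝ → ℝ) (y : ℝ) : tInt F 0 y = 0 := by
  rw [tInt, fracInt₂_of_nonneg le_rfl, fracInt_one, intervalIntegral.integral_same]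

/-- The slope of the defect, which is linear in `x`. -/
noncomputable def slope (h : ReducedSolution α κ c w wy wyy B) (y : ℝ) : ℝ :=
  2 * (h.defect (3 / 4) y - h.defect (1 / 4) y)

lemma integral_integrand (h : ReducedSolution α κ c w wy wyy B) (x : ℝ) {y z : ℝ}
    (hy : y ∈ Ioo (-π) π) (hz : z ∈ Ioo (-π) π) :
    ∫ t in y..z, (kInt α w x t - B t * x ^ (2 - α) - c ^ 2 * tInt w x t)
      = (∫ t in y..z, (kInt α w x t - c ^ 2 * tInt w x t)) - x ^ (2 - α) * ∫ t in y..z, B t := by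
  have hK := continuous_right h.continuous_kInt x
  have hT := continuous_right h.continuous_tInt x
  have hc : Continuous fun t => kInt α w x t - c ^ 2 * tInt w x t := by fun_prop
  have hB : IntervalIntegrable B volume y z :=
    (h.continuousOn_B.mono (uIcc_subset_Ioo_pi hy hz)).intervalIntegrable
  rw [← intervalIntegral.integral_const_mul,
    ← intervalIntegral.integral_sub (hc.intervalIntegrable _ _) (hB.const_mul _)]
  congr 1
  ext t
  ring

/-- Vanishing `secDiff` means affine in `x`; the constant term is zero because the defect extends
continuously to `x = 0` with value `0`. -/
lemma defect_eq (h : ReducedSolution α κ c w wy wyy B) {x y : ℝ} (hx : x ∈ Ioo (0 : ℝ) 1)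
    (hy : y ∈ Ioo (-π) π) : h.defect x y = x * h.slope y := by
  have hlin : ∀ s ∈ Ioo (0 : ℝ) 1, h.defect s y = h.defect (1 / 4) y
      + (2 * s - 1 / 2) * (h.defect (3 / 4) y - h.defect (1 / 4) y) := fun s hs => by
    have := h.secDiff_defect hs hy
    rw [secDiff] at this
    linarith
  have hcont : Continuous fun s => h.defect s y := by
    have e : ∀ s, h.defect s y = κ * (tInt wy s y - tInt wy s 0)
        + ((∫ t in (0 : ℝ)..y, (kInt α w s t - c ^ 2 * tInt w s t))
          - s ^ (2 - α) * ∫ t in (0 : ℝ)..y, B t) := fun s => by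
      rw [defect, h.integral_integrand s zero_mem hy]
    simp_rw [e]
    have h1 := continuous_left h.continuous_tInt_wy y
    have h2 := continuous_left h.continuous_tInt_wy 0
    have h3 : Continuous fun s : ℝ => s ^ (2 - α) :=
      Real.continuous_rpow_const (by linarith [h.le_one])
    have h4 : Continuous (Function.uncurry fun s t => kInt α w s t - c ^ 2 * tInt w s t) :=
      h.continuous_kInt.sub (continuous_const.mul h.continuous_tInt)
    have h5 := intervalIntegral.continuous_parametric_intervalIntegral_of_continuous' (μ := volume)
      h4 0 y
    fun_prop
  have h0 : h.defect 0 y = 0 := by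
    rw [defect, tInt_zero_left, tInt_zero_left, Real.zero_rpow (by linarith [h.le_one])]
    simp [h.kInt_zero_left, tInt_zero_left]
  have hlim : Tendsto (fun s => h.defect s y) (𝓝[>] 0) (𝓝 0) := by
    have := hcont.tendsto 0
    rw [h0] at this
    exact this.mono_left nhdsWithin_le_nhds
  have hlim' : Tendsto (fun s => h.defect s y) (𝓝[>] 0) (𝓝 (h.defect (1 / 4) y
      + (2 * 0 - 1 / 2) * (h.defect (3 / 4) y - h.defect (1 / 4) y))) := by
    have hc : Continuous fun s : ℝ => h.defect (1 / 4) y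
      + (2 * s - 1 / 2) * (h.defect (3 / 4) y - h.defect (1 / 4) y) := by fun_prop
    refine ((hc.tendsto 0).mono_left nhdsWithin_le_nhds).congr' ?_
    filter_upwards [Ioo_mem_nhdsGT (zero_lt_one' ℝ)] with s hs
    exact (hlin s hs).symm
  have := tendsto_nhds_unique hlim hlim'
  rw [hlin x hx, slope]
  linarith

end ReducedSolution

end ReducedProblem

/-! ### A rigidity lemma for second differences -/

section SecondDifference

open Filter Topology

variable {p : ℝ → ℝ} {l u C s : ℝ}

/-- A second difference at the midpoint compares the increment over `ρ` with twice the increment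
over `ρ/2`. Since `s > 1`, the errors of repeated halving sum geometrically. -/
lemma abs_sub_le_of_second_difference (hs : 1 < s) (hC : 0 ≤ C)
    (h2 : ∀ ρ ∈ Ioo (0 : ℝ) 1, ∀ y, l < y - ρ → y + ρ < u →
      |p (y + ρ) + p (y - ρ) - 2 * p y| ≤ C * ρ ^ s) (N : ℕ) :
    ∀ ρ ∈ Ioo (0 : ℝ) 1, ∀ y, l < y → y + ρ < u →
      |p (y + ρ) - p y| ≤ 2 ^ N * |p (y + ρ / 2 ^ N) - p y|
        + C / (1 - (2 : ℝ) ^ (1 - s)) * ρ ^ s := by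
  have hq : (2 : ℝ) ^ (1 - s) < 1 :=
    Real.rpow_lt_one_of_one_lt_of_neg one_lt_two (by linarith)
  have hq' : 0 < 1 - (2 : ℝ) ^ (1 - s) := by linarith
  set C' := C / (1 - (2 : ℝ) ^ (1 - s)) with hC'
  -- The constant is the fixed point of the recursion `C' = 2^(1-s) C' + C` produced by one halving.
  have hCC : (2 : ℝ) ^ (1 - s) * C' + C = C' := by
    rw [hC']
    field_simp
    ring
  induction N with
  | zero =>
    intro ρ hρ y _ _
    have := hρ.1
    have : 0 ≤ C' * ρ ^ s := by positivity
    simpa using this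
  | succ N ih =>
    intro ρ hρ y hy hyu
    have hρ0 := hρ.1
    have hρ1 := hρ.2
    have hh : ρ / 2 ∈ Ioo (0 : ℝ) 1 := ⟨by linarith, by linarith⟩
    have h1 := h2 (ρ / 2) hh (y + ρ / 2) (by linarith) (by linarith)
    rw [show y + ρ / 2 + ρ / 2 = y + ρ by ring, show y + ρ / 2 - ρ / 2 = y by ring] at h1
    have h3 := ih (ρ / 2) hh y hy (by linarith)
    rw [div_div, ← pow_succ'] at h3
    have h4 : (ρ / 2) ^ s ≤ ρ ^ s := Real.rpow_le_rpow (by linarith) (by linarith) (by linarith)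
    have h5 : 2 * (ρ / 2) ^ s = (2 : ℝ) ^ (1 - s) * ρ ^ s := by
      rw [Real.div_rpow hρ0.le zero_le_two, Real.rpow_sub two_pos, Real.rpow_one]
      ring
    have h6 : |p (y + ρ) - p y| ≤ 2 * |p (y + ρ / 2) - p y| + C * ρ ^ s := by
      have e : p (y + ρ) - p y
          = 2 * (p (y + ρ / 2) - p y) + (p (y + ρ) + p y - 2 * p (y + ρ / 2)) := by ring
      rw [e]
      refine (abs_add_le _ _).trans ?_
      rw [abs_mul, abs_two]
      have := mul_le_mul_of_nonneg_left h4 hC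
      linarith
    calc |p (y + ρ) - p y| ≤ 2 * |p (y + ρ / 2) - p y| + C * ρ ^ s := h6
      _ ≤ 2 * (2 ^ N * |p (y + ρ / 2 ^ (N + 1)) - p y| + C' * (ρ / 2) ^ s) + C * ρ ^ s := by
          linarith
      _ = 2 ^ (N + 1) * |p (y + ρ / 2 ^ (N + 1)) - p y|
          + (C' * (2 * (ρ / 2) ^ s) + C * ρ ^ s) := by ring
      _ = 2 ^ (N + 1) * |p (y + ρ / 2 ^ (N + 1)) - p y| + C' * ρ ^ s := by
          rw [h5]
          linear_combination ρ ^ s * hCC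

/-- A continuous function with superlinearly small second differences is constant if, on a dense
set, its difference quotients are eventually arbitrarily small. -/
lemma eq_of_second_difference (hs : 1 < s) (hC : 0 ≤ C) (hp : ContinuousOn p (Ioo l u))
    (h2 : ∀ ρ ∈ Ioo (0 : ℝ) 1, ∀ y, l < y - ρ → y + ρ < u →
      |p (y + ρ) + p (y - ρ) - 2 * p y| ≤ C * ρ ^ s)
    (hd : ∀ η > 0, ∀ a b, l < a → a < b → b < u →
      ∃ y ∈ Ioo a b, ∀ᶠ z in 𝓝 y, |p z - p y| ≤ η * |z - y|)
    {a b : ℝ} (hla : l < a) (hab : a ≤ b) (hbu : b < u) : p b = p a := by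
  have hq : (2 : ℝ) ^ (1 - s) < 1 :=
    Real.rpow_lt_one_of_one_lt_of_neg one_lt_two (by linarith)
  set C' := C / (1 - (2 : ℝ) ^ (1 - s)) with hC'
  -- Let the number of halvings grow at a point with small difference quotients: `2^N` times the
  -- increment over `ρ/2^N` is at most `η ρ`.
  have good : ∀ η > 0, ∀ ρ ∈ Ioo (0 : ℝ) 1, ∀ y, l < y → y + ρ < u →
      (∀ᶠ z in 𝓝 y, |p z - p y| ≤ η * |z - y|) → |p (y + ρ) - p y| ≤ η * ρ + C' * ρ ^ s := by
    intro η hη ρ hρ y hy hyu hev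
    have ht : Tendsto (fun N : ℕ => y + ρ / 2 ^ N) atTop (𝓝 y) := by
      have h1 : Tendsto (fun N : ℕ => ρ * (1 / 2 : ℝ) ^ N) atTop (𝓝 (ρ * 0)) :=
        (tendsto_pow_atTop_nhds_zero_of_lt_one (by norm_num) (by norm_num)).const_mul ρ
      have h2 := h1.const_add y
      rw [mul_zero, add_zero] at h2
      refine h2.congr fun N => ?_
      rw [one_div, inv_pow, div_eq_mul_inv]
    obtain ⟨N, hN⟩ := (ht.eventually hev).exists
    refine (abs_sub_le_of_second_difference hs hC h2 N ρ hρ y hy hyu).trans ?_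
    have h3 : 0 < ρ / 2 ^ N := by have := hρ.1; positivity
    rw [add_sub_cancel_left, abs_of_pos h3] at hN
    have h4 : (2 : ℝ) ^ N * (η * (ρ / 2 ^ N)) = η * ρ := by field_simp
    have h5 := mul_le_mul_of_nonneg_left hN (by positivity : (0 : ℝ) ≤ 2 ^ N)
    rw [h4] at h5
    linarith
  -- The set of good points depends on `η`, but for every `η` it is dense. A strict violation at one
  -- point would persist nearby by continuity and meet a good point.
  have all : ∀ ρ ∈ Ioo (0 : ℝ) 1, ∀ y, l < y → y + ρ < u →
      |p (y + ρ) - p y| ≤ C' * ρ ^ s := by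
    intro ρ hρ y hy hyu
    by_contra! hlt
    have hρ0 := hρ.1
    obtain ⟨η, hη, hlt'⟩ : ∃ η > 0, η * ρ + C' * ρ ^ s < |p (y + ρ) - p y| := by
      refine ⟨(|p (y + ρ) - p y| - C' * ρ ^ s) / (2 * ρ), ?_, ?_⟩
      · apply div_pos <;> linarith
      · have : (|p (y + ρ) - p y| - C' * ρ ^ s) / (2 * ρ) * ρ
            = (|p (y + ρ) - p y| - C' * ρ ^ s) / 2 := by field_simp
        rw [this]
        linarith
    have hc1 : ContinuousAt p y := hp.continuousAt (Ioo_mem_nhds hy (by linarith))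
    have hc2 : ContinuousAt p (y + ρ) := hp.continuousAt (Ioo_mem_nhds (by linarith) hyu)
    have hc3 : ContinuousAt (fun z => |p (z + ρ) - p z|) y := by
      have : ContinuousAt (fun z => p (z + ρ)) y :=
        ContinuousAt.comp (f := fun z : ℝ => z + ρ) hc2 (by fun_prop)
      exact (this.sub hc1).abs
    have hev : ∀ᶠ z in 𝓝 y, η * ρ + C' * ρ ^ s < |p (z + ρ) - p z| ∧ l < z ∧ z + ρ < u := by
      filter_upwards [hc3.eventually (lt_mem_nhds hlt'), Ioo_mem_nhds hy (lt_sub_iff_add_lt.2 hyu)]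
        with z h1 h3
      exact ⟨h1, h3.1, lt_sub_iff_add_lt.1 h3.2⟩
    obtain ⟨r, hr, hball⟩ := Metric.eventually_nhds_iff.1 hev
    have hm : ∀ z ∈ Ioo (y - r) (y + r), η * ρ + C' * ρ ^ s < |p (z + ρ) - p z| ∧ l < z ∧ z + ρ < u :=
      fun z hz => hball (by
        rw [Real.dist_eq, abs_lt]
        constructor <;> linarith [hz.1, hz.2])
    have hm1 := hm (y - r / 2) ⟨by linarith, by linarith⟩
    have hm2 := hm (y + r / 2) ⟨by linarith, by linarith⟩
    obtain ⟨z, hz, hzev⟩ := hd η hη (y - r / 2) (y + r / 2) hm1.2.1 (by linarith)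
      (by linarith [hm2.2.2])
    have hmz := hm z ⟨by linarith [hz.1], by linarith [hz.2]⟩
    exact absurd (good η hη ρ hρ z hmz.2.1 hmz.2.2 hzev) (not_le.2 hmz.1)
  -- Increments of order `ρ^s` with `s > 1` make every right derivative zero.
  refine constant_of_has_deriv_right_zero
    (hp.mono fun z hz => ⟨hla.trans_le hz.1, hz.2.trans_lt hbu⟩) ?_ b ⟨hab, le_rfl⟩
  intro z hz
  rw [← hasDerivWithinAt_Ioi_iff_Ici, hasDerivWithinAt_iff_tendsto_slope' (by simp)]
  have hlim : Tendsto (fun x => C' * (x - z) ^ (s - 1)) (𝓝[>] z) (𝓝 0) := by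
    have hc : Continuous fun x => C' * (x - z) ^ (s - 1) :=
      continuous_const.mul ((Real.continuous_rpow_const (by linarith)).comp (by fun_prop))
    have := hc.tendsto z
    rw [sub_self, Real.zero_rpow (by linarith), mul_zero] at this
    exact this.mono_left nhdsWithin_le_nhds
  refine squeeze_zero_norm' ?_ hlim
  have hm : z < min (z + 1) u := lt_min (by linarith) (hz.2.trans hbu)
  filter_upwards [Ioo_mem_nhdsGT hm] with x hx
  have h0 : 0 < x - z := sub_pos.2 hx.1
  have h1 := all (x - z) ⟨h0, by linarith [hx.2.trans_le (min_le_left _ _)]⟩ z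
    (hla.trans_le hz.1) (by linarith [hx.2.trans_le (min_le_right _ _)])
  rw [add_sub_cancel] at h1
  rw [slope_def_field, norm_div, Real.norm_of_nonneg h0.le, div_le_iff₀ h0, mul_assoc,
    ← Real.rpow_add_one h0.ne', sub_add_cancel]
  exact h1

end SecondDifference

/-! ### Vanishing of the slope, projection on the modes, and `w = 0` -/

namespace ReducedSolution

open Filter Topology

variable {α κ c : ℝ} {w wy wyy : ℝ → ℝ → ℝ} {B : ℝ → ℝ}

lemma exists_bound (h : ReducedSolution α κ c w wy wyy B) :
    ∃ M, 0 ≤ M ∧ (∀ s ∈ Icc (0 : ℝ) 1, ∀ y ∈ Icc (-π) π, |w s y| ≤ M) ∧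
      ∀ s ∈ Icc (0 : ℝ) 1, ∀ y ∈ Icc (-π) π, |wy s y| ≤ M := by
  obtain ⟨M₁, hM₁⟩ := ((isCompact_Icc (a := (0 : ℝ)) (b := 1)).prod
    (isCompact_Icc (a := -π) (b := π))).exists_bound_of_continuousOn h.cont.continuousOn
  obtain ⟨M₂, hM₂⟩ := ((isCompact_Icc (a := (0 : ℝ)) (b := 1)).prod
    (isCompact_Icc (a := -π) (b := π))).exists_bound_of_continuousOn h.cont_wy.continuousOn
  exact ⟨max 0 (max M₁ M₂), le_max_left _ _,
    fun s hs y hy => (hM₁ (s, y) ⟨hs, hy⟩).trans ((le_max_left _ _).trans (le_max_right _ _)),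
    fun s hs y hy => (hM₂ (s, y) ⟨hs, hy⟩).trans ((le_max_right _ _).trans (le_max_right _ _))⟩

lemma abs_tInt_le {F : ℝ → ℝ → ℝ} {M x y : ℝ} (hM : 0 ≤ M) (hx : x ∈ Ioo (0 : ℝ) 1)
    (hF : ∀ s ∈ Icc (0 : ℝ) 1, |F s y| ≤ M) : |tInt F x y| ≤ M * x ^ 2 := by
  have := abs_fracInt₂_fracInt₂_le zero_le_one hx.1 hM
    fun s hs => hF s ⟨hs.1.le, hs.2.trans hx.2.le⟩
  rw [one_add_one_eq_two, Real.Gamma_two, div_one, Real.rpow_one] at this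
  exact this

lemma abs_kInt_sub_le (h : ReducedSolution α κ c w wy wyy B) {M x y z : ℝ} (hM : 0 ≤ M)
    (hx : x ∈ Ioo (0 : ℝ) 1) (hwy : ∀ s ∈ Icc (0 : ℝ) 1, ∀ y ∈ Icc (-π) π, |wy s y| ≤ M)
    (hy : y ∈ Ioo (-π) π) (hz : z ∈ Ioo (-π) π) :
    |kInt α w x z - kInt α w x y| ≤ M * |z - y| * (x ^ (1 - α) / Real.Gamma (2 - α)) ^ 2 := by
  have := abs_fracInt₂_fracInt₂_sub_le (a := 1 - α) (by linarith [h.le_one]) hx.1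
    (M := M * |z - y|) (by positivity) h.cont (y := z) (y' := y) fun s hs =>
      (convex_Ioo (-π) π).norm_image_sub_le_of_norm_hasDerivWithin_le
        (fun t ht => (h.hasDerivAt s t ht).hasDerivWithinAt)
        (fun t ht => hwy s ⟨hs.1.le, hs.2.trans hx.2.le⟩ t (Ioo_subset_Icc_self ht)) hy hz
  rwa [show 1 - α + 1 = 2 - α by ring] at this

lemma mul_slope_sub (h : ReducedSolution α κ c w wy wyy B) {x y z : ℝ} (hx : x ∈ Ioo (0 : ℝ) 1)
    (hy : y ∈ Ioo (-π) π) (hz : z ∈ Ioo (-π) π) :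
    x * (h.slope z - h.slope y) = κ * (tInt wy x z - tInt wy x y)
      + ∫ t in y..z, (kInt α w x t - B t * x ^ (2 - α) - c ^ 2 * tInt w x t) := by
  have h1 := h.defect_eq hx hy
  have h2 := h.defect_eq hx hz
  have h3 := intervalIntegral.integral_add_adjacent_intervals
    (h.intervalIntegrable_integrand x zero_mem hy) (h.intervalIntegrable_integrand x hy hz)
  rw [defect] at h1 h2
  linear_combination h1 - h2 - h3

/-- In the second difference of `x · slope`, the `w_y` part is `O(x²)` and the integral compares the
integrand at points a distance `ρ` apart, giving terms `ρ² x^(2-2α)` and `ρ x^(2-α)`. With `x^α = ρ`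
both equal `x²`, and division by `x` leaves `O(ρ^(1/α))`. -/
lemma abs_slope_second_difference_le (h : ReducedSolution α κ c w wy wyy B) {r : ℝ}
    (hr : r < π) : ∃ C, 0 ≤ C ∧ ∀ ρ ∈ Ioo (0 : ℝ) 1, ∀ y, -r < y - ρ → y + ρ < r →
      |h.slope (y + ρ) + h.slope (y - ρ) - 2 * h.slope y| ≤ C * ρ ^ (1 / α) := by
  obtain ⟨M, hM0, hMw, hMwy⟩ := h.exists_bound
  obtain ⟨N, hN⟩ := (isCompact_Icc (a := -r) (b := r)).exists_bound_of_continuousOn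
    (h.continuousOn_B.mono fun y hy => ⟨by linarith [hy.1], hy.2.trans_lt hr⟩)
  have hα0 := h.pos
  have hκ := h.kappa_pos
  set C₁ := (1 / Real.Gamma (2 - α)) ^ 2 with hC₁
  have hN0' : 0 ≤ max N 0 := le_max_right _ _
  refine ⟨4 * κ * M + M * C₁ + 2 * max N 0 + 2 * c ^ 2 * M, by positivity,
    fun ρ hρ y hy1 hy2 => ?_⟩
  have hρ0 := hρ.1
  set x := ρ ^ (1 / α) with hxdef
  have hx : x ∈ Ioo (0 : ℝ) 1 := ⟨Real.rpow_pos_of_pos hρ0 _,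
    Real.rpow_lt_one hρ0.le hρ.2 (by positivity)⟩
  have hx0 := hx.1
  set q := x ^ (1 - α) with hq
  have hq0 : 0 < q := Real.rpow_pos_of_pos hx0 _
  have hxα : x ^ α = ρ := by
    rw [hxdef, ← Real.rpow_mul hρ0.le, one_div_mul_cancel hα0.ne', Real.rpow_one]
  have hρq : ρ * q = x := by
    rw [← hxα, hq, ← Real.rpow_add hx0, add_sub_cancel, Real.rpow_one]
  have hx2 : x ^ (2 - α) = q * x := by
    rw [hq, ← Real.rpow_add_one hx0.ne']
    congr 1
    ring
  have m1 : ∀ {t}, -r < t → t < r → t ∈ Ioo (-π) π := fun h1 h2 => ⟨by linarith, by linarith⟩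
  have my := m1 (t := y) (by linarith) (by linarith)
  have myp := m1 (t := y + ρ) (by linarith) (by linarith)
  have mym := m1 (t := y - ρ) (by linarith) (by linarith)
  set G := fun t => kInt α w x t - B t * x ^ (2 - α) - c ^ 2 * tInt w x t with hG
  have hTw : ∀ t ∈ Ioo (-π) π, |tInt w x t| ≤ M * x ^ 2 := fun t ht =>
    abs_tInt_le hM0 hx fun s hs => hMw s hs t (Ioo_subset_Icc_self ht)
  have hTwy : ∀ t ∈ Ioo (-π) π, |tInt wy x t| ≤ M * x ^ 2 := fun t ht =>
    abs_tInt_le hM0 hx fun s hs => hMwy s hs t (Ioo_subset_Icc_self ht)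
  have hB : ∀ t, -r < t → t < r → |B t| ≤ max N 0 := fun t h1 h2 =>
    (hN t ⟨h1.le, h2.le⟩).trans (le_max_left _ _)
  have hGdiff : ∀ t ∈ uIoc y (y + ρ), ‖G t - G (t - ρ)‖
      ≤ M * ρ * (q * q * C₁) + 2 * max N 0 * (q * x) + 2 * c ^ 2 * (M * x ^ 2) := by
    intro t ht
    rw [uIoc_of_le (by linarith)] at ht
    have t1 : -r < t := by linarith [ht.1]
    have t2 : t < r := by linarith [ht.2]
    have t3 : -r < t - ρ := by linarith [ht.1]
    have t4 : t - ρ < r := by linarith [ht.2]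
    have k1 := h.abs_kInt_sub_le hM0 hx hMwy (m1 t3 t4) (m1 t1 t2)
    rw [sub_sub_cancel, abs_of_pos hρ0] at k1
    have k1' : (x ^ (1 - α) / Real.Gamma (2 - α)) ^ 2 = q * q * C₁ := by
      rw [hC₁, ← hq]
      ring
    rw [k1'] at k1
    have e : G t - G (t - ρ) = (kInt α w x t - kInt α w x (t - ρ))
        + (B (t - ρ) * (q * x) - B t * (q * x))
        + (c ^ 2 * tInt w x (t - ρ) - c ^ 2 * tInt w x t) := by
      simp only [hG]
      rw [hx2]
      ring
    have hqx : 0 < q * x := by positivity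
    have b1 : |B (t - ρ) * (q * x) - B t * (q * x)| ≤ 2 * max N 0 * (q * x) := by
      rw [← sub_mul, abs_mul, abs_of_pos hqx]
      refine mul_le_mul_of_nonneg_right ?_ hqx.le
      refine (abs_sub _ _).trans ?_
      linarith [hB t t1 t2, hB (t - ρ) t3 t4]
    have c1 : |c ^ 2 * tInt w x (t - ρ) - c ^ 2 * tInt w x t| ≤ 2 * c ^ 2 * (M * x ^ 2) := by
      rw [← mul_sub, abs_mul, abs_of_nonneg (sq_nonneg c), mul_comm 2, mul_assoc]
      refine mul_le_mul_of_nonneg_left ?_ (sq_nonneg c)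
      refine (abs_sub _ _).trans ?_
      linarith [hTw t (m1 t1 t2), hTw (t - ρ) (m1 t3 t4)]
    rw [e, Real.norm_eq_abs]
    refine (abs_add_three _ _ _).trans ?_
    linarith
  have i1 := h.mul_slope_sub hx my myp
  have i2 := h.mul_slope_sub hx mym my
  have i3 : ∫ t in (y - ρ)..y, G t = ∫ t in y..(y + ρ), G (t - ρ) := by
    rw [intervalIntegral.integral_comp_sub_right (fun t => G t), add_sub_cancel_right]
  have i4 : IntervalIntegrable (fun t => G (t - ρ)) volume y (y + ρ) := by
    have := (h.intervalIntegrable_integrand x mym my).comp_sub_right ρ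
    rwa [sub_add_cancel] at this
  have i5 := h.intervalIntegrable_integrand x my myp
  have i6 : (∫ t in y..(y + ρ), G t) - ∫ t in (y - ρ)..y, G t
      = ∫ t in y..(y + ρ), (G t - G (t - ρ)) := by
    rw [i3, intervalIntegral.integral_sub i5 i4]
  have i7 := intervalIntegral.norm_integral_le_of_norm_le_const hGdiff
  rw [← i6, add_sub_cancel_left, abs_of_pos hρ0, Real.norm_eq_abs] at i7
  have tot : x * (h.slope (y + ρ) + h.slope (y - ρ) - 2 * h.slope y)
      = κ * (tInt wy x (y + ρ) + tInt wy x (y - ρ) - 2 * tInt wy x y)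
        + ((∫ t in y..(y + ρ), G t) - ∫ t in (y - ρ)..y, G t) := by
    linear_combination i1 - i2
  have j1 : |κ * (tInt wy x (y + ρ) + tInt wy x (y - ρ) - 2 * tInt wy x y)|
      ≤ κ * (4 * (M * x ^ 2)) := by
    rw [abs_mul, abs_of_pos hκ]
    refine mul_le_mul_of_nonneg_left ?_ hκ.le
    have := abs_le.1 (hTwy _ my)
    have := abs_le.1 (hTwy _ myp)
    have := abs_le.1 (hTwy _ mym)
    rw [abs_le]
    constructor <;> linarith
  have j2 : (M * ρ * (q * q * C₁) + 2 * max N 0 * (q * x) + 2 * c ^ 2 * (M * x ^ 2)) * ρ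
      ≤ (M * C₁ + 2 * max N 0 + 2 * c ^ 2 * M) * x ^ 2 := by
    have e1 : (M * ρ * (q * q * C₁) + 2 * max N 0 * (q * x) + 2 * c ^ 2 * (M * x ^ 2)) * ρ
        = M * C₁ * x ^ 2 + 2 * max N 0 * x ^ 2 + 2 * c ^ 2 * M * x ^ 2 * ρ := by
      linear_combination (M * C₁ * (ρ * q + x) + 2 * max N 0 * x) * hρq
    have e2 : 2 * c ^ 2 * M * x ^ 2 * ρ ≤ 2 * c ^ 2 * M * x ^ 2 :=
      mul_le_of_le_one_right (by positivity) hρ.2.le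
    rw [e1]
    linarith
  have fin : x * |h.slope (y + ρ) + h.slope (y - ρ) - 2 * h.slope y|
      ≤ x * ((4 * κ * M + M * C₁ + 2 * max N 0 + 2 * c ^ 2 * M) * x) := by
    rw [← abs_of_pos hx0, ← abs_mul, abs_of_pos hx0, tot]
    refine (abs_add_le _ _).trans ?_
    nlinarith [j1, j2, i7]
  exact le_of_mul_le_mul_left fin hx0

/-- For each fixed `y` the quantity `(kInt - B x^(2-α))/x` tends to `0`, but integrating this in `y`
requires uniformity. Baire's theorem supplies it locally near a dense set of points. -/
lemma exists_abs_slope_sub_le (h : ReducedSolution α κ c w wy wyy B) (hα : α < 1) {η a b : ℝ}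
    (hη : 0 < η) (ha : -π < a) (hab : a < b) (hb : b < π) :
    ∃ y ∈ Ioo a b, ∀ᶠ z in 𝓝 y, |h.slope z - h.slope y| ≤ η * |z - y| := by
  obtain ⟨M, hM0, hMw, hMwy⟩ := h.exists_bound
  have hκ := h.kappa_pos
  have mem : ∀ t ∈ Icc a b, t ∈ Ioo (-π) π := fun t ht =>
    ⟨ha.trans_le ht.1, ht.2.trans_lt hb⟩
  set A : ℝ → ℝ → ℝ := fun x t => kInt α w x t - B t * x ^ (2 - α) with hA
  -- The closed sets on which the bound `η x` already holds for all `x < 1/(n+1)`; by the pointwise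
  -- limit they cover the line. The clamp makes them sets of reals on which `B` is evaluated only in
  -- `[a, b]`.
  set E : ℕ → Set ℝ := fun n =>
    {t | ∀ x ∈ Ioo (0 : ℝ) (1 / ((n : ℝ) + 1)), |A x (clamp a b t)| ≤ η * x} with hE
  have hclosed : ∀ n, IsClosed (E n) := by
    intro n
    simp only [hE, ofPred_forall]
    refine isClosed_iInter fun x => isClosed_iInter fun _ => isClosed_le ?_ continuous_const
    have c1 : Continuous fun t => kInt α w x (clamp a b t) :=
      (continuous_right h.continuous_kInt x).comp (continuous_clamp a b)
    have c2 : Continuous fun t => B (clamp a b t) :=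
      h.continuousOn_B.comp_continuous (continuous_clamp a b)
        fun t => mem _ (clamp_mem hab.le t)
    exact (c1.sub (c2.mul continuous_const)).abs
  have huniv : ⋃ n, E n = univ := by
    rw [eq_univ_iff_forall]
    intro t
    have hev := (h.tendsto hα _ (mem _ (clamp_mem hab.le t))).eventually
      (Metric.ball_mem_nhds 0 hη)
    obtain ⟨d, hd, hd'⟩ := mem_nhdsGT_iff_exists_Ioo_subset.1 hev
    obtain ⟨n, hn⟩ := exists_nat_one_div_lt (mem_Ioi.1 hd)
    refine mem_iUnion.2 ⟨n, fun x hx => ?_⟩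
    have h1 := hd' ⟨hx.1, hx.2.trans hn⟩
    rw [mem_ofPred_eq, dist_zero_right, norm_div, Real.norm_of_nonneg hx.1.le,
      div_lt_iff₀ hx.1] at h1
    exact h1.le
  obtain ⟨y, hy, hyE⟩ := (dense_iUnion_interior_of_closed hclosed huniv).inter_open_nonempty
    (Ioo a b) isOpen_Ioo (nonempty_Ioo.2 hab)
  obtain ⟨n, hyn⟩ := mem_iUnion.1 hyE
  refine ⟨y, hy, ?_⟩
  obtain ⟨d, hd, hball⟩ := Metric.mem_nhds_iff.1
    (inter_mem (isOpen_interior.mem_nhds hyn) (Ioo_mem_nhds hy.1 hy.2))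
  filter_upwards [Metric.ball_mem_nhds y hd] with z hz
  have hseg : ∀ t ∈ uIcc y z, t ∈ E n ∧ t ∈ Ioo a b := fun t ht => by
    have h1 : t ∈ Metric.ball y d := (convex_ball y d).ordConnected.uIcc_subset
      (Metric.mem_ball_self hd) hz ht
    have h2 := hball h1
    exact ⟨interior_subset h2.1, h2.2⟩
  have hzm : z ∈ Ioo a b := (hseg z right_mem_uIcc).2
  have my := mem y (Ioo_subset_Icc_self hy)
  have mz := mem z (Ioo_subset_Icc_self hzm)
  have hn0 : (0 : ℝ) < 1 / ((n : ℝ) + 1) := by positivity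
  -- Between `y` and `z` the integrand is at most `η x + O(x²)` and the `w_y` terms are `O(x²)`.
  -- After division by `x`, letting `x → 0` leaves `η |z - y|`.
  have est : ∀ x ∈ Ioo (0 : ℝ) (min 1 (1 / ((n : ℝ) + 1))),
      |h.slope z - h.slope y| ≤ η * |z - y| + (2 * κ * M + c ^ 2 * M * |z - y|) * x := by
    intro x hx
    have hx0 := hx.1
    have hx1 : x ∈ Ioo (0 : ℝ) 1 := ⟨hx0, hx.2.trans_le (min_le_left _ _)⟩
    have hx2 : x ∈ Ioo (0 : ℝ) (1 / ((n : ℝ) + 1)) := ⟨hx0, hx.2.trans_le (min_le_right _ _)⟩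
    have hG : ∀ t ∈ uIoc y z, ‖kInt α w x t - B t * x ^ (2 - α) - c ^ 2 * tInt w x t‖
        ≤ η * x + c ^ 2 * (M * x ^ 2) := by
      intro t ht
      obtain ⟨h1, h2⟩ := hseg t (uIoc_subset_uIcc ht)
      have h3 := h1 x hx2
      rw [clamp_of_mem (Ioo_subset_Icc_self h2)] at h3
      have h4 : |tInt w x t| ≤ M * x ^ 2 := abs_tInt_le hM0 hx1 fun s hs =>
        hMw s hs t (Ioo_subset_Icc_self (mem t (Ioo_subset_Icc_self h2)))
      refine (norm_sub_le _ _).trans (add_le_add h3 ?_)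
      rw [norm_mul, Real.norm_of_nonneg (sq_nonneg c)]
      exact mul_le_mul_of_nonneg_left h4 (sq_nonneg c)
    have h5 := intervalIntegral.norm_integral_le_of_norm_le_const hG
    rw [Real.norm_eq_abs] at h5
    have h6 : |κ * (tInt wy x z - tInt wy x y)| ≤ κ * (2 * (M * x ^ 2)) := by
      rw [abs_mul, abs_of_pos hκ]
      refine mul_le_mul_of_nonneg_left ((abs_sub _ _).trans ?_) hκ.le
      have k1 : |tInt wy x z| ≤ M * x ^ 2 := abs_tInt_le hM0 hx1 fun s hs =>
        hMwy s hs z (Ioo_subset_Icc_self mz)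
      have k2 : |tInt wy x y| ≤ M * x ^ 2 := abs_tInt_le hM0 hx1 fun s hs =>
        hMwy s hs y (Ioo_subset_Icc_self my)
      linarith
    have h7 : x * |h.slope z - h.slope y|
        ≤ x * (η * |z - y| + (2 * κ * M + c ^ 2 * M * |z - y|) * x) := by
      rw [← abs_of_pos hx0, ← abs_mul, abs_of_pos hx0, h.mul_slope_sub hx1 my mz]
      refine (abs_add_le _ _).trans ?_
      linarith
    exact le_of_mul_le_mul_left h7 hx0
  have hc : Continuous fun x : ℝ => η * |z - y| + (2 * κ * M + c ^ 2 * M * |z - y|) * x := by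
    fun_prop
  have hlim : Tendsto (fun x : ℝ => η * |z - y| + (2 * κ * M + c ^ 2 * M * |z - y|) * x) (𝓝[>] 0)
      (𝓝 (η * |z - y|)) := by
    have := hc.tendsto 0
    rw [mul_zero, add_zero] at this
    exact this.mono_left nhdsWithin_le_nhds
  refine ge_of_tendsto hlim ?_
  filter_upwards [Ioo_mem_nhdsGT (lt_min one_pos hn0)] with x hx
  exact est x hx

lemma continuous_integral_sub (h : ReducedSolution α κ c w wy wyy B) (x : ℝ) :
    Continuous fun y => ∫ t in (0 : ℝ)..y, (kInt α w x t - c ^ 2 * tInt w x t) := by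
  have hK := continuous_right h.continuous_kInt x
  have hT := continuous_right h.continuous_tInt x
  have hc : Continuous fun t => kInt α w x t - c ^ 2 * tInt w x t := by fun_prop
  exact intervalIntegral.continuous_primitive (fun a b => hc.intervalIntegrable a b) 0

lemma continuousOn_slope (h : ReducedSolution α κ c w wy wyy B) :
    ContinuousOn h.slope (Ioo (-π) π) := by
  have hB : ContinuousOn (fun y => ∫ t in (0 : ℝ)..y, B t) (Ioo (-π) π) := by
    intro y hy
    exact (intervalIntegral.integral_hasDerivAt_right
      (h.continuousOn_B.mono (uIcc_subset_Ioo_pi zero_mem hy)).intervalIntegrable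
      (h.continuousOn_B.stronglyMeasurableAtFilter isOpen_Ioo y hy)
      (h.continuousOn_B.continuousAt (Ioo_mem_nhds hy.1 hy.2))).continuousAt.continuousWithinAt
  have hdef : ∀ x, ContinuousOn (h.defect x) (Ioo (-π) π) := by
    intro x
    have h1 := (h.continuous_integral_sub x).continuousOn (s := Ioo (-π) π)
    have h2 := (continuous_right h.continuous_tInt_wy x).continuousOn (s := Ioo (-π) π)
    refine ContinuousOn.congr (f := fun y => κ * (tInt wy x y - tInt wy x 0)
      + ((∫ t in (0 : ℝ)..y, (kInt α w x t - c ^ 2 * tInt w x t))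
        - x ^ (2 - α) * ∫ t in (0 : ℝ)..y, B t)) (by fun_prop) fun y hy => ?_
    rw [defect, h.integral_integrand x zero_mem hy]
  exact continuousOn_const.mul ((hdef _).sub (hdef _))

/-- Because `1/α > 1`, the second-difference bound and the dense small quotients force the slope to
be constant on each `(-r, r)`; it vanishes at `y = 0` by construction. -/
lemma slope_eq_zero (h : ReducedSolution α κ c w wy wyy B) (hα : α < 1) {y : ℝ}
    (hy : y ∈ Ioo (-π) π) : h.slope y = 0 := by
  have h0 : h.slope 0 = 0 := by simp [slope, defect]
  obtain ⟨r, hr1, hr2⟩ := exists_between (max_lt (abs_lt.2 hy) Real.pi_pos)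
  obtain ⟨hyr, hr0⟩ := max_lt_iff.1 hr1
  rw [abs_lt] at hyr
  obtain ⟨C, hC, hC2⟩ := h.abs_slope_second_difference_le hr2
  have hs : 1 < 1 / α := (one_lt_div h.pos).2 hα
  have hcont : ContinuousOn h.slope (Ioo (-r) r) :=
    h.continuousOn_slope.mono (Ioo_subset_Ioo (by linarith) hr2.le)
  have hd : ∀ η > 0, ∀ a b, -r < a → a < b → b < r →
      ∃ y ∈ Ioo a b, ∀ᶠ z in 𝓝 y, |h.slope z - h.slope y| ≤ η * |z - y| :=
    fun η hη a b ha hab hb => h.exists_abs_slope_sub_le hα hη (by linarith) hab (by linarith)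
  rcases le_total 0 y with hy0 | hy0
  · rw [eq_of_second_difference hs hC hcont hC2 hd (by linarith) hy0 hyr.2, h0]
  · rw [← eq_of_second_difference hs hC hcont hC2 hd hyr.1 hy0 hr0, h0]

/-- The equation, integrated twice in `x` and once in `y`, up to the boundary. -/
lemma exists_integrated_equation (h : ReducedSolution α κ c w wy wyy B) :
    ∃ P : ℝ → ℝ, Continuous P ∧ ∀ x ∈ Ioo (0 : ℝ) 1, ∀ y ∈ Icc (-π) π,
      κ * (tInt wy x y - tInt wy x 0) + ∫ t in (0 : ℝ)..y, (kInt α w x t - c ^ 2 * tInt w x t)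
        = x ^ (2 - α) * P y := by
  set H : ℝ → ℝ → ℝ := fun x y => κ * (tInt wy x y - tInt wy x 0)
    + ∫ t in (0 : ℝ)..y, (kInt α w x t - c ^ 2 * tInt w x t) with hH
  have hHc : ∀ x, Continuous (H x) := fun x => by
    have h1 := h.continuous_integral_sub x
    have h2 := continuous_right h.continuous_tInt_wy x
    fun_prop
  have key : ∀ y ∈ Ioo (-π) π, ∃ Q, ∀ x ∈ Ioo (0 : ℝ) 1, H x y = x ^ (2 - α) * Q := by
    intro y hy
    have e : ∀ x ∈ Ioo (0 : ℝ) 1, H x y = x * h.slope y + x ^ (2 - α) * ∫ t in (0 : ℝ)..y, B t := by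
      intro x hx
      rw [← h.defect_eq hx hy, defect, h.integral_integrand x zero_mem hy]
      ring
    rcases h.le_one.eq_or_lt with h1 | h1
    -- For `α = 1` the slope need not vanish: `x = x^(2-α)`, so it has the allowed form.
    · refine ⟨h.slope y, fun x hx => ?_⟩
      rw [e x hx]
      simp only [h.eq_zero_of_eq_one h1, intervalIntegral.integral_zero, mul_zero, add_zero]
      rw [show 2 - α = 1 by linarith, Real.rpow_one]
    · refine ⟨∫ t in (0 : ℝ)..y, B t, fun x hx => ?_⟩
      rw [e x hx, h.slope_eq_zero h1 hy]
      ring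
  have half : (1 / 2 : ℝ) ∈ Ioo (0 : ℝ) 1 := by constructor <;> norm_num
  have hh : (0 : ℝ) < (1 / 2) ^ (2 - α) := Real.rpow_pos_of_pos (by norm_num) _
  -- Reading `P` off at `x = 1/2` makes it continuous everywhere, whereas `B` is not controlled near
  -- `y = ±π`. The identity then passes to the closed interval by closure.
  refine ⟨fun y => H (1 / 2) y / (1 / 2) ^ (2 - α), (hHc _).div_const _, fun x hx => ?_⟩
  have hclos := EqOn.closure (s := Ioo (-π) π) (f := H x)
    (g := fun y => x ^ (2 - α) * (H (1 / 2) y / (1 / 2) ^ (2 - α))) (fun y hy => by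
      obtain ⟨Q, hQ⟩ := key y hy
      simp only
      rw [hQ x hx, hQ _ half, mul_div_cancel_left₀ _ hh.ne'])
    (hHc x) (continuous_const.mul ((hHc _).div_const _))
  rw [closure_Ioo (by linarith [Real.pi_pos])] at hclos
  exact hclos

lemma tInt_eq_zero {F : ℝ → ℝ → ℝ} {x y : ℝ} (hx : 0 < x) (hF : ∀ s, F s y = 0) :
    tInt F x y = 0 := by
  have h := abs_fracInt₂_fracInt₂_le (a := 1) (M := 0) (F := F) (y := y) zero_le_one hx le_rfl
    fun s _ => by rw [hF s, abs_zero]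
  rw [zero_mul] at h
  exact abs_eq_zero.1 (le_antisymm h (abs_nonneg _))

lemma integral_tInt_wy_mul (h : ReducedSolution α κ c w wy wyy B) (i : ℕ ⊕ ℕ) {x : ℝ}
    (hx : 0 < x) :
    ∫ y in (-π)..π, tInt wy x y * modeConj i y
      = modeFreq i * ∫ y in (-π)..π, tInt w x y * modeFun i y := by
  have hT := continuous_right h.continuous_tInt x
  have hTy := continuous_right h.continuous_tInt_wy x
  have hX := continuous_modeFun i
  have hY := continuous_modeConj i
  have hd : ∀ y ∈ Ioo (-π) π, HasDerivAt (tInt w x) (tInt wy x y) y := fun y hy =>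
    hasDerivAt_fracInt₂ zero_le_one hx (continuous_fracInt₂ zero_le_one h.cont)
      (continuous_fracInt₂ zero_le_one h.cont_wy)
      (fun s hs y hy => hasDerivAt_fracInt₂ zero_le_one hs.1 h.cont h.cont_wy
        (fun t _ y hy => h.hasDerivAt t y hy) hy) hy
  have c1 : Continuous fun y => tInt wy x y * modeConj i y := by fun_prop
  have c2 : Continuous fun y => tInt w x y * modeFun i y := by fun_prop
  have c3 : Continuous fun y => tInt w x y * modeConj i y := by fun_prop
  have key := intervalIntegral.integral_eq_sub_of_hasDerivAt_of_le neg_pi_le_pi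
    (f := fun y => tInt w x y * modeConj i y)
    (f' := fun y => tInt wy x y * modeConj i y - modeFreq i * (tInt w x y * modeFun i y))
    c3.continuousOn (fun y hy => ((hd y hy).mul (hasDerivAt_modeConj i y)).congr_deriv (by ring))
    ((c1.intervalIntegrable _ _).sub ((c2.intervalIntegrable _ _).const_mul _))
  rw [intervalIntegral.integral_sub (c1.intervalIntegrable _ _)
    ((c2.intervalIntegrable _ _).const_mul _), intervalIntegral.integral_const_mul, modeConj_pi,
    modeConj_neg_pi, mul_zero, mul_zero, sub_zero] at key
  linarith

/-- The equation for the Fourier coefficients. -/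
lemma exists_mode_equation (h : ReducedSolution α κ c w wy wyy B) (i : ℕ ⊕ ℕ) :
    ∃ β : ℝ, ∀ x ∈ Ioo (0 : ℝ) 1, ∫ y in (-π)..π, kInt α w x y * modeFun i y
      = β * x ^ (2 - α)
        + (κ * modeFreq i ^ 2 + c ^ 2) * ∫ y in (-π)..π, tInt w x y * modeFun i y := by
  obtain ⟨P, hPc, hP⟩ := h.exists_integrated_equation
  -- All that depends on the unknown `P` is proportional to `x^(2-α)`, so its projection is a single
  -- constant times that power.
  refine ⟨P π * modeFun i π - P (-π) * modeFun i (-π)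
    - modeFreq i * ∫ y in (-π)..π, P y * modeConj i y, fun x hx => ?_⟩
  set ω := modeFreq i
  set X := modeFun i
  set Y := modeConj i
  have hT := continuous_right h.continuous_tInt x
  have hTy := continuous_right h.continuous_tInt_wy x
  have hK := continuous_right h.continuous_kInt x
  have hX : Continuous X := continuous_modeFun i
  have hY : Continuous Y := continuous_modeConj i
  have hXd : ∀ y, HasDerivAt X (ω * Y y) y := hasDerivAt_modeFun i
  have hg : Continuous fun t => kInt α w x t - c ^ 2 * tInt w x t := by fun_prop
  set J : ℝ → ℝ := fun y => ∫ t in (0 : ℝ)..y, (kInt α w x t - c ^ 2 * tInt w x t) with hJ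
  have hJd : ∀ y, HasDerivAt J (kInt α w x y - c ^ 2 * tInt w x y) y := fun y =>
    intervalIntegral.integral_hasDerivAt_right (hg.intervalIntegrable _ _)
      hg.stronglyMeasurable.stronglyMeasurableAtFilter hg.continuousAt
  have hJc : Continuous J := h.continuous_integral_sub x
  have ii : ∀ {f : ℝ → ℝ} (_ : Continuous f), IntervalIntegrable f volume (-π) π :=
    fun hf => hf.intervalIntegrable _ _
  have k1 : (∫ y in (-π)..π, (kInt α w x y - c ^ 2 * tInt w x y) * X y)
      + ω * ∫ y in (-π)..π, J y * Y y = J π * X π - J (-π) * X (-π) := by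
    rw [← intervalIntegral.integral_const_mul, ← intervalIntegral.integral_add
      (ii (by fun_prop)) (ii (by fun_prop))]
    refine intervalIntegral.integral_eq_sub_of_hasDerivAt (f := fun y => J y * X y)
      (fun y _ => ((hJd y).mul (hXd y)).congr_deriv (by ring)) (ii (by fun_prop))
  have k2 : ω * ∫ y in (-π)..π, Y y = X π - X (-π) := by
    rw [← intervalIntegral.integral_const_mul]
    exact intervalIntegral.integral_eq_sub_of_hasDerivAt (fun y _ => hXd y) (ii (by fun_prop))
  have k3 : ∫ y in (-π)..π, J y * Y y = x ^ (2 - α) * (∫ y in (-π)..π, P y * Y y)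
      - κ * (∫ y in (-π)..π, tInt wy x y * Y y) + κ * tInt wy x 0 * ∫ y in (-π)..π, Y y := by
    rw [← intervalIntegral.integral_const_mul, ← intervalIntegral.integral_const_mul,
      ← intervalIntegral.integral_const_mul, ← intervalIntegral.integral_sub
      (ii (by fun_prop)) (ii (by fun_prop)), ← intervalIntegral.integral_add
      (ii (by fun_prop)) (ii (by fun_prop))]
    refine intervalIntegral.integral_congr fun y hy => ?_
    rw [uIcc_of_le neg_pi_le_pi] at hy
    linear_combination Y y * hP x hx y hy
  have k4 := h.integral_tInt_wy_mul i hx.1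
  have k5 : ∫ y in (-π)..π, (kInt α w x y - c ^ 2 * tInt w x y) * X y
      = (∫ y in (-π)..π, kInt α w x y * X y) - c ^ 2 * ∫ y in (-π)..π, tInt w x y * X y := by
    rw [← intervalIntegral.integral_const_mul, ← intervalIntegral.integral_sub
      (ii (by fun_prop)) (ii (by fun_prop))]
    congr 1
    ext y
    ring
  -- The Neumann condition removes `w_y` at `±π`, which evaluates the boundary terms `J(±π)`. The
  -- leftover value of `tInt wy` at `y = 0` cancels through `k2`.
  have k6 := hP x hx π ⟨neg_pi_le_pi, le_rfl⟩
  have k7 := hP x hx (-π) ⟨le_rfl, neg_pi_le_pi⟩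
  rw [tInt_eq_zero hx.1 h.top] at k6
  rw [tInt_eq_zero hx.1 h.bottom] at k7
  rw [k5, k3, k4] at k1
  linear_combination k1 + X π * k6 - X (-π) * k7 - κ * tInt wy x 0 * k2

/-- Each mode coefficient of `w` is continuous in `x`, vanishes at `x = 1` and solves the fractional
equation with one free constant, so it is zero; completeness finishes. -/
lemma eq_zero (h : ReducedSolution α κ c w wy wyy B) :
    ∀ x ∈ Ioo (0 : ℝ) 1, ∀ y ∈ Icc (-π) π, w x y = 0 := by
  have hα' : 0 ≤ 1 - α := by linarith [h.le_one]
  intro x hx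
  refine eq_zero_of_integral_modeFun (continuous_right h.cont x).continuousOn fun i => ?_
  have hF : Continuous (Function.uncurry fun s y => w s y * modeFun i y) :=
    h.cont.mul ((continuous_modeFun i).comp continuous_snd)
  have hiter : ∀ a, fracInt₂ a (fracInt₂ a fun s y => w s y * modeFun i y)
      = fun s y => fracInt₂ a (fracInt₂ a w) s y * modeFun i y := by
    intro a
    have e : ∀ G : ℝ → ℝ → ℝ, fracInt₂ a (fun s y => G s y * modeFun i y)
        = fun s y => fracInt₂ a G s y * modeFun i y := fun G => by
      ext s y
      exact fracInt₂_mul_right a G _ s y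
    rw [e, e]
  obtain ⟨β, hβ⟩ := h.exists_mode_equation i
  have hκ := h.kappa_pos
  refine eq_zero_of_fracInt_eq_add (β := β) (m := κ * modeFreq i ^ 2 + c ^ 2) h.pos h.le_one
    (by positivity) (f := fun s => ∫ y in (-π)..π, w s y * modeFun i y)
    (intervalIntegral.continuous_parametric_intervalIntegral_of_continuous' hF _ _) ?_ ?_ x hx
  · simp [h.right]
  · intro x hx
    rw [fracInt_fracInt_integral hα' hα' hx.1 hF, fracInt_fracInt_integral zero_le_one zero_le_one
      hx.1 hF, hiter, hiter]
    exact hβ x hx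

end ReducedSolution

/-! ### From two solutions of Problem N to the reduced problem -/

section Uniqueness

open Filter Topology

/-- `h` is the second derivative of `J^(1-α) J^(1-α) f - B x ^ (2 - α)` on `(0, 1)`, in integrated
form, together with the behaviour of the latter at `0`. -/
structure IsPrimitivePair (α : ℝ) (f h : ℝ → ℝ) (B : ℝ) : Prop where
  cont : Continuous f
  contOn : ContinuousOn h (Ioo 0 1)
  secDiff_eq : ∀ x ∈ Ioo (0 : ℝ) 1,
    secDiff (fun s => fracInt (1 - α) (fracInt (1 - α) f) s - B * s ^ (2 - α)) x = secInt h x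
  tendsto : α < 1 → Tendsto (fun x => (fracInt (1 - α) (fracInt (1 - α) f) x
    - B * x ^ (2 - α)) / x) (𝓝[>] 0) (𝓝 0)
  eq_zero_of_eq_one : α = 1 → B = 0

lemma fracInt_fracInt_linear {a x : ℝ} (ha : 0 ≤ a) (hx : 0 < x) {f g : ℝ → ℝ} (hf : Continuous f)
    (hg : Continuous g) (p q : ℝ) :
    fracInt a (fracInt a fun s => p * f s + q * g s) x
      = p * fracInt a (fracInt a f) x + q * fracInt a (fracInt a g) x := by
  rw [← fracInt_max_congr ha hx a f, ← fracInt_max_congr ha hx a g,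
    ← fracInt_linear ha (continuous_fracInt_max ha hf) (continuous_fracInt_max ha hg)]
  refine fracInt_congr ha hx fun s hs => ?_
  rw [max_eq_left hs.1.le, fracInt_linear ha hf hg]

lemma IsPrimitivePair.linear {α : ℝ} (hα : α ≤ 1) {f h g k : ℝ → ℝ} {B C : ℝ}
    (hf : IsPrimitivePair α f h B) (hg : IsPrimitivePair α g k C) (p q : ℝ) :
    IsPrimitivePair α (fun s => p * f s + q * g s) (fun s => p * h s + q * k s)
      (p * B + q * C) where
  cont := by
    have := hf.cont
    have := hg.cont
    fun_prop
  contOn := by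
    have := hf.contOn
    have := hg.contOn
    fun_prop
  secDiff_eq x hx := by
    rw [secInt_linear hf.contOn hg.contOn p q hx, ← hf.secDiff_eq x hx, ← hg.secDiff_eq x hx]
    have e : ∀ s ∈ Ioo (0 : ℝ) 1, fracInt (1 - α) (fracInt (1 - α) fun s => p * f s + q * g s) s
        = p * fracInt (1 - α) (fracInt (1 - α) f) s + q * fracInt (1 - α) (fracInt (1 - α) g) s :=
      fun s hs => fracInt_fracInt_linear (by linarith) hs.1 hf.cont hg.cont p q
    simp only [secDiff]
    rw [e x hx, e _ quarter_mem, e _ three_quarters_mem]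
    ring
  tendsto h := by
    have ht := ((hf.tendsto h).const_mul p).add ((hg.tendsto h).const_mul q)
    rw [mul_zero, mul_zero, add_zero] at ht
    refine ht.congr' ?_
    filter_upwards [self_mem_nhdsWithin] with x hx
    rw [fracInt_fracInt_linear (by linarith) hx hf.cont hg.cont]
    ring
  eq_zero_of_eq_one h := by
    rw [hf.eq_zero_of_eq_one h, hg.eq_zero_of_eq_one h]
    ring

/-- The values of `v` at the nearest point of the closed rectangle. -/
noncomputable def clampFun (v : ℝ → ℝ → ℝ) (x y : ℝ) : ℝ := v (clamp 0 1 x) (clamp (-π) π y)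

lemma continuous_clampFun {v : ℝ → ℝ → ℝ}
    (hv : ContinuousOn (fun p : ℝ × ℝ => v p.1 p.2) OmegaBar) :
    Continuous (Function.uncurry (clampFun v)) :=
  hv.comp_continuous (f := fun p : ℝ × ℝ => (clamp 0 1 p.1, clamp (-π) π p.2))
    (((continuous_clamp _ _).comp continuous_fst).prodMk
      ((continuous_clamp _ _).comp continuous_snd))
    fun p => ⟨clamp_mem zero_le_one p.1, clamp_mem neg_pi_le_pi p.2⟩

lemma clampFun_of_mem (v : ℝ → ℝ → ℝ) {x y : ℝ} (hx : x ∈ Icc (0 : ℝ) 1) (hy : y ∈ Icc (-π) π) :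
    clampFun v x y = v x y := by
  rw [clampFun, clamp_of_mem hx, clamp_of_mem hy]

variable {α ε c : ℝ} {φ ψ : ℝ → ℝ} {u v : ℝ → ℝ → ℝ}

lemma IsSolutionN.hasDerivAt_clampFun (hv : IsSolutionN α ε c φ ψ v) (x : ℝ) {y : ℝ}
    (hy : y ∈ Ioo (-π) π) : HasDerivAt (clampFun v x) (clampFun (uyBar v) x y) y := by
  have hx := clamp_mem zero_le_one x
  have h1 : HasDerivAt (v (clamp 0 1 x)) (uyBar v (clamp 0 1 x) y) y :=
    (hv.uy_exists (clamp 0 1 x, y) ⟨hx, Ioo_subset_Icc_self hy⟩).hasDerivWithinAt.hasDerivAt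
      (Icc_mem_nhds hy.1 hy.2)
  rw [clampFun, clamp_of_mem (Ioo_subset_Icc_self hy)]
  refine h1.congr_of_eventuallyEq ?_
  filter_upwards [Ioo_mem_nhds hy.1 hy.2] with z hz
  rw [clampFun, clamp_of_mem (Ioo_subset_Icc_self hz)]

lemma IsSolutionN.hasDerivAt_clampFun_uyBar (hv : IsSolutionN α ε c φ ψ v) {x y : ℝ}
    (hx : x ∈ Ioo (0 : ℝ) 1) (hy : y ∈ Ioo (-π) π) :
    HasDerivAt (clampFun (uyBar v) x) (uyy v x y) y := by
  refine (hv.regular.uyy_exists (x, y) ⟨hx, hy⟩).hasDerivAt.congr_of_eventuallyEq ?_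
  filter_upwards [Ioo_mem_nhds hy.1 hy.2] with z hz
  rw [clampFun_of_mem _ (Ioo_subset_Icc_self hx) (Ioo_subset_Icc_self hz), uyBar,
    derivWithin_of_mem_nhds (Icc_mem_nhds hz.1 hz.2)]

/-- The constant is chosen separately for each `y`; its continuity is recovered later from the
equation itself. -/
lemma IsSolutionN.exists_isPrimitivePair (hα0 : 0 < α) (hα1 : α ≤ 1)
    (hv : IsSolutionN α ε c φ ψ v) : ∃ B : ℝ → ℝ, (α = 1 → ∀ y, B y = 0) ∧ ∀ y ∈ Ioo (-π) π,
      IsPrimitivePair α (fun s => clampFun v s y - clampFun v 0 y)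
        (fun s => dx α (dx α v) s y) (B y) := by
  have hr := hv.regular
  have hα' : 0 ≤ 1 - α := by linarith
  have key : ∀ y, ∃ B : ℝ, (α = 1 → B = 0) ∧ (y ∈ Ioo (-π) π →
      IsPrimitivePair α (fun s => clampFun v s y - clampFun v 0 y)
        (fun s => dx α (dx α v) s y) B) := by
    intro y
    by_cases hy : y ∈ Ioo (-π) π
    swap
    · exact ⟨0, fun _ => rfl, fun h => absurd h hy⟩
    have hy' := Ioo_subset_Icc_self hy
    have hcont : ContinuousOn (fun x => v x y) (Icc 0 1) :=
      hr.continuousOn.comp (f := fun x : ℝ => (x, y)) (by fun_prop) fun x hx => ⟨hx, hy'⟩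
    have hcc : ContinuousOn (fun x => dx α (dx α v) x y) (Ioo 0 1) :=
      hr.dxdx_continuousOn.comp (f := fun x : ℝ => (x, y)) (by fun_prop) fun x hx => ⟨hx, hy⟩
    obtain ⟨B, h1, h2, h3⟩ := exists_secDiff_eq_secInt hα0 hα1 hcont (hr.dx_exists y hy)
      (hr.dxdx_exists y hy) hcc
    have e : ∀ x ∈ Ioo (0 : ℝ) 1,
        fracInt (1 - α) (fracInt (1 - α) fun s => clampFun v s y - clampFun v 0 y) x
          = fracInt (1 - α) (fracInt (1 - α) fun s => v s y - v 0 y) x := fun x hx =>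
      fracInt_congr hα' hx.1 fun s hs => fracInt_congr hα' hs.1 fun t ht => by
        rw [clampFun_of_mem v ⟨ht.1.le, ht.2.trans (hs.2.trans hx.2.le)⟩ hy',
          clampFun_of_mem v ⟨le_rfl, zero_le_one⟩ hy']
    refine ⟨B, h3, fun _ => ⟨?_, hcc, fun x hx => ?_, fun h => ?_, h3⟩⟩
    · exact (continuous_left (continuous_clampFun hr.continuousOn) y).sub continuous_const
    · refine Eq.trans (secDiff_congr hx fun s hs => ?_) (h1 x hx)
      rw [e s hs]
    · refine (h2 h).congr' ?_
      filter_upwards [Ioo_mem_nhdsGT (zero_lt_one' ℝ)] with x hx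
      rw [e x hx]
  choose B hB1 hB2 using key
  exact ⟨B, fun h y => hB1 y h, hB2⟩

lemma neg_mem_Ioo_pi {y : ℝ} (hy : y ∈ Ioo (-π) π) : -y ∈ Ioo (-π) π :=
  ⟨by linarith [hy.2], by linarith [hy.1]⟩

lemma continuous_uncurry_reflect {F : ℝ → ℝ → ℝ} (hF : Continuous (Function.uncurry F)) :
    Continuous (Function.uncurry fun x y => F x (-y)) :=
  hF.comp (continuous_fst.prodMk continuous_snd.neg)

/-- The even (`σ = 1`) and odd (`σ = -1`) parts of the difference of two solutions. -/
lemma IsSolutionN.exists_reducedSolution (hα0 : 0 < α) (hα1 : α ≤ 1)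
    (hu : IsSolutionN α ε c φ ψ u) (hv : IsSolutionN α ε c φ ψ v) {σ : ℝ} (hσ : σ ^ 2 = 1)
    (hκ : 0 < 1 - ε * σ) :
    ∃ (wy wyy : ℝ → ℝ → ℝ) (B : ℝ → ℝ), ReducedSolution α (1 - ε * σ) c
      (fun x y => (clampFun v x y - clampFun u x y) + σ * (clampFun v x (-y) - clampFun u x (-y)))
      wy wyy B := by
  obtain ⟨Bu, hBu, hpu⟩ := hu.exists_isPrimitivePair hα0 hα1
  obtain ⟨Bv, hBv, hpv⟩ := hv.exists_isPrimitivePair hα0 hα1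
  have hα' : 0 ≤ 1 - α := by linarith
  have cu := continuous_clampFun hu.regular.continuousOn
  have cv := continuous_clampFun hv.regular.continuousOn
  have cuy := continuous_clampFun hu.uy_continuousOn
  have cvy := continuous_clampFun hv.uy_continuousOn
  have h0 : ∀ y, clampFun v 0 y = clampFun u 0 y := fun y => by
    have hy := clamp_mem neg_pi_le_pi y
    rw [clampFun, clampFun, clamp_of_mem ⟨le_rfl, zero_le_one⟩, hu.left _ hy, hv.left _ hy]
  have h1 : ∀ y, clampFun v 1 y = clampFun u 1 y := fun y => by
    have hy := clamp_mem neg_pi_le_pi y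
    rw [clampFun, clampFun, clamp_of_mem ⟨zero_le_one, le_rfl⟩, hu.right _ hy, hv.right _ hy]
  have bot : ∀ {u : ℝ → ℝ → ℝ}, IsSolutionN α ε c φ ψ u → ∀ x, clampFun (uyBar u) x (-π) = 0 :=
    fun hu x => by
      rw [clampFun, clamp_of_mem ⟨le_rfl, neg_pi_le_pi⟩, hu.bottom _ (clamp_mem zero_le_one x)]
  have top : ∀ {u : ℝ → ℝ → ℝ}, IsSolutionN α ε c φ ψ u → ∀ x, clampFun (uyBar u) x π = 0 :=
    fun hu x => by
      rw [clampFun, clamp_of_mem ⟨neg_pi_le_pi, le_rfl⟩, hu.top _ (clamp_mem zero_le_one x)]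
  set w : ℝ → ℝ → ℝ := fun x y =>
    (clampFun v x y - clampFun u x y) + σ * (clampFun v x (-y) - clampFun u x (-y)) with hw
  set B : ℝ → ℝ := fun y =>
    1 * (1 * Bv y + -1 * Bu y) + σ * (1 * Bv (-y) + -1 * Bu (-y)) with hB
  have pair : ∀ y ∈ Ioo (-π) π, IsPrimitivePair α (fun s => w s y)
      (fun s => 1 * (1 * dx α (dx α v) s y + -1 * dx α (dx α u) s y)
        + σ * (1 * dx α (dx α v) s (-y) + -1 * dx α (dx α u) s (-y))) (B y) := by
    intro y hy
    have hy' := neg_mem_Ioo_pi hy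
    have hP := ((hpv y hy).linear hα1 (hpu y hy) 1 (-1)).linear hα1
      ((hpv _ hy').linear hα1 (hpu _ hy') 1 (-1)) 1 σ
    have e : (fun s => w s y) = fun s => 1 * (1 * (clampFun v s y - clampFun v 0 y)
        + -1 * (clampFun u s y - clampFun u 0 y)) + σ * (1 * (clampFun v s (-y) - clampFun v 0 (-y))
        + -1 * (clampFun u s (-y) - clampFun u 0 (-y))) := by
      ext s
      simp only [hw]
      rw [h0, h0]
      ring
    rw [e]
    exact hP
  have kInt_eq : ∀ x, 0 < x → ∀ y,
      kInt α w x y = fracInt (1 - α) (fracInt (1 - α) fun s => w s y) x := by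
    intro x hx y
    rw [kInt, fracInt₂_of_nonneg hx.le]
    exact fracInt_congr hα' hx fun s hs => fracInt₂_of_nonneg hs.1.le _ _ _
  refine ⟨fun x y => (clampFun (uyBar v) x y - clampFun (uyBar u) x y)
      - σ * (clampFun (uyBar v) x (-y) - clampFun (uyBar u) x (-y)),
    fun x y => (uyy v x y - uyy u x y) + σ * (uyy v x (-y) - uyy u x (-y)), B, ?_⟩
  have hneg : ∀ y : ℝ, HasDerivAt (fun y : ℝ => -y) (-1) y := fun y => hasDerivAt_neg y
  refine
    { pos := hα0
      le_one := hα1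
      kappa_pos := hκ
      cont := (cv.sub cu).add (continuous_const.mul
        ((continuous_uncurry_reflect cv).sub (continuous_uncurry_reflect cu)))
      cont_wy := (cvy.sub cuy).sub (continuous_const.mul
        ((continuous_uncurry_reflect cvy).sub (continuous_uncurry_reflect cuy)))
      hasDerivAt := ?_
      hasDerivAt_wy := ?_
      cont_wyy := ?_
      left := ?_
      right := ?_
      bottom := ?_
      top := ?_
      secDiff_eq := ?_
      tendsto := ?_
      eq_zero_of_eq_one := ?_ }
  · intro x y hy
    have hy' := neg_mem_Ioo_pi hy
    have d1 := (hv.hasDerivAt_clampFun x hy).sub (hu.hasDerivAt_clampFun x hy)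
    have d2 := ((hv.hasDerivAt_clampFun x hy').sub (hu.hasDerivAt_clampFun x hy')).comp y (hneg y)
    exact (d1.add (d2.const_mul σ)).congr_deriv (by ring)
  · intro x hx y hy
    have hy' := neg_mem_Ioo_pi hy
    have d1 := (hv.hasDerivAt_clampFun_uyBar hx hy).sub (hu.hasDerivAt_clampFun_uyBar hx hy)
    have d2 := ((hv.hasDerivAt_clampFun_uyBar hx hy').sub
      (hu.hasDerivAt_clampFun_uyBar hx hy')).comp y (hneg y)
    exact (d1.sub (d2.const_mul σ)).congr_deriv (by ring)
  · have c1 := hv.regular.uyy_continuousOn.sub hu.regular.uyy_continuousOn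
    have c2 := c1.comp (f := fun p : ℝ × ℝ => (p.1, -p.2)) (s := Omega) (by fun_prop)
      fun p hp => ⟨hp.1, neg_mem_Ioo_pi hp.2⟩
    exact c1.add (continuousOn_const.mul c2)
  · intro y
    simp only [hw]
    rw [h0, h0]
    ring
  · intro y
    simp only [hw]
    rw [h1, h1]
    ring
  · intro x
    simp only [neg_neg]
    rw [bot hv, bot hu, top hv, top hu]
    ring
  · intro x
    rw [bot hv, bot hu, top hv, top hu]
    ring
  · intro x hx y hy
    refine ((secDiff_congr hx fun s hs => ?_).trans ((pair y hy).secDiff_eq x hx)).trans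
      (secInt_congr hx fun s hs => ?_)
    · rw [kInt_eq s hs.1]
    · have hy' := neg_mem_Ioo_pi hy
      have hs' := Ioo_subset_Icc_self hs
      have e1 := hv.regular.equation s hs y hy
      have e2 := hu.regular.equation s hs y hy
      have e3 := hv.regular.equation s hs _ hy'
      have e4 := hu.regular.equation s hs _ hy'
      rw [neg_neg] at e3 e4
      simp only [hw]
      rw [clampFun_of_mem v hs' (Ioo_subset_Icc_self hy),
        clampFun_of_mem u hs' (Ioo_subset_Icc_self hy),
        clampFun_of_mem v hs' (Ioo_subset_Icc_self hy'),
        clampFun_of_mem u hs' (Ioo_subset_Icc_self hy')]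
      -- The equations at `y` and `-y` are added with weights `1` and `σ`; `σ² = 1` lets the
      -- reflected terms combine into `(1 - εσ)` times `w_yy`.
      linear_combination e1 - e2 + σ * (e3 - e4)
        - ε * (uyy v s (-y) - uyy u s (-y)) * hσ
  · intro h y hy
    refine ((pair y hy).tendsto h).congr' ?_
    filter_upwards [self_mem_nhdsWithin] with x hx
    rw [kInt_eq x hx]
  · intro h y
    simp only [hB]
    rw [hBv h, hBu h, hBv h, hBu h]
    ring

/-- Problem N has at most one solution. -/
theorem IsSolutionN.eq (hα0 : 0 < α) (hα1 : α ≤ 1) (hε : |ε| < 1)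
    (hu : IsSolutionN α ε c φ ψ u) (hv : IsSolutionN α ε c φ ψ v) :
    ∀ x ∈ Icc (0 : ℝ) 1, ∀ y ∈ Icc (-π) π, v x y = u x y := by
  obtain ⟨hε1, hε2⟩ := abs_lt.1 hε
  intro x hx y hy
  rcases hx.1.eq_or_lt with rfl | hx0
  · rw [hu.left y hy, hv.left y hy]
  rcases hx.2.eq_or_lt with rfl | hx1
  · rw [hu.right y hy, hv.right y hy]
  -- The two parities decouple with `κ = 1 - ε` and `κ = 1 + ε`, both positive; the vanishing sum
  -- and difference of `v - u` and its reflection give `v = u`.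
  obtain ⟨_, _, _, he⟩ := hu.exists_reducedSolution hα0 hα1 hv (σ := 1) (by norm_num)
    (by linarith)
  obtain ⟨_, _, _, ho⟩ := hu.exists_reducedSolution hα0 hα1 hv (σ := -1) (by norm_num)
    (by linarith)
  have h1 := he.eq_zero x ⟨hx0, hx1⟩ y hy
  have h2 := ho.eq_zero x ⟨hx0, hx1⟩ y hy
  rw [clampFun_of_mem v hx hy, clampFun_of_mem u hx hy] at h1 h2
  linarith

end Uniqueness

end FracHelmholtz

theorem theorem2 (α ε c : ℝ) (δ : ℝ≥0) (φ ψ : ℝ → ℝ)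
    (hα0 : 0 < α) (hα1 : α ≤ 1) (hε : |ε| < 1) (hδ0 : 0 < δ) (hδ1 : δ < 1)
    (hφ : HolderClass 3 δ φ) (hψ : HolderClass 2 δ ψ)
    (hφl : derivWithin φ (Icc (-π) π) (-π) = 0) (hφr : derivWithin φ (Icc (-π) π) π = 0)
    (hψl : derivWithin ψ (Icc (-π) π) (-π) = 0) (hψr : derivWithin ψ (Icc (-π) π) π = 0) :
    ∃ u : ℝ → ℝ → ℝ,
      IsSolutionN α ε c φ ψ u ∧
      (∀ v : ℝ → ℝ → ℝ, IsSolutionN α ε c φ ψ v →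
        ∀ x ∈ Icc (0 : ℝ) 1, ∀ y ∈ Icc (-π) π, v x y = u x y) ∧
      ∀ x ∈ Icc (0 : ℝ) 1, ∀ y ∈ Icc (-π) π,
        Summable (fun k : ℕ => sinTerm α ε c φ ψ x y k) ∧
        Summable (fun k : ℕ => cosTerm α ε c φ ψ x y (k + 1)) ∧
        u x y = zeroMode α c φ ψ x + ∑' k : ℕ, sinTerm α ε c φ ψ x y k
          + ∑' k : ℕ, cosTerm α ε c φ ψ x y (k + 1) := by
  have hφs := summable_mul_modeCoeff_of_contDiffOn_three hφ.1 hφl hφr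
  have hψs := summable_mul_modeCoeff_of_contDiffOn_two hψ.1 hψl hψr
  have hu := isSolutionN_fourierSol (c := c) hα0 hα1 hε hφ.1.continuousOn hψ.1.continuousOn
    hφs hψs
  exact ⟨fourierSol α ε c φ ψ, hu, fun v hv => hu.eq hα0 hα1 hε hv,
    fun x hx y _ => fourierSol_eq hα0 hα1 hε hφs hψs hx y⟩
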